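/- An allocation instance consists of a finite simple bipartite graph $G=(V,E)$ whose colour classes are the jobs and the machines, real quotas $q(v)\ge 0$ on the vertices, real capacities $c(e)\ge 0$ on the edges, and for each vertex $v$ a strict ranking $\mathrm{rank}_v$ of its incident edges (a smaller rank is better). A feasible allocation is a function $x:E\to\mathbb{R}_{\ge 0}$ with $x(e)\le c(e)$ for every edge $e$ and $x(v):=\sum_{e\ni v}x(e)\le q(v)$ for every vertex $v$. An edge $jm$ blocks $x$ if $x(jm)<c(jm)$ and, for each end vertex $v\in\{j,m\}$, either $x(v)<q(v)$ or $v$ prefers $jm$ to its worst edge with positive value in $x$. A feasible allocation is stable if no edge blocks it. A better-response step turns a feasible allocation into another one by increasing the value of one blocking edge $jm$, possibly decreasing the values of edges at $j$ that $j$ likes less than $jm$ and of edges at $m$ that $m$ likes less than $jm$, and changing nothing else. The model of computation is a real random access machine with unit cost per operation: it stores natural numbers and real numbers in arrays whose cells are addressed by natural numbers, it adds, subtracts (truncated at zero for natural numbers) and compares natural numbers, it adds, subtracts and compares real numbers, and it writes output symbols. The input consists of the numbers of jobs, machines and edges, the end vertices of the edges with the ranks of the edges there, the quotas, the capacities and the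 values of $x$. A sequence of better-response steps is output by listing, for each step, the changed edges with their new values and then the blocking edge. Theorem. There are a program for this machine and a constant $C$ such that, for every allocation instance with arbitrary real data and every feasible allocation $x$ of it, the program halts after at most $C\,(|V|^2|E|+1)$ operations, and its output is a (finite, possibly empty) sequence of better-response steps that leads from $x$ to a stable allocation. In other words, for every real-valued allocation instance and every given feasible allocation there is a sequence of better-response steps that reaches a stable allocation, and it is computed in $O(|V|^2|E|)$ time. -/

import Mathlib

namespace StableAllocation

/-! ## Allocation instances, stability and better response steps -/

/-- A real-valued stable allocation instance `(G, q, c, O)`. The graph `G` is a finite simple bipartite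
graph with jobs `Fin nJ`, machines `Fin nM` and edges `Fin nE`; edge `e` joins `job e` to `mach e`.
The preference lists are given by the rank of each edge at its job (`rankJ`) and at its machine
(`rankM`); a smaller rank is better, and edges that share a vertex have distinct ranks there. -/
structure AllocInstance where
  nJ : ℕ
  nM : ℕ
  nE : ℕ
  job : Fin nE → Fin nJ
  mach : Fin nE → Fin nM
  simple : ∀ e f, job e = job f → mach e = mach f → e = f
  cap : Fin nE → ℝ
  quotaJ : Fin nJ → ℝ
  quotaM : Fin nM → ℝ
  cap_nonneg : ∀ e, 0 ≤ cap e
  quotaJ_nonneg : ∀ j, 0 ≤ quotaJ j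
  quotaM_nonneg : ∀ m, 0 ≤ quotaM m
  rankJ : Fin nE → ℕ
  rankM : Fin nE → ℕ
  rankJ_strict : ∀ e f, job e = job f → rankJ e = rankJ f → e = f
  rankM_strict : ∀ e f, mach e = mach f → rankM e = rankM f → e = f

namespace AllocInstance

variable (I : AllocInstance)

/-- The total value `x(j)` allocated to job `j`. -/
noncomputable def loadJ (x : Fin I.nE → ℝ) (j : Fin I.nJ) : ℝ :=
  ∑ e : Fin I.nE, if I.job e = j then x e else 0

/-- The total value `x(m)` allocated to machine `m`. -/
noncomputable def loadM (x : Fin I.nE → ℝ) (m : Fin I.nM) : ℝ :=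
  ∑ e : Fin I.nE, if I.mach e = m then x e else 0

/-- `x` is a feasible allocation. -/
def Feasible (x : Fin I.nE → ℝ) : Prop :=
  (∀ e, 0 ≤ x e ∧ x e ≤ I.cap e) ∧
    (∀ j, I.loadJ x j ≤ I.quotaJ j) ∧ (∀ m, I.loadM x m ≤ I.quotaM m)

/-- `e` and `f` share their job, which prefers `e` to `f`. -/
def BetterAtJob (e f : Fin I.nE) : Prop :=
  I.job f = I.job e ∧ I.rankJ e < I.rankJ f

/-- `e` and `f` share their machine, which prefers `e` to `f`. -/
def BetterAtMach (e f : Fin I.nE) : Prop :=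
  I.mach f = I.mach e ∧ I.rankM e < I.rankM f

/-- Edge `e` blocks `x`: it is unsaturated, and each of its end vertices has free quota or
prefers `e` to its worst edge with positive value (that is, to some edge with positive value). -/
def Blocks (x : Fin I.nE → ℝ) (e : Fin I.nE) : Prop :=
  x e < I.cap e ∧
    (I.loadJ x (I.job e) < I.quotaJ (I.job e) ∨ ∃ f, 0 < x f ∧ I.BetterAtJob e f) ∧
    (I.loadM x (I.mach e) < I.quotaM (I.mach e) ∨ ∃ f, 0 < x f ∧ I.BetterAtMach e f)

/-- `x` is a stable allocation. -/
def Stable (x : Fin I.nE → ℝ) : Prop :=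
  I.Feasible x ∧ ∀ e, ¬ I.Blocks x e

/-- `z` arises from `x` by a better response step along `e`: the edge `e` blocks `x`, its value is
raised, its two end vertices may reduce the value of edges that they like less than `e`, nothing
else changes, and the result is feasible. -/
def BetterResponse (x : Fin I.nE → ℝ) (e : Fin I.nE) (z : Fin I.nE → ℝ) : Prop :=
  I.Blocks x e ∧ I.Feasible z ∧ x e < z e ∧
    ∀ f, f ≠ e → z f ≤ x f ∧ (z f < x f → I.BetterAtJob e f ∨ I.BetterAtMach e f)

/-- The list of pairs (number of the blocking edge, resulting allocation) is a sequence of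
better response steps that leads from `x` to `y`. -/
def ResponsePath : (Fin I.nE → ℝ) → List (ℕ × (Fin I.nE → ℝ)) → (Fin I.nE → ℝ) → Prop
  | x, [], y => y = x
  | x, (k, z) :: l, y =>
      (∃ e : Fin I.nE, (e : ℕ) = k ∧ I.BetterResponse x e z) ∧ ResponsePath z l y

end AllocInstance

/-! ## Real random access machine, as a structured programming language with a step count

Memory consists of arrays of natural numbers and arrays of real numbers; a program, being a finite
text, uses finitely many of them. The operations on natural numbers are addition, truncated
subtraction and comparison. The operations on real numbers are addition, subtraction and
comparison. Array cells can be addressed by computed indices. There is a write-only output. -/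

/-- A symbol on the output. `put f v` announces the new value `v` of edge number `f`;
`close e` announces that the values put so far complete a step along edge number `e`. -/
inductive OutSym where
  | put (f : ℕ) (v : ℝ)
  | close (e : ℕ)

/-- A memory state: `nat a i` and `real a i` are the contents of cell `i` of array `a`. -/
structure State where
  nat : ℕ → ℕ → ℕ
  real : ℕ → ℕ → ℝ
  out : List OutSym

/-- Expressions with natural values. -/
inductive NExp where
  | const (k : ℕ)
  | get (a : ℕ) (i : NExp)
  | add (u v : NExp)
  | sub (u v : NExp)

def NExp.eval (s : State) : NExp → ℕ
  | .const k => k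
  | .get a i => s.nat a (i.eval s)
  | .add u v => u.eval s + v.eval s
  | .sub u v => u.eval s - v.eval s

/-- The number of elementary operations in an expression. -/
def NExp.cost : NExp → ℕ
  | .const _ => 1
  | .get _ i => i.cost + 1
  | .add u v => u.cost + v.cost + 1
  | .sub u v => u.cost + v.cost + 1

/-- Expressions with real values. -/
inductive RExp where
  | zero
  | get (a : ℕ) (i : NExp)
  | add (u v : RExp)
  | sub (u v : RExp)

noncomputable def RExp.eval (s : State) : RExp → ℝ
  | .zero => 0
  | .get a i => s.real a (i.eval s)
  | .add u v => u.eval s + v.eval s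
  | .sub u v => u.eval s - v.eval s

/-- The number of elementary operations in an expression. -/
def RExp.cost : RExp → ℕ
  | .zero => 1
  | .get _ i => i.cost + 1
  | .add u v => u.cost + v.cost + 1
  | .sub u v => u.cost + v.cost + 1

/-- Tests. -/
inductive Test where
  | natLt (u v : NExp)
  | natEq (u v : NExp)
  | realLt (u v : RExp)
  | not (b : Test)
  | and (b c : Test)

def Test.Holds (s : State) : Test → Prop
  | .natLt u v => u.eval s < v.eval s
  | .natEq u v => u.eval s = v.eval s
  | .realLt u v => u.eval s < v.eval s
  | .not b => ¬ b.Holds s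
  | .and b c => b.Holds s ∧ c.Holds s

/-- The number of elementary operations in a test. -/
def Test.cost : Test → ℕ
  | .natLt u v => u.cost + v.cost + 1
  | .natEq u v => u.cost + v.cost + 1
  | .realLt u v => u.cost + v.cost + 1
  | .not b => b.cost + 1
  | .and b c => b.cost + c.cost + 1

/-- Programs. -/
inductive Prog where
  | skip
  | setNat (a : ℕ) (i v : NExp)
  | setReal (a : ℕ) (i : NExp) (v : RExp)
  | put (f : NExp) (v : RExp)
  | close (e : NExp)
  | seq (p q : Prog)
  | ite (b : Test) (p q : Prog)
  | loop (b : Test) (p : Prog)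

/-- Overwrite cell `i` of array `a`. -/
def write {α : Type} (mem : ℕ → ℕ → α) (a i : ℕ) (v : α) : ℕ → ℕ → α :=
  fun a' i' => if a' = a ∧ i' = i then v else mem a' i'

/-- `Exec p s t s'`: started in state `s`, program `p` halts after `t` elementary operations, in
state `s'`. `loop b p` repeats `p` as long as `b` holds. -/
inductive Exec : Prog → State → ℕ → State → Prop
  | skip (s : State) : Exec .skip s 1 s
  | setNat (a : ℕ) (i v : NExp) (s : State) :
      Exec (.setNat a i v) s (i.cost + v.cost + 1)
        { s with nat := write s.nat a (i.eval s) (v.eval s) }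
  | setReal (a : ℕ) (i : NExp) (v : RExp) (s : State) :
      Exec (.setReal a i v) s (i.cost + v.cost + 1)
        { s with real := write s.real a (i.eval s) (v.eval s) }
  | put (f : NExp) (v : RExp) (s : State) :
      Exec (.put f v) s (f.cost + v.cost + 1)
        { s with out := s.out ++ [.put (f.eval s) (v.eval s)] }
  | close (e : NExp) (s : State) :
      Exec (.close e) s (e.cost + 1) { s with out := s.out ++ [.close (e.eval s)] }
  | seq {p q : Prog} {s s₁ s₂ : State} {t₁ t₂ : ℕ} (h₁ : Exec p s t₁ s₁) (h₂ : Exec q s₁ t₂ s₂) :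
      Exec (.seq p q) s (t₁ + t₂) s₂
  | iteTrue {b : Test} {p q : Prog} {s s' : State} {t : ℕ} (hb : b.Holds s) (h : Exec p s t s') :
      Exec (.ite b p q) s (b.cost + 1 + t) s'
  | iteFalse {b : Test} {p q : Prog} {s s' : State} {t : ℕ} (hb : ¬ b.Holds s)
      (h : Exec q s t s') : Exec (.ite b p q) s (b.cost + 1 + t) s'
  | loopTrue {b : Test} {p : Prog} {s s₁ s₂ : State} {t₁ t₂ : ℕ} (hb : b.Holds s)
      (h₁ : Exec p s t₁ s₁) (h₂ : Exec (.loop b p) s₁ t₂ s₂) :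
      Exec (.loop b p) s (b.cost + 1 + t₁ + t₂) s₂
  | loopFalse {b : Test} {p : Prog} {s : State} (hb : ¬ b.Holds s) :
      Exec (.loop b p) s (b.cost + 1) s

/-! ## Input and output of an allocation algorithm -/

/-- The finite sequence `f` followed by zeros. -/
def pad {α : Type} [Zero α] {n : ℕ} (f : Fin n → α) (i : ℕ) : α :=
  if h : i < n then f ⟨i, h⟩ else 0

/-- The initial memory. Array 0 of naturals holds the numbers of jobs, machines and edges; arrays
1 to 4 hold, for each edge, its job, its machine, its rank at its job and its rank at its machine.
Arrays 0 to 3 of reals hold the capacities, the quotas of the jobs, the quotas of the machines and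
the given allocation. All other cells are zero, and the output is empty. -/
noncomputable def inputState (I : AllocInstance) (x : Fin I.nE → ℝ) : State where
  nat a :=
    match a with
    | 0 => pad ![I.nJ, I.nM, I.nE]
    | 1 => pad fun e => (I.job e : ℕ)
    | 2 => pad fun e => (I.mach e : ℕ)
    | 3 => pad I.rankJ
    | 4 => pad I.rankM
    | _ => fun _ => 0
  real a :=
    match a with
    | 0 => pad I.cap
    | 1 => pad I.quotaJ
    | 2 => pad I.quotaM
    | 3 => pad x
    | _ => fun _ => 0
  out := []

/-- The sequence of steps described by an output, read with the current allocation `x`: each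
`put` changes one value of the allocation, each `close e` completes a step along edge number `e`. -/
noncomputable def decode {n : ℕ} : (Fin n → ℝ) → List OutSym → List (ℕ × (Fin n → ℝ))
  | _, [] => []
  | x, .put f v :: l => decode (fun e => if (e : ℕ) = f then v else x e) l
  | x, .close e :: l => (e, x) :: decode x l

end StableAllocation

namespace StableAllocation

/-! ## Reasoning about programs -/

/-! An edge is a candidate if it is unsaturated and its machine has free quota or holds a worse edge
with positive value. A blocking edge is a candidate whose job has free quota or holds a worse
positive edge. Hence an allocation is stable once no job envies (prefers a candidate to one of its
positive edges) and no job is active (has free quota and a candidate); this is `stable_of_envyFree`.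
The algorithm first removes envy and then activity.

While there is envy, one step along an envied candidate empties all worse edges at both its ends and
raises it. The number `phi` of edges that are not worse than some positive edge at their job then
drops (`envy_step`, `phi_lt`), so there are at most |E| such steps.

In an envy-free allocation each job points to its best candidate, its proposal, and a full machine
answers a proposal by refusing its worst positive edge. Refusals lead from job to job. From an
active job this walk ends at a job without a candidate, at a proposal to a machine with free quota,
or in a cycle. The largest amount that fits is pushed along the walk by better-response steps
(`Pushed.step`). In the first two cases (`Pushed.psi_lt_of_none`, `Pushed.raise_of_free`) the active
job becomes full, a proposal is saturated, a refused edge becomes empty or a machine becomes full.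
In the third case filling the active job could merely activate another job, so the cycle is also
rotated, by so much that one of its proposals is saturated or one of its refused edges is emptied
(`Rotation.final`).

Over a whole round only proposals rise, only refused edges fall and full machines stay full. Such
`Moves` create no new candidates and no envy (`Moves.cand`, `Moves.envyFree`), and the potential
`psi` drops (`Moves.psi_lt`, `Moves.psi_lt_of_active`). So there are O(|V|+|E|) rounds. A round has
no nested loops and costs O(|V|+|E|). Since |E| ≤ |V|² in a simple graph, the total is O(|V|²|E|) as
soon as there is an edge.

The program is verified with a time-bounded program logic (`Runs`), in which whatever the text of a
program cannot change is preserved automatically (`Exec.frame`). -/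

/-- A bound for the number of operations of a program all of whose loops take at most `N` rounds. -/
def Prog.bound (N : ℕ) : Prog → ℕ
  | .skip => 1
  | .setNat _ i v => i.cost + v.cost + 1
  | .setReal _ i v => i.cost + v.cost + 1
  | .put f v => f.cost + v.cost + 1
  | .close e => e.cost + 1
  | .seq p q => p.bound N + q.bound N
  | .ite b p q => b.cost + 1 + (p.bound N + q.bound N)
  | .loop b p => N * (b.cost + 1 + p.bound N) + (b.cost + 1)

/-- The largest number of nested loops. -/
def Prog.depth : Prog → ℕ
  | .seq p q => max p.depth q.depth
  | .ite _ p q => max p.depth q.depth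
  | .loop _ p => p.depth + 1
  | _ => 0

theorem Prog.bound_of_depth_zero (N : ℕ) : ∀ p : Prog, p.depth = 0 → p.bound N = p.bound 1
  | .skip, _ => rfl
  | .setNat .., _ => rfl
  | .setReal .., _ => rfl
  | .put .., _ => rfl
  | .close _, _ => rfl
  | .seq p q, h => by
      simp only [Prog.depth, Nat.max_eq_zero_iff] at h
      simp only [Prog.bound, bound_of_depth_zero N p h.1, bound_of_depth_zero N q h.2]
  | .ite b p q, h => by
      simp only [Prog.depth, Nat.max_eq_zero_iff] at h
      simp only [Prog.bound, bound_of_depth_zero N p h.1, bound_of_depth_zero N q h.2]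
  | .loop b p, h => by simp [Prog.depth] at h

/-- Without nested loops every factor `N` occurs to the first power, so for a fixed program the
bound is linear in `N`. This makes a round of the algorithm cost O(|V|+|E|). -/
theorem Prog.bound_le_of_depth_le_one (N : ℕ) :
    ∀ p : Prog, p.depth ≤ 1 → p.bound N ≤ p.bound 1 * (N + 1)
  | .skip, _ => by simp only [Prog.bound]; nlinarith
  | .setNat .., _ => by simp only [Prog.bound]; nlinarith
  | .setReal .., _ => by simp only [Prog.bound]; nlinarith
  | .put .., _ => by simp only [Prog.bound]; nlinarith
  | .close _, _ => by simp only [Prog.bound]; nlinarith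
  | .seq p q, h => by
      simp only [Prog.depth, max_le_iff] at h
      have := bound_le_of_depth_le_one N p h.1
      have := bound_le_of_depth_le_one N q h.2
      simp only [Prog.bound]; nlinarith
  | .ite b p q, h => by
      simp only [Prog.depth, max_le_iff] at h
      have := bound_le_of_depth_le_one N p h.1
      have := bound_le_of_depth_le_one N q h.2
      simp only [Prog.bound]; nlinarith [Nat.zero_le (b.cost * N)]
  | .loop b p, h => by
      replace h : p.depth = 0 := by simpa [Prog.depth] using h
      simp only [Prog.bound, bound_of_depth_zero N p h]
      nlinarith [Nat.zero_le (b.cost * N)]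

/-! ### Syntactic frame conditions -/

/-- The program contains an assignment to the array `a` of natural numbers. -/
def Prog.setsNat (a : ℕ) : Prog → Bool
  | .setNat b _ _ => a == b
  | .seq p q => p.setsNat a || q.setsNat a
  | .ite _ p q => p.setsNat a || q.setsNat a
  | .loop _ p => p.setsNat a
  | _ => false

/-- The program contains an assignment to the array `a` of real numbers. -/
def Prog.setsReal (a : ℕ) : Prog → Bool
  | .setReal b _ _ => a == b
  | .seq p q => p.setsReal a || q.setsReal a
  | .ite _ p q => p.setsReal a || q.setsReal a
  | .loop _ p => p.setsReal a
  | _ => false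

/-- The program contains an output command. -/
def Prog.writes : Prog → Bool
  | .put .. => true
  | .close _ => true
  | .seq p q => p.writes || q.writes
  | .ite _ p q => p.writes || q.writes
  | .loop _ p => p.writes
  | _ => false

/-- The states `s` and `s'` agree in everything that the text of `p` does not change. -/
structure Frame (p : Prog) (s s' : State) : Prop where
  nat : ∀ a, p.setsNat a = false → s'.nat a = s.nat a
  real : ∀ a, p.setsReal a = false → s'.real a = s.real a
  out : p.writes = false → s'.out = s.out

theorem Frame.refl (p : Prog) (s : State) : Frame p s s :=
  ⟨fun _ _ => rfl, fun _ _ => rfl, fun _ => rfl⟩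

theorem Frame.trans {p : Prog} {s s' s'' : State} (h : Frame p s s') (h' : Frame p s' s'') :
    Frame p s s'' :=
  ⟨fun a ha => (h'.nat a ha).trans (h.nat a ha), fun a ha => (h'.real a ha).trans (h.real a ha),
    fun ha => (h'.out ha).trans (h.out ha)⟩

theorem Frame.of_imp {p q : Prog} {s s' : State} (h : Frame p s s')
    (hN : ∀ a, q.setsNat a = false → p.setsNat a = false)
    (hR : ∀ a, q.setsReal a = false → p.setsReal a = false)
    (hW : q.writes = false → p.writes = false) : Frame q s s' :=
  ⟨fun a ha => h.nat a (hN a ha), fun a ha => h.real a (hR a ha), fun ha => h.out (hW ha)⟩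

theorem Frame.seq_left {p : Prog} {s s' : State} (h : Frame p s s') (q : Prog) :
    Frame (.seq p q) s s' := by
  refine h.of_imp ?_ ?_ ?_ <;> simp +contextual [Prog.setsNat, Prog.setsReal, Prog.writes]

theorem Frame.seq_right {q : Prog} {s s' : State} (h : Frame q s s') (p : Prog) :
    Frame (.seq p q) s s' := by
  refine h.of_imp ?_ ?_ ?_ <;> simp +contextual [Prog.setsNat, Prog.setsReal, Prog.writes]

theorem write_eq {α : Type} (mem : ℕ → ℕ → α) (a i : ℕ) (v : α) (b : ℕ) :
    write mem a i v b = if b = a then Function.update (mem b) i v else mem b := by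
  funext k
  by_cases h : b = a <;> simp [write, h, Function.update_apply]

/-- Specifications need to mention only what changes: the rest is a Boolean computation on the
program text, usually settled by `rfl`. -/
theorem Exec.frame {p : Prog} {s s' : State} {t : ℕ} (h : Exec p s t s') : Frame p s s' := by
  induction h with
  | skip s => exact .refl _ _
  | setNat a i v s =>
    refine ⟨fun b hb => ?_, fun _ _ => rfl, fun _ => rfl⟩
    have : b ≠ a := by simpa [Prog.setsNat] using hb
    simp [write_eq, this]
  | setReal a i v s =>
    refine ⟨fun _ _ => rfl, fun b hb => ?_, fun _ => rfl⟩
    have : b ≠ a := by simpa [Prog.setsReal] using hb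
    simp [write_eq, this]
  | put f v s => exact ⟨fun _ _ => rfl, fun _ _ => rfl, fun h => by simp [Prog.writes] at h⟩
  | close e s => exact ⟨fun _ _ => rfl, fun _ _ => rfl, fun h => by simp [Prog.writes] at h⟩
  | seq _ _ ih₁ ih₂ => exact (ih₁.seq_left _).trans (ih₂.seq_right _)
  | iteTrue _ _ ih =>
    refine ih.of_imp ?_ ?_ ?_ <;> simp +contextual [Prog.setsNat, Prog.setsReal, Prog.writes]
  | iteFalse _ _ ih =>
    refine ih.of_imp ?_ ?_ ?_ <;> simp +contextual [Prog.setsNat, Prog.setsReal, Prog.writes]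
  | loopTrue _ _ _ ih₁ ih₂ =>
    exact Frame.trans (ih₁.of_imp (fun _ h => h) (fun _ h => h) (fun h => h)) ih₂
  | loopFalse _ => exact .refl _ _

/-! ### Time-bounded program logic -/

/-- Started in `s`, the program halts within its bound, in a state that satisfies `Q`. -/
def Runs (N : ℕ) (p : Prog) (s : State) (Q : State → Prop) : Prop :=
  ∃ t s', Exec p s t s' ∧ t ≤ p.bound N ∧ Q s'

namespace Runs

variable {N : ℕ} {p q : Prog} {b : Test} {s : State} {Q R : State → Prop}

theorem mono (h : Runs N p s R) (hQ : ∀ s', R s' → Frame p s s' → Q s') : Runs N p s Q := by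
  obtain ⟨t, s', h, ht, hR⟩ := h
  exact ⟨t, s', h, ht, hQ s' hR h.frame⟩

theorem skip (h : Q s) : Runs N .skip s Q := ⟨_, _, .skip s, le_rfl, h⟩

theorem setNat {a : ℕ} {i v : NExp}
    (h : Q { s with nat := write s.nat a (i.eval s) (v.eval s) }) :
    Runs N (.setNat a i v) s Q := ⟨_, _, .setNat a i v s, le_rfl, h⟩

theorem setReal {a : ℕ} {i : NExp} {v : RExp}
    (h : Q { s with real := write s.real a (i.eval s) (v.eval s) }) :
    Runs N (.setReal a i v) s Q := ⟨_, _, .setReal a i v s, le_rfl, h⟩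

theorem put {f : NExp} {v : RExp}
    (h : Q { s with out := s.out ++ [.put (f.eval s) (v.eval s)] }) :
    Runs N (.put f v) s Q := ⟨_, _, .put f v s, le_rfl, h⟩

theorem close {e : NExp} (h : Q { s with out := s.out ++ [.close (e.eval s)] }) :
    Runs N (.close e) s Q := ⟨_, _, .close e s, le_rfl, h⟩

theorem seq (h : Runs N p s fun s' => Runs N q s' Q) : Runs N (.seq p q) s Q := by
  obtain ⟨t, s', h, ht, t', s'', h', ht', hQ⟩ := h
  exact ⟨_, _, .seq h h', Nat.add_le_add ht ht', hQ⟩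

theorem seq_of (h : Runs N p s R) (h' : ∀ s', R s' → Frame p s s' → Runs N q s' Q) :
    Runs N (.seq p q) s Q :=
  seq (h.mono h')

theorem ite (h : b.Holds s → Runs N p s Q) (h' : ¬ b.Holds s → Runs N q s Q) :
    Runs N (.ite b p q) s Q := by
  by_cases hb : b.Holds s
  · obtain ⟨t, s', h, ht, hQ⟩ := h hb
    exact ⟨_, _, .iteTrue hb h, by simp only [Prog.bound]; omega, hQ⟩
  · obtain ⟨t, s', h, ht, hQ⟩ := h' hb
    exact ⟨_, _, .iteFalse hb h, by simp only [Prog.bound]; omega, hQ⟩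

/-- The number `K` of rounds is known in advance, and the invariant is indexed by the round. `K ≤ N`
is the only place where time enters, so functional correctness and running time are proved together.
-/
theorem loop (K : ℕ) (hK : K ≤ N) (Inv : ℕ → State → Prop) (h0 : Inv 0 s)
    (hstep : ∀ k < K, ∀ s', Frame p s s' → Inv k s' → b.Holds s' ∧ Runs N p s' (Inv (k + 1)))
    (hend : ∀ s', Frame p s s' → Inv K s' → ¬ b.Holds s' ∧ Q s') : Runs N (.loop b p) s Q := by
  have key : ∀ d k s', k + d = K → Frame p s s' → Inv k s' →
      ∃ t s'', Exec (.loop b p) s' t s'' ∧ t ≤ d * (b.cost + 1 + p.bound N) + (b.cost + 1) ∧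
        Q s'' := by
    intro d
    induction d with
    | zero =>
      intro k s' hk hf hI
      obtain rfl : k = K := by omega
      obtain ⟨hb, hQ⟩ := hend s' hf hI
      exact ⟨_, _, .loopFalse hb, by simp, hQ⟩
    | succ d ih =>
      intro k s' hk hf hI
      obtain ⟨hb, t, s₁, h₁, ht, hI₁⟩ := hstep k (by omega) s' hf hI
      obtain ⟨t', s₂, h₂, ht', hQ⟩ := ih (k + 1) s₁ (by omega) (hf.trans h₁.frame) hI₁
      refine ⟨_, _, .loopTrue hb h₁ h₂, ?_, hQ⟩
      rw [Nat.succ_mul]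
      omega
  obtain ⟨t, s', h, ht, hQ⟩ := key K 0 s (by omega) (.refl _ _) h0
  refine ⟨t, s', h, ht.trans ?_, hQ⟩
  simp only [Prog.bound]
  gcongr

end Runs

/-- Cell 0 of an array of natural numbers, used as a variable. -/
abbrev cell (a : ℕ) : NExp := .get a (.const 0)

/-- Cell 0 of an array of real numbers, used as a variable. -/
abbrev rcell (a : ℕ) : RExp := .get a (.const 0)

/-- `forTo n p` runs `p` with `0, …, n - 1` in the counter, which is cell 0 of array 8. -/
abbrev forTo (n : NExp) (p : Prog) : Prog :=
  .seq (.setNat 8 (.const 0) (.const 0))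
    (.loop (.natLt (cell 8) n) (.seq p (.setNat 8 (.const 0) (.add (cell 8) (.const 1)))))

/-- The upper limit is evaluated anew before every round, so `hn` asks for its value in all states
that the loop can reach. The counter is part of the state, hence the invariant is required after its
update. -/
theorem Runs.forTo {N : ℕ} {n : NExp} {p : Prog} {s : State} {Q : State → Prop} (K : ℕ)
    (hK : K ≤ N) (Inv : ℕ → State → Prop) (hp : p.setsNat 8 = false)
    (hn : ∀ s', Frame (forTo n p) s s' → n.eval s' = K)
    (h0 : Inv 0 { s with nat := write s.nat 8 0 0 })
    (hstep : ∀ k < K, ∀ s', Frame (StableAllocation.forTo n p) s s' → s'.nat 8 0 = k → Inv k s' →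
      Runs N p s' fun s'' => Inv (k + 1) { s'' with nat := write s''.nat 8 0 (k + 1) })
    (hend : ∀ s', Frame (StableAllocation.forTo n p) s s' → Inv K s' → Q s') :
    Runs N (StableAllocation.forTo n p) s Q := by
  refine Runs.seq (Runs.setNat ?_)
  have hf : Frame (StableAllocation.forTo n p) s { s with nat := write s.nat 8 0 0 } := by
    refine ⟨fun a ha => ?_, fun _ _ => rfl, fun _ => rfl⟩
    have : a ≠ 8 := by
      rintro rfl
      simp [Prog.setsNat] at ha
    simp [write_eq, this]
  have hf' : ∀ s', Frame (p.seq (.setNat 8 (.const 0) (.add (cell 8) (.const 1))))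
      { s with nat := write s.nat 8 0 0 } s' → Frame (StableAllocation.forTo n p) s s' := by
    intro s' h
    exact hf.trans (h.of_imp (by simp +contextual [Prog.setsNat])
      (by simp +contextual [Prog.setsReal]) (by simp +contextual [Prog.writes]))
  refine Runs.loop K hK (fun k s' => s'.nat 8 0 = k ∧ Inv k s') ⟨by simp [NExp.eval, write_eq], h0⟩
    ?_ ?_
  · rintro k hk s' hfr ⟨h8, hI⟩
    refine ⟨by simpa [Test.Holds, NExp.eval, h8, hn s' (hf' s' hfr)] using hk, ?_⟩
    refine Runs.seq_of (hstep k hk s' (hf' s' hfr) h8 hI) fun s'' h'' hfr' => Runs.setNat ?_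
    have : s''.nat 8 0 = k := by rw [hfr'.nat 8 hp, h8]
    simp only [NExp.eval, this]
    exact ⟨by simp [write_eq], h''⟩
  · rintro s' hfr ⟨h8, hI⟩
    exact ⟨by simp [Test.Holds, NExp.eval, h8, hn s' (hf' s' hfr)], hend s' (hf' s' hfr) hI⟩

/-- A loop whose rounds decrease a measure. -/
theorem Exec.loop_of_measure {N : ℕ} {b : Test} {p : Prog} {Q : State → Prop}
    (Inv : ℕ → State → Prop) (hb : ∀ k s, Inv k s → b.Holds s)
    (hstep : ∀ k s, Inv k s →
      Runs N p s fun s' => (¬ b.Holds s' ∧ Q s') ∨ ∃ k' < k, Inv k' s') :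
    ∀ k s, Inv k s → ∃ t s', Exec (.loop b p) s t s' ∧
      t ≤ (k + 2) * (b.cost + 1 + p.bound N) ∧ Q s' := by
  intro k
  induction k using Nat.strong_induction_on with
  | _ k ih =>
    intro s hI
    obtain ⟨t, s₁, h₁, ht, h⟩ := hstep k s hI
    obtain ⟨hb₁, hQ⟩ | ⟨k', hk', hI₁⟩ := h
    · refine ⟨_, _, .loopTrue (hb k s hI) h₁ (.loopFalse hb₁), ?_, hQ⟩
      nlinarith [Nat.zero_le (k * (b.cost + 1 + p.bound N))]
    · obtain ⟨t', s₂, h₂, ht', hQ⟩ := ih k' hk' s₁ hI₁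
      -- Measure `k` allows at most `k + 1` rounds; the failing last test accounts for the second
      -- unit in `k + 2`.
      refine ⟨_, _, .loopTrue (hb k s hI) h₁ h₂, ?_, hQ⟩
      have : (k' + 2) * (b.cost + 1 + p.bound N) ≤ (k + 1) * (b.cost + 1 + p.bound N) :=
        Nat.mul_le_mul_right _ (by omega)
      rw [show k + 2 = k + 1 + 1 from rfl, Nat.succ_mul]
      omega

/-- Disjunction of tests. -/
def Test.or (b c : Test) : Test := .not (.and (.not b) (.not c))

theorem Test.holds_or {b c : Test} {s : State} : (b.or c).Holds s ↔ b.Holds s ∨ c.Holds s := by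
  simp only [Test.or, Test.Holds]; tauto

/-! ## Combinatorics of allocations -/

namespace AllocInstance

variable {I : AllocInstance} {x y z : Fin I.nE → ℝ}

/-- The machine of `e` has free quota or prefers `e` to some edge with positive value. -/
def Wanted (I : AllocInstance) (x : Fin I.nE → ℝ) (e : Fin I.nE) : Prop :=
  I.loadM x (I.mach e) < I.quotaM (I.mach e) ∨ ∃ f, 0 < x f ∧ I.BetterAtMach e f

/-- Edge `e` is unsaturated and wanted by its machine. -/
def Cand (I : AllocInstance) (x : Fin I.nE → ℝ) (e : Fin I.nE) : Prop :=
  x e < I.cap e ∧ I.Wanted x e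

/-- No job prefers a candidate edge to an edge with positive value. -/
def EnvyFree (I : AllocInstance) (x : Fin I.nE → ℝ) : Prop :=
  ∀ e f, I.Cand x e → I.BetterAtJob e f → ¬ 0 < x f

/-- Job `j` has free quota and a candidate edge. -/
def Active (I : AllocInstance) (x : Fin I.nE → ℝ) (j : Fin I.nJ) : Prop :=
  I.loadJ x j < I.quotaJ j ∧ ∃ e, I.job e = j ∧ I.Cand x e

/-- A blocking edge is a candidate; its job either has free quota, and is then active, or holds a
worse positive edge, which is envy. -/
theorem stable_of_envyFree (hx : I.Feasible x) (h : I.EnvyFree x) (ha : ∀ j, ¬ I.Active x j) :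
    I.Stable x := by
  refine ⟨hx, fun e he => ?_⟩
  obtain ⟨hc, hJ | ⟨f, hf, hb⟩, hM⟩ := he
  · exact ha _ ⟨hJ, e, rfl, hc, hM⟩
  · exact h e f ⟨hc, hM⟩ hb hf

theorem sum_ite_update {n : ℕ} (p : Fin n → Prop) [DecidablePred p] (x : Fin n → ℝ) (e : Fin n)
    (v : ℝ) : (∑ g, if p g then Function.update x e v g else 0) =
      (∑ g, if p g then x g else 0) + if p e then v - x e else 0 := by
  have h : ∀ g, (if p g then Function.update x e v g else 0) =
      (if p g then x g else 0) + if g = e then (if p e then v - x e else 0) else 0 := by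
    intro g
    by_cases hg : g = e
    · subst hg; by_cases hp : p g <;> simp [hp]
    · simp [hg]
  simp only [h, Finset.sum_add_distrib, Finset.sum_ite_eq', Finset.mem_univ, if_true]

theorem loadJ_update (x : Fin I.nE → ℝ) (e : Fin I.nE) (v : ℝ) (j : Fin I.nJ) :
    I.loadJ (Function.update x e v) j = I.loadJ x j + if I.job e = j then v - x e else 0 :=
  sum_ite_update (fun g => I.job g = j) x e v

theorem loadM_update (x : Fin I.nE → ℝ) (e : Fin I.nE) (v : ℝ) (m : Fin I.nM) :
    I.loadM (Function.update x e v) m = I.loadM x m + if I.mach e = m then v - x e else 0 :=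
  sum_ite_update (fun g => I.mach g = m) x e v

/-- Raise `e` by `α` and lower `f` by `β`. -/
noncomputable def shift (z : Fin I.nE → ℝ) (e f : Fin I.nE) (α β : ℝ) : Fin I.nE → ℝ :=
  Function.update (Function.update z e (z e + α)) f (z f - β)

/-- Raise `e` by `α`. -/
noncomputable def raise (z : Fin I.nE → ℝ) (e : Fin I.nE) (α : ℝ) : Fin I.nE → ℝ :=
  Function.update z e (z e + α)

theorem BetterAtMach.ne {e f : Fin I.nE} (h : I.BetterAtMach e f) : f ≠ e := by
  rintro rfl; exact lt_irrefl _ h.2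

theorem shift_left {e f : Fin I.nE} (h : f ≠ e) (z : Fin I.nE → ℝ) (α β : ℝ) :
    shift z e f α β e = z e + α := by
  simp [shift, Function.update_of_ne h.symm]

theorem shift_right (z : Fin I.nE → ℝ) (e f : Fin I.nE) (α β : ℝ) :
    shift z e f α β f = z f - β := by
  simp [shift]

theorem shift_of_ne {e f g : Fin I.nE} (he : g ≠ e) (hf : g ≠ f) (z : Fin I.nE → ℝ) (α β : ℝ) :
    shift z e f α β g = z g := by
  simp [shift, he, hf]

theorem loadJ_shift {e f : Fin I.nE} (h : f ≠ e) (z : Fin I.nE → ℝ) (α β : ℝ) (j : Fin I.nJ) :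
    I.loadJ (shift z e f α β) j =
      I.loadJ z j + (if I.job e = j then α else 0) - if I.job f = j then β else 0 := by
  simp only [shift, loadJ_update, Function.update_of_ne h]
  split_ifs <;> ring

theorem loadM_shift {e f : Fin I.nE} (h : f ≠ e) (z : Fin I.nE → ℝ) (α β : ℝ) (m : Fin I.nM) :
    I.loadM (shift z e f α β) m =
      I.loadM z m + (if I.mach e = m then α else 0) - if I.mach f = m then β else 0 := by
  simp only [shift, loadM_update, Function.update_of_ne h]
  split_ifs <;> ring

theorem loadJ_raise (z : Fin I.nE → ℝ) (e : Fin I.nE) (α : ℝ) (j : Fin I.nJ) :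
    I.loadJ (raise z e α) j = I.loadJ z j + if I.job e = j then α else 0 := by
  simp [raise, loadJ_update]

theorem loadM_raise (z : Fin I.nE → ℝ) (e : Fin I.nE) (α : ℝ) (m : Fin I.nM) :
    I.loadM (raise z e α) m = I.loadM z m + if I.mach e = m then α else 0 := by
  simp [raise, loadM_update]

/-- The two amounts may differ because the first step of a rotation may lower the refused edge by
more than it can yet raise the proposal. -/
theorem betterResponse_shift {e f : Fin I.nE} {α β : ℝ} (hz : I.Feasible z) (hα : 0 < α)
    (hβ : 0 ≤ β) (hcap : z e + α ≤ I.cap e) (hf : I.BetterAtMach e f) (hβf : β ≤ z f)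
    (hzf : 0 < z f) (hJ : I.loadJ z (I.job e) + α ≤ I.quotaJ (I.job e))
    (hM : I.loadM z (I.mach e) + α - β ≤ I.quotaM (I.mach e)) :
    I.BetterResponse z e (shift z e f α β) := by
  have hne := hf.ne
  refine ⟨⟨by linarith, Or.inl (by linarith), Or.inr ⟨f, hzf, hf⟩⟩, ⟨fun g => ?_, fun j => ?_,
    fun m => ?_⟩, by rw [shift_left hne]; linarith, fun g hg => ?_⟩
  · by_cases hgf : g = f
    · subst hgf
      rw [shift_right]
      exact ⟨by linarith, by linarith [(hz.1 g).2]⟩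
    · by_cases hge : g = e
      · subst hge
        rw [shift_left hne]
        exact ⟨by linarith [(hz.1 g).1], hcap⟩
      · rw [shift_of_ne hge hgf]; exact hz.1 g
  · rw [loadJ_shift hne]
    have := hz.2.1 j
    split_ifs with h1 h2
    · subst h1; linarith
    · subst h1; linarith
    · linarith
    · linarith
  · rw [loadM_shift hne, hf.1]
    have := hz.2.2 m
    split_ifs with h1
    · subst h1; exact hM
    · linarith
  · by_cases hgf : g = f
    · subst hgf
      rw [shift_right]
      exact ⟨by linarith, fun _ => Or.inr hf⟩
    · rw [shift_of_ne hg hgf]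
      exact ⟨le_rfl, fun h => absurd h (lt_irrefl _)⟩

theorem betterResponse_raise {e : Fin I.nE} {α : ℝ} (hz : I.Feasible z) (hα : 0 < α)
    (hcap : z e + α ≤ I.cap e) (hJ : I.loadJ z (I.job e) + α ≤ I.quotaJ (I.job e))
    (hM : I.loadM z (I.mach e) + α ≤ I.quotaM (I.mach e)) :
    I.BetterResponse z e (raise z e α) := by
  refine ⟨⟨by linarith, Or.inl (by linarith), Or.inl (by linarith)⟩, ⟨fun g => ?_, fun j => ?_,
    fun m => ?_⟩, by simp [raise, hα], fun g hg => ?_⟩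
  · by_cases hge : g = e
    · subst hge
      simp only [raise, Function.update_self]
      exact ⟨by linarith [(hz.1 g).1], hcap⟩
    · simp only [raise, Function.update_of_ne hge]; exact hz.1 g
  · rw [loadJ_raise]
    split_ifs with h1
    · subst h1; exact hJ
    · linarith [hz.2.1 j]
  · rw [loadM_raise]
    split_ifs with h1
    · subst h1; exact hM
    · linarith [hz.2.2 m]
  · simp only [raise, Function.update_of_ne hg]
    exact ⟨le_rfl, fun h => absurd h (lt_irrefl _)⟩

/-! ### Proposals and refusals -/

/-- `P j` is the best candidate edge of job `j`. If its machine is full then `F j` is the worst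
edge with positive value at that machine. -/
structure Pointers (I : AllocInstance) (x : Fin I.nE → ℝ)
    (P F : Fin I.nJ → Option (Fin I.nE)) : Prop where
  job_eq : ∀ {j e}, P j = some e → I.job e = j
  cand : ∀ {j e}, P j = some e → I.Cand x e
  best : ∀ {j e}, P j = some e → ∀ e', I.job e' = j → I.Cand x e' → I.rankJ e ≤ I.rankJ e'
  not_cand : ∀ {j}, P j = none → ∀ e, I.job e = j → ¬ I.Cand x e
  exists_of_some : ∀ {j f}, F j = some f → ∃ e, P j = some e ∧ I.mach f = I.mach e
  full : ∀ {j f}, F j = some f → I.loadM x (I.mach f) = I.quotaM (I.mach f)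
  pos : ∀ {j f}, F j = some f → 0 < x f
  worst : ∀ {j f}, F j = some f → ∀ g, I.mach g = I.mach f → 0 < x g → I.rankM g ≤ I.rankM f
  free : ∀ {j e}, F j = none → P j = some e → I.loadM x (I.mach e) < I.quotaM (I.mach e)

variable {P F : Fin I.nJ → Option (Fin I.nE)}

namespace Pointers

/-- A refused edge is the worst positive edge of a full machine, so both ways of being wanted fail.
-/
theorem not_wanted (hp : I.Pointers x P F) {j : Fin I.nJ} {f : Fin I.nE} (h : F j = some f) :
    ¬ I.Wanted x f := by
  rintro (h' | ⟨g, hg, hb⟩)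
  · exact h'.ne (hp.full h)
  · exact absurd (hp.worst h g hb.1 hg) (not_le.2 hb.2)

/-- Proposals are wanted and refused edges are not. This disjointness, even across different jobs,
keeps the raised and the lowered edges of a round apart. -/
theorem ne (hp : I.Pointers x P F) {j j' : Fin I.nJ} {e f : Fin I.nE} (h : P j = some e)
    (h' : F j' = some f) : f ≠ e := by
  rintro rfl; exact hp.not_wanted h' (hp.cand h).2

theorem better (hp : I.Pointers x P F) {j : Fin I.nJ} {e f : Fin I.nE} (h : P j = some e)
    (h' : F j = some f) : I.BetterAtMach e f := by
  obtain ⟨e', he', hm⟩ := hp.exists_of_some h'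
  obtain rfl : e = e' := by simpa [h] using he'
  refine ⟨hm, ?_⟩
  obtain hw | ⟨g, hg, hb⟩ := (hp.cand h).2
  · exact absurd hw (by rw [← hm]; exact (hp.full h').not_lt)
  · exact hb.2.trans_le (hp.worst h' g (hb.1.trans hm.symm) hg)

/-- The proposal and the refused edge share their machine; with a common job they would coincide by
simplicity of the graph. -/
theorem job_ne (hp : I.Pointers x P F) {j : Fin I.nJ} {f : Fin I.nE} (h' : F j = some f) :
    I.job f ≠ j := by
  obtain ⟨e, he, hm⟩ := hp.exists_of_some h'
  intro h
  exact hp.ne he h' (I.simple _ _ (h.trans (hp.job_eq he).symm) hm)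

end Pointers

/-- Going from `x` to `y`, only proposed edges are raised and only refused edges are lowered. -/
structure Shape (I : AllocInstance) (P F : Fin I.nJ → Option (Fin I.nE))
    (x y : Fin I.nE → ℝ) : Prop where
  up : ∀ g, x g < y g → ∃ j, P j = some g
  down : ∀ g, y g < x g → ∃ j, F j = some g

namespace Shape

theorem trans (h : I.Shape P F x y) (h' : I.Shape P F y z) : I.Shape P F x z := by
  refine ⟨fun g hg => ?_, fun g hg => ?_⟩
  · rcases lt_or_ge (x g) (y g) with h1 | h1
    · exact h.up g h1
    · exact h'.up g (by linarith)
  · rcases lt_or_ge (y g) (x g) with h1 | h1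
    · exact h.down g h1
    · exact h'.down g (by linarith)

theorem le_of_pointer {w : Fin I.nE → ℝ} (h : I.Shape P F x y) (hp : I.Pointers w P F)
    {j : Fin I.nJ} {e : Fin I.nE} (he : P j = some e) : x e ≤ y e := by
  by_contra hlt
  obtain ⟨j', hj'⟩ := h.down e (not_le.1 hlt)
  exact hp.ne he hj' rfl

theorem ge_of_pointer {w : Fin I.nE → ℝ} (h : I.Shape P F x y) (hp : I.Pointers w P F)
    {j : Fin I.nJ} {f : Fin I.nE} (hf : F j = some f) : y f ≤ x f := by
  by_contra hlt
  obtain ⟨j', hj'⟩ := h.up f (not_le.1 hlt)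
  exact hp.ne hj' hf rfl

end Shape

/-- Going from `x` to `y`, only proposed edges are raised, only refused edges are lowered, and full
machines stay full. -/
structure Moves (I : AllocInstance) (P F : Fin I.nJ → Option (Fin I.nE))
    (x y : Fin I.nE → ℝ) : Prop extends I.Shape P F x y where
  full : ∀ m, I.loadM x m = I.quotaM m → I.loadM y m = I.quotaM m

namespace Moves

/-- Suppose `e` is unwanted at `x`, so that its machine is full there and holds nothing positive
worse than `e`. The machine stays full, so a worse edge `f` has become positive. Then `f` was a
proposal, hence wanted at `x`, and some positive edge was worse than `f` and therefore worse than
`e`. -/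
theorem wanted (h : I.Moves P F x y) (hp : I.Pointers x P F) (hx : I.Feasible x) {e : Fin I.nE}
    (he : I.Wanted y e) : I.Wanted x e := by
  by_contra hn
  simp only [Wanted, not_or, not_exists, not_and] at hn
  have hfull : I.loadM x (I.mach e) = I.quotaM (I.mach e) := le_antisymm (hx.2.2 _) (not_lt.1 hn.1)
  obtain he | ⟨f, hf, hb⟩ := he
  · exact he.ne (h.full _ hfull)
  · have hxf := hn.2 f
    have : x f < y f := lt_of_le_of_lt (not_lt.1 fun h0 => hxf h0 hb) hf
    obtain ⟨j, hj⟩ := h.up f this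
    obtain hw | ⟨g, hg, hb'⟩ := (hp.cand hj).2
    · rw [hb.1, hfull] at hw; exact lt_irrefl _ hw
    · exact hn.2 g hg ⟨hb'.1.trans hb.1, hb.2.trans hb'.2⟩

/-- An edge could become unsaturated only by being lowered, but lowered edges were refused and are
still unwanted. -/
theorem cand (h : I.Moves P F x y) (hp : I.Pointers x P F) (hx : I.Feasible x) {e : Fin I.nE}
    (he : I.Cand y e) : I.Cand x e := by
  have hw := h.wanted hp hx he.2
  refine ⟨?_, hw⟩
  rcases lt_or_ge (y e) (x e) with h1 | h1
  · obtain ⟨j, hj⟩ := h.down e h1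
    exact absurd hw (hp.not_wanted hj)
  · exact h1.trans_lt he.1

/-- Envy at `y` would need a newly positive edge worse than a candidate. Newly positive edges are
proposals, which are the best candidates of their jobs at `x`, and candidates at `y` were candidates
at `x`. -/
theorem envyFree (h : I.Moves P F x y) (hp : I.Pointers x P F) (hx : I.Feasible x)
    (he : I.EnvyFree x) : I.EnvyFree y := by
  intro e f hc hb hf
  have hc' := h.cand hp hx hc
  have : x f < y f := lt_of_le_of_lt (not_lt.1 (he e f hc' hb)) hf
  obtain ⟨j, hj⟩ := h.up f this
  exact absurd (hp.best hj e (hb.1.symm.trans (hp.job_eq hj)) hc') (not_le.2 hb.2)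

end Moves

/-! ### Potentials -/

open Classical in
/-- The candidate edges. -/
noncomputable def candSet (I : AllocInstance) (x : Fin I.nE → ℝ) : Finset (Fin I.nE) :=
  {e | I.Cand x e}

open Classical in
/-- The edges that have positive value or are wanted by their machines. -/
noncomputable def liveSet (I : AllocInstance) (x : Fin I.nE → ℝ) : Finset (Fin I.nE) :=
  {e | 0 < x e ∨ I.Wanted x e}

open Classical in
/-- The machines with free quota. -/
noncomputable def freeSet (I : AllocInstance) (x : Fin I.nE → ℝ) : Finset (Fin I.nM) :=
  {m | I.loadM x m < I.quotaM m}

open Classical in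
/-- The active jobs. -/
noncomputable def activeSet (I : AllocInstance) (x : Fin I.nE → ℝ) : Finset (Fin I.nJ) :=
  {j | I.Active x j}

@[simp] theorem mem_candSet {e : Fin I.nE} : e ∈ I.candSet x ↔ I.Cand x e := by simp [candSet]

@[simp] theorem mem_liveSet {e : Fin I.nE} : e ∈ I.liveSet x ↔ 0 < x e ∨ I.Wanted x e := by
  simp [liveSet]

@[simp] theorem mem_freeSet {m : Fin I.nM} : m ∈ I.freeSet x ↔ I.loadM x m < I.quotaM m := by
  simp [freeSet]

@[simp] theorem mem_activeSet {j : Fin I.nJ} : j ∈ I.activeSet x ↔ I.Active x j := by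
  simp [activeSet]

/-- The potential of an envy-free allocation. -/
noncomputable def psi (I : AllocInstance) (x : Fin I.nE → ℝ) : ℕ :=
  2 * (I.candSet x).card + 2 * (I.liveSet x).card + 2 * (I.freeSet x).card + (I.activeSet x).card

open Classical in
/-- The number of edges that are not worse than some edge with positive value at their job. -/
noncomputable def phi (I : AllocInstance) (x : Fin I.nE → ℝ) : ℕ :=
  ({e | ∃ f, 0 < x f ∧ I.job f = I.job e ∧ I.rankJ e ≤ I.rankJ f} : Finset (Fin I.nE)).card

/-- An upper bound for `psi`. -/
def psiMax (I : AllocInstance) : ℕ := 4 * I.nE + 2 * I.nM + I.nJ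

theorem psi_le (x : Fin I.nE → ℝ) : I.psi x ≤ I.psiMax := by
  have h : ∀ {n : ℕ} (s : Finset (Fin n)), s.card ≤ n := fun s => by
    simpa using Finset.card_le_univ s
  have := h (I.candSet x)
  have := h (I.liveSet x)
  have := h (I.freeSet x)
  have := h (I.activeSet x)
  unfold psi psiMax
  omega

theorem phi_le (x : Fin I.nE → ℝ) : I.phi x ≤ I.nE := by
  unfold phi
  simpa using Finset.card_le_univ (α := Fin I.nE) _

open Classical in
/-- The measure of progress of the algorithm. -/
noncomputable def measure (I : AllocInstance) (x : Fin I.nE → ℝ) : ℕ :=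
  if I.EnvyFree x then I.psi x else I.psiMax + 1 + I.phi x

theorem measure_le (x : Fin I.nE → ℝ) : I.measure x ≤ I.psiMax + 1 + I.nE := by
  unfold measure
  have := psi_le x
  have := phi_le x
  split_ifs <;> omega

namespace Moves

theorem candSet_subset (h : I.Moves P F x y) (hp : I.Pointers x P F) (hx : I.Feasible x) :
    I.candSet y ⊆ I.candSet x := by
  intro e; simpa using h.cand hp hx

theorem liveSet_subset (h : I.Moves P F x y) (hp : I.Pointers x P F) (hx : I.Feasible x) :
    I.liveSet y ⊆ I.liveSet x := by
  intro e
  simp only [mem_liveSet]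
  rintro (he | he)
  · rcases lt_or_ge (x e) (y e) with h1 | h1
    · obtain ⟨j, hj⟩ := h.up e h1
      exact Or.inr (hp.cand hj).2
    · exact Or.inl (he.trans_le h1)
  · exact Or.inr (h.wanted hp hx he)

theorem freeSet_subset (h : I.Moves P F x y) (hx : I.Feasible x) :
    I.freeSet y ⊆ I.freeSet x := by
  intro m
  simp only [mem_freeSet]
  exact fun hm => lt_of_le_of_ne (hx.2.2 m) fun he => hm.ne (h.full m he)

/-- Only `T` loses load, so at most one job becomes active and costs 1. The event pays 2: a
saturated proposal leaves `candSet`, an emptied refused edge leaves `liveSet` because it is also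
unwanted, and a filled machine leaves `freeSet`. This explains the weights in `psi`. -/
theorem psi_lt (h : I.Moves P F x y) (hp : I.Pointers x P F) (hx : I.Feasible x)
    (T : Fin I.nJ) (hT : ∀ j, j ≠ T → I.loadJ x j ≤ I.loadJ y j)
    (hev : (∃ j e, P j = some e ∧ I.cap e ≤ y e) ∨ (∃ j f, F j = some f ∧ y f ≤ 0) ∨
      ∃ m, I.loadM x m < I.quotaM m ∧ I.quotaM m ≤ I.loadM y m) : I.psi y < I.psi x := by
  have h1 := h.candSet_subset hp hx
  have h2 := h.liveSet_subset hp hx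
  have h3 := h.freeSet_subset hx
  have h4 : I.activeSet y ⊆ insert T (I.activeSet x) := by
    intro j
    simp only [Finset.mem_insert, mem_activeSet]
    rintro ⟨hq, e, he, hc⟩
    by_cases hj : j = T
    · exact Or.inl hj
    · exact Or.inr ⟨(hT j hj).trans_lt hq, e, he, h.cand hp hx hc⟩
  have c1 := Finset.card_le_card h1
  have c2 := Finset.card_le_card h2
  have c3 := Finset.card_le_card h3
  have c4 := (Finset.card_le_card h4).trans (Finset.card_insert_le _ _)
  unfold psi
  rcases hev with ⟨j, e, hj, he⟩ | ⟨j, f, hj, hf⟩ | ⟨m, hm, hm'⟩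
  · have := Finset.card_lt_card ((Finset.ssubset_iff_of_subset h1).2 ⟨e, mem_candSet.2 (hp.cand hj),
      fun hc => absurd (mem_candSet.1 hc).1 (not_lt.2 he)⟩)
    omega
  · have := Finset.card_lt_card ((Finset.ssubset_iff_of_subset h2).2 ⟨f,
      mem_liveSet.2 (Or.inl (hp.pos hj)), fun hc => (mem_liveSet.1 hc).elim (fun h0 => by linarith)
        fun hw => hp.not_wanted hj (h.wanted hp hx hw)⟩)
    omega
  · have := Finset.card_lt_card ((Finset.ssubset_iff_of_subset h3).2 ⟨m, mem_freeSet.2 hm,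
      fun hc => absurd (mem_freeSet.1 hc) (not_lt.2 hm')⟩)
    omega

/-- The active job `j₀` becomes full, and nobody replaces it: any other job that loses load has no
candidate at `x`, hence none at `y`. -/
theorem psi_lt_of_active (h : I.Moves P F x y) (hp : I.Pointers x P F) (hx : I.Feasible x)
    (j₀ : Fin I.nJ) (hj₀ : I.Active x j₀) (hq : I.quotaJ j₀ ≤ I.loadJ y j₀)
    (hT : ∀ j, I.loadJ y j < I.loadJ x j → P j = none ∨ j = j₀) : I.psi y < I.psi x := by
  have h4 : I.activeSet y ⊂ I.activeSet x := by
    rw [Finset.ssubset_iff_of_subset]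
    · exact ⟨j₀, mem_activeSet.2 hj₀, fun ha => not_le.2 (mem_activeSet.1 ha).1 hq⟩
    · intro j
      simp only [mem_activeSet]
      rintro ⟨hq', e, he, hc⟩
      have hc' := h.cand hp hx hc
      rcases lt_or_ge (I.loadJ y j) (I.loadJ x j) with h5 | h5
      · obtain h5 | rfl := hT j h5
        · exact absurd hc' (hp.not_cand h5 e he)
        · exact hj₀
      · exact ⟨h5.trans_lt hq', e, he, hc'⟩
  have c1 := Finset.card_le_card (h.candSet_subset hp hx)
  have c2 := Finset.card_le_card (h.liveSet_subset hp hx)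
  have c3 := Finset.card_le_card (h.freeSet_subset hx)
  have c4 := Finset.card_lt_card h4
  unfold psi
  omega

end Moves

open Classical in
-- The only edge that may rise is `e`, and whatever is at least as good as `e` was already counted
-- because of the worse positive edge `g`. The edge `g` itself is no longer counted.
theorem phi_lt {e g : Fin I.nE} (hg : 0 < x g) (hb : I.BetterAtJob e g)
    (h0 : ∀ f, I.BetterAtJob e f → ¬ 0 < y f) (hle : ∀ f, f ≠ e → y f ≤ x f) :
    I.phi y < I.phi x := by
  unfold phi
  refine Finset.card_lt_card ((Finset.ssubset_iff_of_subset ?_).2 ⟨g, ?_, ?_⟩)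
  · intro d
    simp only [Finset.mem_filter, Finset.mem_univ, true_and]
    rintro ⟨f, hf, hj, hr⟩
    by_cases hfe : f = e
    · subst hfe
      exact ⟨g, hg, hb.1.trans hj, hr.trans hb.2.le⟩
    · exact ⟨f, hf.trans_le (hle f hfe), hj, hr⟩
  · simp only [Finset.mem_filter, Finset.mem_univ, true_and]
    exact ⟨g, hg, rfl, le_rfl⟩
  · simp only [Finset.mem_filter, Finset.mem_univ, true_and]
    rintro ⟨f, hf, hj, hr⟩
    exact h0 f ⟨hj.trans hb.1, hb.2.trans_le hr⟩ hf

/-- The offset `psiMax + 1` makes the passage from an envious to an envy-free allocation a decrease,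
whatever the new value of `psi`. -/
theorem measure_lt_of_phi_lt (hx : ¬ I.EnvyFree x) (h : I.phi y < I.phi x) :
    I.measure y < I.measure x := by
  unfold measure
  have := psi_le y
  rw [if_neg hx]
  split_ifs <;> omega

theorem measure_lt_of_psi_lt (hx : I.EnvyFree x) (hy : I.EnvyFree y) (h : I.psi y < I.psi x) :
    I.measure y < I.measure x := by
  rw [measure, measure, if_pos hx, if_pos hy]
  exact h

end AllocInstance

namespace AllocInstance

variable {I : AllocInstance} {x y z b : Fin I.nE → ℝ} {P F : Fin I.nJ → Option (Fin I.nE)}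

/-! ### Pushing an amount along a sequence of refusals -/

/-- The job whose edge is refused when `j` proposes, and `j` itself if there is none. -/
def next (I : AllocInstance) (F : Fin I.nJ → Option (Fin I.nE)) (j : Fin I.nJ) : Fin I.nJ :=
  (F j).elim j I.job

theorem next_of_some {j : Fin I.nJ} {f : Fin I.nE} (h : F j = some f) : I.next F j = I.job f := by
  simp [next, h]

theorem next_of_none {j : Fin I.nJ} (h : F j = none) : I.next F j = j := by
  simp [next, h]

/-- The jobs `r 0, …, r K` are distinct, and each of them has an edge refused in favour of the
proposal of its predecessor. -/
structure Route (I : AllocInstance) (P F : Fin I.nJ → Option (Fin I.nE)) (r : ℕ → Fin I.nJ)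
    (K : ℕ) : Prop where
  step : ∀ l < K, ∃ e f, P (r l) = some e ∧ F (r l) = some f ∧ I.job f = r (l + 1)
  inj : ∀ l ≤ K, ∀ l' ≤ K, r l = r l' → l = l'

/-- Stopping at the first visit to `T` makes the jobs distinct, because a repetition would give a
shortcut to `T`. Distinctness bounds the length by the number of jobs. -/
theorem Pointers.exists_route (hp : I.Pointers x P F) (j T : Fin I.nJ) (n : ℕ)
    (hn : (I.next F)^[n] j = T) :
    ∃ K, K ≤ I.nJ ∧ (I.next F)^[K] j = T ∧ (∀ l < K, (I.next F)^[l] j ≠ T) ∧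
      I.Route P F (fun l => (I.next F)^[l] j) K := by
  classical
  have hex : ∃ K, (I.next F)^[K] j = T := ⟨n, hn⟩
  have hK := Nat.find_spec hex
  have hmin : ∀ l < Nat.find hex, (I.next F)^[l] j ≠ T := fun l hl => Nat.find_min hex hl
  set K := Nat.find hex
  have inj' : ∀ l l', l < l' → l' ≤ K → (I.next F)^[l] j ≠ (I.next F)^[l'] j := by
    intro l l' hlt hle heq
    -- If positions `l < l'` coincide, then the remaining `K - l'` moves can be made already from
    -- position `l`.
    refine hmin (l + (K - l')) (by omega) ?_
    rw [Nat.add_comm, Function.iterate_add_apply, heq, ← Function.iterate_add_apply,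
      Nat.sub_add_cancel hle, hK]
  have inj : ∀ l ≤ K, ∀ l' ≤ K, (I.next F)^[l] j = (I.next F)^[l'] j → l = l' := by
    intro l hl l' hl' heq
    rcases lt_trichotomy l l' with h | h | h
    · exact absurd heq (inj' l l' h hl')
    · exact h
    · exact absurd heq.symm (inj' l' l h hl)
  refine ⟨K, ?_, hK, hmin, fun l hl => ?_, inj⟩
  · have : Function.Injective fun l : Fin (K + 1) => (I.next F)^[(l : ℕ)] j := fun l l' h =>
      Fin.ext (inj l (by omega) l' (by omega) h)
    have := Fintype.card_le_of_injective _ this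
    simp only [Fintype.card_fin] at this
    omega
  · cases hF : F ((I.next F)^[l] j) with
    | none =>
      exact absurd (by rw [Function.iterate_succ_apply', next_of_none hF]) (inj' l (l + 1) (by omega) hl)
    | some f =>
      obtain ⟨e, he, -⟩ := hp.exists_of_some hF
      exact ⟨e, f, he, rfl, by rw [Function.iterate_succ_apply', next_of_some hF]⟩

/-- The amount `a` fits into the proposed and refused edges of the jobs `r 0, …, r (K - 1)`. -/
def Fits (I : AllocInstance) (P F : Fin I.nJ → Option (Fin I.nE)) (r : ℕ → Fin I.nJ) (K : ℕ)
    (b : Fin I.nE → ℝ) (a : ℝ) : Prop :=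
  ∀ l < K, (∀ e, P (r l) = some e → b e + a ≤ I.cap e) ∧ (∀ f, F (r l) = some f → a ≤ b f)

/-- The allocation `z` arises from `b` by pushing the amount `a` from `r 0` to `r i`. -/
structure Pushed (I : AllocInstance) (P F : Fin I.nJ → Option (Fin I.nE)) (r : ℕ → Fin I.nJ)
    (K : ℕ) (b : Fin I.nE → ℝ) (a : ℝ) (i : ℕ) (z : Fin I.nE → ℝ) : Prop where
  feasible : I.Feasible z
  loadJ_eq : ∀ j, I.loadJ z j =
    I.loadJ b j + (if j = r 0 then a else 0) - if j = r i then a else 0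
  loadM_eq : ∀ m, I.loadM z m = I.loadM b m
  doneP : ∀ l < i, ∀ e, P (r l) = some e → z e = b e + a
  doneF : ∀ l < i, ∀ f, F (r l) = some f → z f = b f - a
  todoP : ∀ l, i ≤ l → l < K → ∀ e, P (r l) = some e → z e = b e
  todoF : ∀ l, i ≤ l → l < K → ∀ f, F (r l) = some f → z f = b f
  other : ∀ g, (∀ l < i, P (r l) ≠ some g) → (∀ l < i, F (r l) ≠ some g) → z g = b g

theorem Pushed.zero {r : ℕ → Fin I.nJ} {K : ℕ} {a : ℝ} (hb : I.Feasible b) :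
    I.Pushed P F r K b a 0 b :=
  ⟨hb, by simp, by simp, by simp, by simp, by simp, by simp, by simp⟩

/-- Job `r i` has room for `a`: either it is the start, where `hq` provides it, or it has just lost
`a` through the preceding refusal. Its machine exchanges `a` for `a`, so machine loads stay
constant. -/
theorem Pushed.step {r : ℕ → Fin I.nJ} {K : ℕ} {a : ℝ} {i : ℕ} (hp : I.Pointers x P F)
    (hr : I.Route P F r K) (hfit : I.Fits P F r K b a) (ha : 0 < a)
    (hq : I.loadJ b (r 0) + a ≤ I.quotaJ (r 0)) (hb : I.Feasible b) (h : I.Pushed P F r K b a i z)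
    (hi : i < K) {e f : Fin I.nE} (he : P (r i) = some e) (hf : F (r i) = some f) :
    I.BetterResponse z e (shift z e f a a) ∧ I.Pushed P F r K b a (i + 1) (shift z e f a a) := by
  have hbt := hp.better he hf
  have hne := hbt.ne
  have hje := hp.job_eq he
  obtain ⟨e', f', he', hf', hjf⟩ := hr.step i hi
  obtain rfl : e = e' := by simpa [he] using he'
  obtain rfl : f = f' := by simpa [hf] using hf'
  have hze := h.todoP i le_rfl hi e he
  have hzf := h.todoF i le_rfl hi f hf
  have hbr : I.BetterResponse z e (shift z e f a a) := by
    refine betterResponse_shift h.feasible ha ha.le ?_ hbt ?_ ?_ ?_ ?_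
    · rw [hze]; exact (hfit i hi).1 e he
    · rw [hzf]; exact (hfit i hi).2 f hf
    · rw [hzf]; exact ha.trans_le ((hfit i hi).2 f hf)
    · rw [hje, h.loadJ_eq, if_pos rfl]
      by_cases h0 : r i = r 0
      · rw [if_pos h0, h0]; linarith
      · rw [if_neg h0]; linarith [hb.2.1 (r i)]
    · linarith [h.feasible.2.2 (I.mach e)]
  have hPe : ∀ l ≤ K, ∀ g, P (r l) = some g → g = e → l = i := by
    rintro l hl g hg rfl
    exact hr.inj l hl i hi.le ((hp.job_eq hg).symm.trans hje)
  -- The refused edge of `r l` belongs to job `r (l + 1)`, so distinct jobs on the route have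
  -- distinct refused edges.
  have hFf : ∀ l < K, ∀ g, F (r l) = some g → g = f → l = i := by
    rintro l hl g hg rfl
    obtain ⟨-, g', -, hg', hj'⟩ := hr.step l hl
    obtain rfl : g = g' := by simpa [hg] using hg'
    have := hr.inj (l + 1) hl (i + 1) hi (hj'.symm.trans hjf)
    omega
  refine ⟨hbr, hbr.2.1, fun j => ?_, fun m => ?_, fun l hl g hg => ?_, fun l hl g hg => ?_,
    fun l hl hlK g hg => ?_, fun l hl hlK g hg => ?_, fun g h1 h2 => ?_⟩
  · rw [loadJ_shift hne, h.loadJ_eq, hje, hjf]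
    simp only [eq_comm (a := j)]
    ring
  · rw [loadM_shift hne, h.loadM_eq, hbt.1]
    ring
  · by_cases hge : g = e
    · subst hge; rw [shift_left hne, hze]
    · rw [shift_of_ne hge (hp.ne hg hf).symm]
      have : l ≠ i := by
        rintro rfl; exact hge (Option.some.inj (hg.symm.trans he))
      exact h.doneP l (by omega) g hg
  · by_cases hgf : g = f
    · subst hgf; rw [shift_right, hzf]
    · rw [shift_of_ne (hp.ne he hg) hgf]
      have : l ≠ i := by
        rintro rfl; exact hgf (Option.some.inj (hg.symm.trans hf))
      exact h.doneF l (by omega) g hg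
  · rw [shift_of_ne (fun hge => ?_) (hp.ne hg hf).symm]
    · exact h.todoP l (by omega) hlK g hg
    · have := hPe l hlK.le g hg hge
      omega
  · rw [shift_of_ne (hp.ne he hg) (fun hgf => ?_)]
    · exact h.todoF l (by omega) hlK g hg
    · have := hFf l hlK g hg hgf
      omega
  · rw [shift_of_ne]
    · exact h.other g (fun l hl => h1 l (by omega)) (fun l hl => h2 l (by omega))
    · rintro rfl; exact h1 i (by omega) he
    · rintro rfl; exact h2 i (by omega) hf

theorem Pushed.shape {r : ℕ → Fin I.nJ} {K : ℕ} {a : ℝ} {i : ℕ} (h : I.Pushed P F r K b a i z)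
    (ha : 0 ≤ a) : I.Shape P F b z := by
  refine ⟨fun g hg => ?_, fun g hg => ?_⟩
  · by_contra hn
    push Not at hn
    by_cases hF : ∃ l < i, F (r l) = some g
    · obtain ⟨l, hl, hl'⟩ := hF
      have := h.doneF l hl g hl'
      linarith
    · push Not at hF
      have := h.other g (fun l _ => hn _) hF
      linarith
  · by_contra hn
    push Not at hn
    by_cases hP : ∃ l < i, P (r l) = some g
    · obtain ⟨l, hl, hl'⟩ := hP
      have := h.doneP l hl g hl'
      linarith
    · push Not at hP
      have := h.other g hP (fun l _ => hn _)
      linarith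

theorem shape_shift {e f : Fin I.nE} {j j' : Fin I.nJ} {α β : ℝ} (hne : f ≠ e) (hα : 0 ≤ α)
    (hβ : 0 ≤ β) (he : P j = some e) (hf : F j' = some f) : I.Shape P F z (shift z e f α β) := by
  refine ⟨fun g hg => ?_, fun g hg => ?_⟩
  · by_cases hge : g = e
    · exact ⟨j, hge ▸ he⟩
    · by_cases hgf : g = f
      · subst hgf; rw [shift_right] at hg; linarith
      · rw [shift_of_ne hge hgf] at hg; exact absurd hg (lt_irrefl _)
  · by_cases hgf : g = f
    · exact ⟨j', hgf ▸ hf⟩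
    · by_cases hge : g = e
      · subst hge; rw [shift_left hne] at hg; linarith
      · rw [shift_of_ne hge hgf] at hg; exact absurd hg (lt_irrefl _)

theorem shape_raise {e : Fin I.nE} {j : Fin I.nJ} {α : ℝ} (hα : 0 ≤ α) (he : P j = some e) :
    I.Shape P F z (raise z e α) := by
  refine ⟨fun g hg => ?_, fun g hg => ?_⟩
  · by_cases hge : g = e
    · exact ⟨j, hge ▸ he⟩
    · simp [raise, hge] at hg
  · by_cases hge : g = e
    · subst hge
      simp only [raise, Function.update_self] at hg
      linarith
    · simp [raise, hge] at hg

/-- Some proposed edge is saturated or some refused edge has value zero. -/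
def Tight (I : AllocInstance) (P F : Fin I.nJ → Option (Fin I.nE)) (y : Fin I.nE → ℝ) : Prop :=
  (∃ j e, P j = some e ∧ I.cap e ≤ y e) ∨ ∃ j f, F j = some f ∧ y f ≤ 0

/-- Proposals never fall and refused edges never rise, so later steps of a round cannot undo the
event. -/
theorem Tight.of_shape (h : I.Tight P F y) (hp : I.Pointers x P F) (hs : I.Shape P F y z) :
    I.Tight P F z := by
  obtain ⟨j, e, hj, he⟩ | ⟨j, f, hj, hf⟩ := h
  · exact Or.inl ⟨j, e, hj, he.trans (hs.le_of_pointer hp hj)⟩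
  · exact Or.inr ⟨j, f, hj, (hs.ge_of_pointer hp hj).trans hf⟩

/-- The amount `a` is the minimum of `a₀` and of what fits into the proposed and refused edges of
`r 0, …, r (K - 1)`. -/
structure MinFit (I : AllocInstance) (P F : Fin I.nJ → Option (Fin I.nE)) (r : ℕ → Fin I.nJ)
    (K : ℕ) (b : Fin I.nE → ℝ) (a₀ a : ℝ) : Prop where
  le : a ≤ a₀
  fits : I.Fits P F r K b a
  attained : a = a₀ ∨ ∃ l < K, (∃ e, P (r l) = some e ∧ a = I.cap e - b e) ∨
    ∃ f, F (r l) = some f ∧ a = b f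

theorem MinFit.zero {r : ℕ → Fin I.nJ} (b : Fin I.nE → ℝ) (a : ℝ) : I.MinFit P F r 0 b a a :=
  ⟨le_rfl, fun _ h => absurd h (Nat.not_lt_zero _), Or.inl rfl⟩

theorem MinFit.succ {r : ℕ → Fin I.nJ} {K : ℕ} {a₀ a : ℝ} (h : I.MinFit P F r K b a₀ a)
    {e f : Fin I.nE} (he : P (r K) = some e) (hf : F (r K) = some f) :
    I.MinFit P F r (K + 1) b a₀ (min (min a (I.cap e - b e)) (b f)) := by
  refine ⟨(min_le_left _ _).trans ((min_le_left _ _).trans h.le), fun l hl => ?_, ?_⟩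
  · have h1 : min (min a (I.cap e - b e)) (b f) ≤ a := (min_le_left _ _).trans (min_le_left _ _)
    have h2 : min (min a (I.cap e - b e)) (b f) ≤ I.cap e - b e :=
      (min_le_left _ _).trans (min_le_right _ _)
    rcases Nat.lt_succ_iff_lt_or_eq.1 hl with hl | rfl
    · exact ⟨fun g hg => by linarith [(h.fits l hl).1 g hg], fun g hg => h1.trans ((h.fits l hl).2 g hg)⟩
    · refine ⟨fun g hg => ?_, fun g hg => ?_⟩
      · obtain rfl : e = g := by simpa [he] using hg
        linarith
      · obtain rfl : f = g := by simpa [hf] using hg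
        exact min_le_right _ _
  · rcases min_choice (min a (I.cap e - b e)) (b f) with h1 | h1
    · rcases min_choice a (I.cap e - b e) with h2 | h2
      · rw [h1, h2]
        obtain h3 | ⟨l, hl, h3⟩ := h.attained
        · exact Or.inl h3
        · exact Or.inr ⟨l, by omega, h3⟩
      · exact Or.inr ⟨K, by omega, Or.inl ⟨e, he, h1.trans h2⟩⟩
    · exact Or.inr ⟨K, by omega, Or.inr ⟨f, hf, h1⟩⟩

/-- At the allocation for which the pointers were computed, proposals are unsaturated and refused
edges are positive. After a push this may fail, so for rotations `MinFit.tight_of_nonpos` is needed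
too. -/
theorem MinFit.pos {r : ℕ → Fin I.nJ} {K : ℕ} {a₀ a : ℝ} (h : I.MinFit P F r K x a₀ a)
    (hp : I.Pointers x P F) (h0 : 0 < a₀) : 0 < a := by
  obtain rfl | ⟨l, -, ⟨e, he, rfl⟩ | ⟨f, hf, rfl⟩⟩ := h.attained
  · exact h0
  · exact sub_pos.2 (hp.cand he).1
  · exact hp.pos hf

theorem MinFit.congr_amount {r : ℕ → Fin I.nJ} {K : ℕ} {a₀ a a' : ℝ}
    (h : I.MinFit P F r K b a₀ a) (ha : a' = a) : I.MinFit P F r K b a₀ a' := ha ▸ h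

theorem MinFit.tight_of_nonpos {r : ℕ → Fin I.nJ} {K : ℕ} {a₀ a : ℝ} (h : I.MinFit P F r K b a₀ a)
    (ha : a ≤ 0) (h0 : a = a₀ → I.Tight P F b) : I.Tight P F b := by
  obtain h1 | ⟨l, -, ⟨e, he, h1⟩ | ⟨f, hf, h1⟩⟩ := h.attained
  · exact h0 h1
  · exact Or.inl ⟨_, e, he, by linarith⟩
  · exact Or.inr ⟨_, f, hf, by linarith⟩

theorem Pushed.tight {r : ℕ → Fin I.nJ} {K : ℕ} {a₀ a : ℝ} (h : I.Pushed P F r K b a K z)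
    (hm : I.MinFit P F r K b a₀ a) : a = a₀ ∨ I.Tight P F z := by
  obtain h1 | ⟨l, hl, ⟨e, he, h1⟩ | ⟨f, hf, h1⟩⟩ := hm.attained
  · exact Or.inl h1
  · exact Or.inr (Or.inl ⟨_, e, he, by rw [h.doneP l hl e he]; linarith⟩)
  · exact Or.inr (Or.inr ⟨_, f, hf, by rw [h.doneF l hl f hf]; linarith⟩)

/-! ### The three ways in which a round ends -/

/-- Either the amount was limited by the free quota of the active job, which is now full, while the
last job loses load but has no candidate; or a limiting edge on the route is now tight. -/
theorem Pushed.psi_lt_of_none {r : ℕ → Fin I.nJ} {K : ℕ} {a : ℝ} (hp : I.Pointers x P F)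
    (hx : I.Feasible x) (h : I.Pushed P F r K x a K z) (ha : 0 ≤ a)
    (hm : I.MinFit P F r K x (I.quotaJ (r 0) - I.loadJ x (r 0)) a) (hact : I.Active x (r 0))
    (hT : P (r K) = none) : I.Moves P F x z ∧ I.psi z < I.psi x := by
  have hmv : I.Moves P F x z := ⟨h.shape ha, fun m hm => by rw [h.loadM_eq, hm]⟩
  refine ⟨hmv, ?_⟩
  have h0 : r 0 ≠ r K := by
    intro h0
    obtain ⟨-, e, he, hc⟩ := hact
    exact hp.not_cand (h0 ▸ hT) e he hc
  obtain h1 | h1 := h.tight hm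
  · refine hmv.psi_lt_of_active hp hx (r 0) hact ?_ fun j hj => Or.inl ?_
    · rw [h.loadJ_eq, if_pos rfl, if_neg h0, h1]; linarith
    · rw [h.loadJ_eq] at hj
      by_cases hjK : j = r K
      · rw [hjK, hT]
      · rw [if_neg hjK] at hj
        split_ifs at hj <;> linarith
  · refine hmv.psi_lt hp hx (r K) (fun j hj => ?_) (h1.elim Or.inl fun h => Or.inr (Or.inl h))
    rw [h.loadJ_eq, if_neg hj]
    split_ifs <;> linarith

/-- The push stops before the last job proposes, and that job differs from all earlier ones. -/
theorem Pushed.eq_of_job {r : ℕ → Fin I.nJ} {K : ℕ} {a : ℝ} (hp : I.Pointers x P F)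
    (hr : I.Route P F r K) (h : I.Pushed P F r K b a K z) {e : Fin I.nE}
    (he : P (r K) = some e) : z e = b e := by
  refine h.other e (fun l hl hl' => ?_) fun l _ hl' => hp.ne he hl' rfl
  have := hr.inj l hl.le K le_rfl ((hp.job_eq hl').symm.trans (hp.job_eq he))
  omega

/-- The last job recovers its loss by raising `e` at a machine with room, so only the load of `r 0`
changes, and it grows. The terms of the minimum correspond to a full start job, a saturated `e` and
a full machine; any other limit is a tight edge on the route. -/
theorem Pushed.raise_of_free {r : ℕ → Fin I.nJ} {K : ℕ} {a₀ a : ℝ} (hp : I.Pointers x P F)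
    (hr : I.Route P F r K) (hx : I.Feasible x) (h : I.Pushed P F r K x a K z) (ha : 0 < a)
    (hm : I.MinFit P F r K x a₀ a) (hact : I.Active x (r 0)) {e : Fin I.nE} (he : P (r K) = some e)
    (hF : F (r K) = none)
    (ha₀ : a₀ = min (min (I.quotaJ (r 0) - I.loadJ x (r 0)) (I.cap e - x e))
      (I.quotaM (I.mach e) - I.loadM x (I.mach e))) :
    I.BetterResponse z e (raise z e a) ∧ I.Moves P F x (raise z e a) ∧
      I.psi (raise z e a) < I.psi x := by
  have hle := hm.le
  have hje := hp.job_eq he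
  have hze := h.eq_of_job hp hr he
  have hfree := hp.free hF he
  have b1 : a₀ ≤ I.quotaJ (r 0) - I.loadJ x (r 0) :=
    ha₀ ▸ (min_le_left _ _).trans (min_le_left _ _)
  have b2 : a₀ ≤ I.cap e - x e := ha₀ ▸ (min_le_left _ _).trans (min_le_right _ _)
  have b3 : a₀ ≤ I.quotaM (I.mach e) - I.loadM x (I.mach e) := ha₀ ▸ min_le_right _ _
  have hload : ∀ j, I.loadJ (raise z e a) j = I.loadJ x j + if j = r 0 then a else 0 := by
    intro j
    rw [loadJ_raise, h.loadJ_eq, hje]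
    simp only [eq_comm (a := j)]
    ring
  have hmv : I.Moves P F x (raise z e a) := by
    refine ⟨(h.shape ha.le).trans (shape_raise ha.le he), fun m hm' => ?_⟩
    -- The only machine that gains load is the one of `e`, which was not full at `x`, so nothing is
    -- claimed for it.
    rw [loadM_raise, if_neg, h.loadM_eq, hm', add_zero]
    rintro rfl
    exact hfree.ne hm'
  refine ⟨betterResponse_raise h.feasible ha ?_ ?_ ?_, hmv, ?_⟩
  · rw [hze]; linarith
  · rw [hje, h.loadJ_eq, if_pos rfl]
    by_cases h0 : r K = r 0
    · rw [if_pos h0, h0]; linarith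
    · rw [if_neg h0]; linarith [hx.2.1 (r K)]
  · rw [h.loadM_eq]; linarith
  · have hge : ∀ j, I.loadJ x j ≤ I.loadJ (raise z e a) j := fun j => by
      rw [hload]; split_ifs <;> linarith
    obtain h1 | h1 := h.tight hm
    · rcases min_choice (min (I.quotaJ (r 0) - I.loadJ x (r 0)) (I.cap e - x e))
        (I.quotaM (I.mach e) - I.loadM x (I.mach e)) with h2 | h2
      · rcases min_choice (I.quotaJ (r 0) - I.loadJ x (r 0)) (I.cap e - x e) with h3 | h3
        · refine hmv.psi_lt_of_active hp hx (r 0) hact ?_ fun j hj => absurd hj (not_lt.2 (hge j))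
          rw [hload, if_pos rfl, h1, ha₀, h2, h3]; linarith
        · refine hmv.psi_lt hp hx (r K) (fun j _ => hge j) (Or.inl ⟨_, e, he, ?_⟩)
          simp only [raise, Function.update_self, hze]
          rw [h1, ha₀, h2, h3]; linarith
      · refine hmv.psi_lt hp hx (r K) (fun j _ => hge j) (Or.inr (Or.inr ⟨_, hfree, ?_⟩))
        rw [loadM_raise, if_pos rfl, h.loadM_eq, h1, ha₀, h2]; linarith
    · refine hmv.psi_lt hp hx (r K) (fun j _ => hge j)
        ((h1.of_shape hp (shape_raise ha.le he)).elim Or.inl fun h => Or.inr (Or.inl h))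

/-! ### Rotations around a cycle of refusals -/

/-- A cycle of refusals that starts and ends at job `T`, and amounts for going around it. -/
structure Rotation (I : AllocInstance) (P F : Fin I.nJ → Option (Fin I.nE)) (r : ℕ → Fin I.nJ)
    (K : ℕ) (b : Fin I.nE → ℝ) (T : Fin I.nJ) (e f : Fin I.nE) (s a : ℝ) : Prop where
  feasible : I.Feasible b
  route : I.Route P F r K
  start : r 0 = I.job f
  finish : r K = T
  hP : P T = some e
  hF : F T = some f
  pos : 0 < s
  le : s ≤ a
  free : I.loadJ b T + s ≤ I.quotaJ T
  minFit : I.MinFit P F r K b (min (I.cap e - b e) (b f)) a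

namespace Rotation

variable {r : ℕ → Fin I.nJ} {K : ℕ} {T : Fin I.nJ} {e f : Fin I.nE} {s a : ℝ}

/-- The opening step of the rotation involves the proposal and the refusal of `T`. These differ from
all others on the cycle, since the proposals there belong to jobs other than `T` and the refused
edges to jobs other than `r 0`. -/
theorem fits_shift (h : I.Rotation P F r K b T e f s a) (hp : I.Pointers x P F) :
    ∀ l < K, (∀ g, P (r l) = some g → shift b e f s a g = b g) ∧
      ∀ g, F (r l) = some g → shift b e f s a g = b g := by
  intro l hl
  refine ⟨fun g hg => shift_of_ne ?_ (hp.ne hg h.hF).symm _ _ _,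
    fun g hg => shift_of_ne (hp.ne h.hP hg) ?_ _ _ _⟩
  · rintro rfl
    have := h.route.inj l hl.le K le_rfl (by rw [h.finish, ← hp.job_eq h.hP, hp.job_eq hg])
    omega
  · rintro rfl
    obtain ⟨-, f', -, hf', hj⟩ := h.route.step l hl
    obtain rfl : g = f' := by simpa [hg] using hf'
    have := h.route.inj (l + 1) hl 0 (Nat.zero_le _) (by rw [h.start, hj])
    omega

theorem ne (h : I.Rotation P F r K b T e f s a) (hp : I.Pointers x P F) : T ≠ r 0 := by
  rw [h.start]; exact (hp.job_ne h.hF).symm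

/-- At the outset `T` is only known to have room for `s`, so its proposal rises by `s` while `f`
gives up the whole amount `a`. This frees `a` at the job of `f`, from where the push around the
cycle can start. -/
theorem first (h : I.Rotation P F r K b T e f s a) (hp : I.Pointers x P F) :
    I.BetterResponse b e (shift b e f s a) ∧ I.Fits P F r K (shift b e f s a) a ∧
      I.loadJ (shift b e f s a) (r 0) + a ≤ I.quotaJ (r 0) := by
  have hbt := hp.better h.hP h.hF
  have hje := hp.job_eq h.hP
  have h1 := h.minFit.le.trans (min_le_left _ _)
  have h2 := h.minFit.le.trans (min_le_right _ _)
  have := h.pos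
  have := h.le
  refine ⟨betterResponse_shift h.feasible h.pos (by linarith) (by linarith) hbt h2 (by linarith)
    ?_ ?_, fun l hl => ⟨fun g hg => ?_, fun g hg => ?_⟩, ?_⟩
  · rw [hje]; exact h.free
  · linarith [h.feasible.2.2 (I.mach e)]
  · rw [(h.fits_shift hp l hl).1 g hg]; exact (h.minFit.fits l hl).1 g hg
  · rw [(h.fits_shift hp l hl).2 g hg]; exact (h.minFit.fits l hl).2 g hg
  · rw [loadJ_shift hbt.ne, hje, if_neg (h.ne hp), if_pos h.start.symm]
    linarith [h.feasible.2.1 (r 0)]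

theorem apply_left (h : I.Rotation P F r K b T e f s a) (hp : I.Pointers x P F)
    (hz : I.Pushed P F r K (shift b e f s a) a K z) : z e = b e + s := by
  rw [hz.eq_of_job hp h.route (h.finish ▸ h.hP), shift_left (hp.ne h.hP h.hF)]

theorem loadJ_pushed (h : I.Rotation P F r K b T e f s a) (hp : I.Pointers x P F)
    (hz : I.Pushed P F r K (shift b e f s a) a K z) (j : Fin I.nJ) :
    I.loadJ z j = I.loadJ b j - if T = j then a - s else 0 := by
  rw [hz.loadJ_eq, loadJ_shift (hp.ne h.hP h.hF), hp.job_eq h.hP, h.finish, ← h.start]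
  simp only [eq_comm (a := j)]
  split_ifs <;> ring

theorem loadM_pushed (h : I.Rotation P F r K b T e f s a) (hp : I.Pointers x P F)
    (hz : I.Pushed P F r K (shift b e f s a) a K z) (m : Fin I.nM) :
    I.loadM z m = I.loadM b m - if I.mach e = m then a - s else 0 := by
  rw [hz.loadM_eq, loadM_shift (hp.ne h.hP h.hF), (hp.better h.hP h.hF).1]
  split_ifs <;> ring

/-- When the push returns to `T`, both `T` and the machine of `e` are short of `a - s`, which is
exactly what `e` still has to gain. -/
theorem last (h : I.Rotation P F r K b T e f s a) (hp : I.Pointers x P F)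
    (hz : I.Pushed P F r K (shift b e f s a) a K z) (hlt : s < a) :
    I.BetterResponse z e (raise z e (a - s)) := by
  have h1 := h.minFit.le.trans (min_le_left _ _)
  refine betterResponse_raise hz.feasible (by linarith) ?_ ?_ ?_
  · rw [h.apply_left hp hz]; linarith
  · rw [hp.job_eq h.hP, h.loadJ_pushed hp hz, if_pos rfl]; linarith [h.feasible.2.1 T]
  · rw [h.loadM_pushed hp hz, if_pos rfl]; linarith [h.feasible.2.2 (I.mach e)]

/-- Around the closed cycle all gains and losses cancel, and every proposal has risen and every
refused edge has fallen by `a`. Since `a` is the largest amount that fits, one of these edges has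
reached its limit. -/
theorem final (h : I.Rotation P F r K b T e f s a) (hp : I.Pointers x P F)
    (hz : I.Pushed P F r K (shift b e f s a) a K z) :
    I.Shape P F b (raise z e (a - s)) ∧ (∀ j, I.loadJ (raise z e (a - s)) j = I.loadJ b j) ∧
      (∀ m, I.loadM (raise z e (a - s)) m = I.loadM b m) ∧ I.Tight P F (raise z e (a - s)) := by
  have hs := h.pos
  have hle := h.le
  have hne := hp.ne h.hP h.hF
  have sh1 : I.Shape P F b (shift b e f s a) :=
    shape_shift hne hs.le (by linarith) h.hP h.hF
  have sh2 := hz.shape (by linarith)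
  have sh3 : I.Shape P F z (raise z e (a - s)) := shape_raise (by linarith) h.hP
  refine ⟨(sh1.trans sh2).trans sh3, fun j => ?_, fun m => ?_, ?_⟩
  · rw [loadJ_raise, h.loadJ_pushed hp hz, hp.job_eq h.hP]; ring
  · rw [loadM_raise, h.loadM_pushed hp hz]; ring
  · obtain h1 | ⟨l, hl, ⟨g, hg, h1⟩ | ⟨g, hg, h1⟩⟩ := h.minFit.attained
    · rcases min_choice (I.cap e - b e) (b f) with h2 | h2
      · refine Or.inl ⟨T, e, h.hP, ?_⟩
        simp only [raise, Function.update_self, h.apply_left hp hz]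
        linarith
      · refine Or.inr ⟨T, f, h.hF, ((sh2.trans sh3).ge_of_pointer hp h.hF).trans ?_⟩
        rw [shift_right]; linarith
    · refine Or.inl ⟨_, g, hg, le_trans ?_ (sh3.le_of_pointer hp hg)⟩
      rw [hz.doneP l hl g hg, (h.fits_shift hp l hl).1 g hg]; linarith
    · refine Or.inr ⟨_, g, hg, (sh3.ge_of_pointer hp hg).trans ?_⟩
      rw [hz.doneF l hl g hg, (h.fits_shift hp l hl).2 g hg]; linarith

end Rotation

end AllocInstance

/-! ## Reading the input and computing the pointers -/

/-- The memory contains the instance `I`. -/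
structure Inp (I : AllocInstance) (s : State) : Prop where
  nJ : s.nat 0 0 = I.nJ
  nM : s.nat 0 1 = I.nM
  nE : s.nat 0 2 = I.nE
  job : ∀ e : Fin I.nE, s.nat 1 e = I.job e
  mach : ∀ e : Fin I.nE, s.nat 2 e = I.mach e
  rankJ : ∀ e : Fin I.nE, s.nat 3 e = I.rankJ e
  rankM : ∀ e : Fin I.nE, s.nat 4 e = I.rankM e
  cap : ∀ e : Fin I.nE, s.real 0 e = I.cap e
  quotaJ : ∀ j : Fin I.nJ, s.real 1 j = I.quotaJ j
  quotaM : ∀ m : Fin I.nM, s.real 2 m = I.quotaM m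

/-- The current allocation in the memory. -/
def alloc (I : AllocInstance) (s : State) : Fin I.nE → ℝ := fun e => s.real 3 e

/-- The program has no assignment to the input arrays except that of the allocation. -/
def Prog.keepsInput (p : Prog) : Bool :=
  !(p.setsNat 0 || p.setsNat 1 || p.setsNat 2 || p.setsNat 3 || p.setsNat 4 ||
    p.setsReal 0 || p.setsReal 1 || p.setsReal 2)

variable {I : AllocInstance} {N : ℕ}

theorem Inp.frame {s s' : State} {p : Prog} (h : Inp I s) (hf : Frame p s s')
    (hp : p.keepsInput = true) : Inp I s' := by
  simp only [Prog.keepsInput, Bool.not_eq_true', Bool.or_eq_false_iff] at hp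
  obtain ⟨⟨⟨⟨⟨⟨⟨n0, n1⟩, n2⟩, n3⟩, n4⟩, r0⟩, r1⟩, r2⟩ := hp
  constructor
  · rw [hf.nat 0 n0]; exact h.nJ
  · rw [hf.nat 0 n0]; exact h.nM
  · rw [hf.nat 0 n0]; exact h.nE
  · rw [hf.nat 1 n1]; exact h.job
  · rw [hf.nat 2 n2]; exact h.mach
  · rw [hf.nat 3 n3]; exact h.rankJ
  · rw [hf.nat 4 n4]; exact h.rankM
  · rw [hf.real 0 r0]; exact h.cap
  · rw [hf.real 1 r1]; exact h.quotaJ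
  · rw [hf.real 2 r2]; exact h.quotaM

theorem alloc_frame {s s' : State} {p : Prog} (hf : Frame p s s') (hp : p.setsReal 3 = false) :
    alloc I s' = alloc I s := by
  unfold alloc; rw [hf.real 3 hp]

/-- The number of jobs. -/
abbrev numJ : NExp := .get 0 (.const 0)
/-- The number of machines. -/
abbrev numM : NExp := .get 0 (.const 1)
/-- The number of edges. -/
abbrev numE : NExp := .get 0 (.const 2)
/-- The loop counter. -/
abbrev ctr : NExp := cell 8
/-- The number before `u`. -/
abbrev NExp.pred (u : NExp) : NExp := .sub u (.const 1)

/-- Compute the loads of the jobs and of the machines. -/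
def loads : Prog :=
  .seq (forTo numJ (.setReal 4 ctr .zero)) <|
  .seq (forTo numM (.setReal 5 ctr .zero)) <|
  forTo numE <|
    .seq (.setReal 4 (.get 1 ctr) (.add (.get 4 (.get 1 ctr)) (.get 3 ctr)))
      (.setReal 5 (.get 2 ctr) (.add (.get 5 (.get 2 ctr)) (.get 3 ctr)))

/-- Compute the worst edge with positive value of each machine. -/
def worsts : Prog :=
  .seq (forTo numM (.setNat 5 ctr (.const 0))) <|
  forTo numE <|
    .ite (.realLt .zero (.get 3 ctr))
      (.ite (.or (.natEq (.get 5 (.get 2 ctr)) (.const 0))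
          (.natLt (.get 4 (.pred (.get 5 (.get 2 ctr)))) (.get 4 ctr)))
        (.setNat 5 (.get 2 ctr) (.add ctr (.const 1))) .skip) .skip

/-- The edge in the loop counter is a candidate edge. -/
def candTest : Test :=
  .and (.realLt (.get 3 ctr) (.get 0 ctr))
    (.or (.realLt (.get 5 (.get 2 ctr)) (.get 2 (.get 2 ctr)))
      (.and (.not (.natEq (.get 5 (.get 2 ctr)) (.const 0)))
        (.natLt (.get 4 ctr) (.get 4 (.pred (.get 5 (.get 2 ctr)))))))

/-- Compute the best candidate edge of each job. -/
def props : Prog :=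
  .seq (forTo numJ (.setNat 6 ctr (.const 0))) <|
  forTo numE <|
    .ite candTest
      (.ite (.or (.natEq (.get 6 (.get 1 ctr)) (.const 0))
          (.natLt (.get 3 ctr) (.get 3 (.pred (.get 6 (.get 1 ctr))))))
        (.setNat 6 (.get 1 ctr) (.add ctr (.const 1))) .skip) .skip

/-- Compute the refused edges, and find an active job. -/
def links : Prog :=
  .seq (.setNat 12 (.const 0) (.const 0)) <|
  forTo numJ <|
    .seq (.setNat 7 ctr (.const 0)) <|
    .ite (.natEq (.get 6 ctr) (.const 0)) .skip <|
    .seq (.ite (.realLt (.get 4 ctr) (.get 1 ctr))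
      (.setNat 12 (.const 0) (.add ctr (.const 1))) .skip)
      (.ite (.realLt (.get 5 (.get 2 (.pred (.get 6 ctr)))) (.get 2 (.get 2 (.pred (.get 6 ctr)))))
        .skip (.setNat 7 ctr (.get 5 (.get 2 (.pred (.get 6 ctr))))))

/-- Find a candidate edge that its job prefers to some edge with positive value. -/
def envy : Prog :=
  .seq (.setNat 11 (.const 0) (.const 0)) <|
  forTo numE <|
    .ite (.and (.realLt .zero (.get 3 ctr)) (.and (.not (.natEq (.get 6 (.get 1 ctr)) (.const 0)))
        (.natLt (.get 3 (.pred (.get 6 (.get 1 ctr)))) (.get 3 ctr))))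
      (.setNat 11 (.const 0) (.get 6 (.get 1 ctr))) .skip

/-- Compute all pointers. -/
def scan : Prog := .seq loads (.seq worsts (.seq props (.seq links envy)))

/-! ### Correctness of the scanning loops -/

/-- The sum of the values of the first `k` elements that satisfy `p`. -/
noncomputable def partialSum {n : ℕ} (x : Fin n → ℝ) (p : Fin n → Prop) [DecidablePred p] (k : ℕ) :
    ℝ := ∑ e : Fin n, if e.val < k then (if p e then x e else 0) else 0

theorem partialSum_succ {n : ℕ} (x : Fin n → ℝ) (p : Fin n → Prop) [DecidablePred p] {k : ℕ}
    (hk : k < n) : partialSum x p (k + 1) =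
      partialSum x p k + if p ⟨k, hk⟩ then x ⟨k, hk⟩ else 0 := by
  have h : ∀ e : Fin n, (if e.val < k + 1 then (if p e then x e else 0) else 0) =
      (if e.val < k then (if p e then x e else 0) else 0) +
        if e = ⟨k, hk⟩ then (if p ⟨k, hk⟩ then x ⟨k, hk⟩ else 0) else 0 := by
    intro e
    rcases lt_trichotomy e.val k with h | h | h
    · have : e ≠ ⟨k, hk⟩ := fun h' => by simp [h'] at h
      simp [h, this, Nat.lt_succ_of_lt h]
    · obtain rfl : e = ⟨k, hk⟩ := Fin.ext h
      simp
    · have h1 : e ≠ ⟨k, hk⟩ := fun h' => by simp [h'] at h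
      have h2 : ¬ e.val < k + 1 := by omega
      simp [h1, h2, h.not_gt]
  simp only [partialSum, h, Finset.sum_add_distrib, Finset.sum_ite_eq', Finset.mem_univ, if_true]

theorem partialSum_zero {n : ℕ} (x : Fin n → ℝ) (p : Fin n → Prop) [DecidablePred p] :
    partialSum x p 0 = 0 := by simp [partialSum]

theorem partialSum_full {n : ℕ} (x : Fin n → ℝ) (p : Fin n → Prop) [DecidablePred p] :
    partialSum x p n = ∑ e, if p e then x e else 0 := by simp [partialSum]

/-- A loop that sets the first `K` cells of an array to zero. -/
theorem clearReal_spec {a : ℕ} {n : NExp} {s : State} (K : ℕ) (hK : K ≤ N)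
    (hn : ∀ s', Frame (forTo n (.setReal a ctr .zero)) s s' → n.eval s' = K) :
    Runs N (forTo n (.setReal a ctr .zero)) s fun s' => ∀ i < K, s'.real a i = 0 := by
  refine Runs.forTo K hK (fun k s' => ∀ i < k, s'.real a i = 0) rfl hn (by simp) ?_
    (fun s' _ h => h)
  intro k _ s' _ h8 hI
  refine Runs.setReal fun i hi => ?_
  simp only [NExp.eval, RExp.eval, h8, write_eq, if_true, Function.update_apply]
  split_ifs with h
  · rfl
  · exact hI i (by omega)

theorem clearNat_spec {a : ℕ} {n : NExp} {s : State} (K : ℕ) (hK : K ≤ N) (ha : a ≠ 8)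
    (hn : ∀ s', Frame (forTo n (.setNat a ctr (.const 0))) s s' → n.eval s' = K) :
    Runs N (forTo n (.setNat a ctr (.const 0))) s fun s' => ∀ i < K, s'.nat a i = 0 := by
  refine Runs.forTo K hK (fun k s' => ∀ i < k, s'.nat a i = 0)
    (by simpa [Prog.setsNat] using ha.symm) hn (by simp) ?_ (fun s' _ h => h)
  intro k _ s' _ h8 hI
  refine Runs.setNat fun i hi => ?_
  simp only [NExp.eval, h8, write_eq, if_true, Function.update_apply, if_neg ha]
  split_ifs with h
  · rfl
  · exact hI i (by omega)

/-- All loops of the algorithm take at most this number of rounds. -/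
abbrev AllocInstance.size (I : AllocInstance) : ℕ := I.nE + I.nJ + I.nM

theorem loads_spec {s : State} (hs : Inp I s) :
    Runs I.size loads s fun s' => (∀ j : Fin I.nJ, s'.real 4 j = I.loadJ (alloc I s) j) ∧
      ∀ m : Fin I.nM, s'.real 5 m = I.loadM (alloc I s) m := by
  refine Runs.seq_of (clearReal_spec I.nJ (by simp [AllocInstance.size]; omega)
    fun s' hf => (hs.frame hf rfl).nJ) fun s₁ h₁ hf₁ => ?_
  have hs₁ := hs.frame hf₁ rfl
  have ha₁ : alloc I s₁ = alloc I s := alloc_frame hf₁ rfl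
  refine Runs.seq_of (clearReal_spec I.nM (by simp [AllocInstance.size])
    fun s' hf => (hs₁.frame hf rfl).nM) fun s₂ h₂ hf₂ => ?_
  have hs₂ := hs₁.frame hf₂ rfl
  have ha₂ : alloc I s₂ = alloc I s := (alloc_frame hf₂ rfl).trans ha₁
  refine Runs.forTo I.nE (by simp [AllocInstance.size]; omega) (fun k s' =>
    (∀ j : Fin I.nJ, s'.real 4 j = partialSum (alloc I s) (fun e => I.job e = j) k) ∧
      ∀ m : Fin I.nM, s'.real 5 m = partialSum (alloc I s) (fun e => I.mach e = m) k) rfl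
    (fun s' hf => (hs₂.frame hf rfl).nE) ⟨fun j => ?_, fun m => ?_⟩ ?_ ?_
  · rw [partialSum_zero, ← h₁ j j.2]
    exact congrFun (hf₂.real 4 rfl) j
  · rw [partialSum_zero, ← h₂ m m.2]
  · rintro k hk s' hf h8 ⟨hJ, hM⟩
    have hs' := hs₂.frame hf rfl
    have ha : ∀ e : Fin I.nE, s'.real 3 e = alloc I s e := fun e => by
      rw [← ha₂, ← alloc_frame hf rfl]; rfl
    have hjob := hs'.job ⟨k, hk⟩
    have hmach := hs'.mach ⟨k, hk⟩
    have hak := ha ⟨k, hk⟩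
    simp only at hjob hmach hak
    refine Runs.seq (Runs.setReal (Runs.setReal ⟨fun j => ?_, fun m => ?_⟩))
    · simp only [NExp.eval, RExp.eval, h8, write_eq, if_true, Function.update_apply, hjob, hak,
        partialSum_succ _ _ hk, hJ, Nat.reduceEqDiff, if_false, Fin.val_inj, eq_comm (a := j)]
      split_ifs with h
      · rw [h]
      · simp
    · simp only [NExp.eval, RExp.eval, h8, write_eq, if_true, Function.update_apply, hmach, hak,
        partialSum_succ _ _ hk, hM, Nat.reduceEqDiff, if_false, Fin.val_inj, eq_comm (a := m)]
      split_ifs with h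
      · rw [h]
      · simp
  · rintro s' - ⟨hJ, hM⟩
    exact ⟨fun j => (hJ j).trans (partialSum_full _ _), fun m => (hM m).trans (partialSum_full _ _)⟩

/-! ### Optional edges -/

/-- Encoding of an optional edge as a natural number. -/
def enc {n : ℕ} : Option (Fin n) → ℕ
  | none => 0
  | some e => e + 1

@[simp] theorem enc_none {n : ℕ} : enc (none : Option (Fin n)) = 0 := rfl

@[simp] theorem enc_some {n : ℕ} (e : Fin n) : enc (some e) = e + 1 := rfl

/-- `o` is an element of `S` that is related to all elements of `S`, and `none` if `S` is empty. -/
structure IsArg {n : ℕ} (R : Fin n → Fin n → Prop) (S : Fin n → Prop) (o : Option (Fin n)) :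
    Prop where
  none : o = none → ∀ e, ¬ S e
  some : ∀ {f}, o = some f → S f ∧ ∀ e, S e → R f e

namespace IsArg

variable {n : ℕ} {R : Fin n → Fin n → Prop} {S S' : Fin n → Prop} {o : Option (Fin n)}

theorem of_empty (h : ∀ e, ¬ S e) : IsArg R S Option.none := ⟨fun _ => h, by simp⟩

theorem congr (h : IsArg R S o) (hS : ∀ e, S e ↔ S' e) : IsArg R S' o := by
  obtain rfl : S = S' := funext fun e => propext (hS e)
  exact h

theorem insert (h : IsArg R S o) (k : Fin n) (hS : ∀ e, S' e ↔ S e ∨ e = k)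
    (hrefl : R k k) (htrans : ∀ a b c, R a b → R b c → R a c)
    (ho : ∀ f, o = Option.some f → R k f) : IsArg R S' (Option.some k) := by
  refine ⟨by simp, fun {f} hf => ?_⟩
  obtain rfl : k = f := by simpa using hf
  refine ⟨(hS k).2 (Or.inr rfl), fun e he => ?_⟩
  obtain he | rfl := (hS e).1 he
  · cases o with
    | none => exact absurd he (h.none rfl e)
    | some f => exact htrans _ _ _ (ho f rfl) ((h.some rfl).2 e he)
  · exact hrefl

theorem keep {f : Fin n} (h : IsArg R S (Option.some f)) (k : Fin n) (hS : ∀ e, S' e ↔ S e ∨ e = k)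
    (ho : R f k) : IsArg R S' (Option.some f) := by
  refine ⟨by simp, fun {g} hg => ?_⟩
  obtain rfl : f = g := by simpa using hg
  refine ⟨(hS f).2 (Or.inl (h.some rfl).1), fun e he => ?_⟩
  obtain he | rfl := (hS e).1 he
  · exact (h.some rfl).2 e he
  · exact ho

end IsArg

theorem lt_succ_and_iff {n k : ℕ} (hk : k < n) {p : Fin n → Prop} (h : ¬ p ⟨k, hk⟩) (e : Fin n) :
    (e.val < k ∧ p e) ↔ (e.val < k + 1 ∧ p e) := by
  refine ⟨fun he => ⟨by omega, he.2⟩, fun he => ⟨?_, he.2⟩⟩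
  rcases Nat.lt_succ_iff_lt_or_eq.1 he.1 with h' | h'
  · exact h'
  · exact absurd he.2 (by rwa [show e = ⟨k, hk⟩ from Fin.ext h'])

theorem lt_succ_and_iff_or {n k : ℕ} (hk : k < n) {p : Fin n → Prop} (h : p ⟨k, hk⟩) (e : Fin n) :
    (e.val < k + 1 ∧ p e) ↔ (e.val < k ∧ p e) ∨ e = ⟨k, hk⟩ := by
  constructor
  · rintro ⟨h1, h2⟩
    rcases Nat.lt_succ_iff_lt_or_eq.1 h1 with h' | h'
    · exact Or.inl ⟨h', h2⟩
    · exact Or.inr (Fin.ext h')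
  · rintro (⟨h1, h2⟩ | rfl)
    · exact ⟨by omega, h2⟩
    · exact ⟨by simp, h⟩

/-- `W` is the worst edge with positive value at machine `m`. -/
def IsWorst (I : AllocInstance) (x : Fin I.nE → ℝ) (m : Fin I.nM) (W : Option (Fin I.nE)) : Prop :=
  IsArg (fun f e => I.rankM e ≤ I.rankM f) (fun e => I.mach e = m ∧ 0 < x e) W

/-- `P` is the best candidate edge at job `j`. -/
def IsProp (I : AllocInstance) (x : Fin I.nE → ℝ) (j : Fin I.nJ) (P : Option (Fin I.nE)) : Prop :=
  IsArg (fun f e => I.rankJ f ≤ I.rankJ e) (fun e => I.job e = j ∧ I.Cand x e) P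

theorem worsts_spec {s : State} (hs : Inp I s) :
    Runs I.size worsts s fun s' => ∀ m : Fin I.nM, ∃ W, s'.nat 5 m = enc W ∧
      IsWorst I (alloc I s) m W := by
  refine Runs.seq_of (clearNat_spec I.nM (by simp [AllocInstance.size]) (by decide)
    fun s' hf => (hs.frame hf rfl).nM) fun s₁ h₁ hf₁ => ?_
  have hs₁ := hs.frame hf₁ rfl
  have ha₁ : alloc I s₁ = alloc I s := alloc_frame hf₁ rfl
  refine Runs.forTo I.nE (by simp [AllocInstance.size]; omega) (fun k s' =>
    ∀ m : Fin I.nM, ∃ W, s'.nat 5 m = enc W ∧ IsArg (fun f e => I.rankM e ≤ I.rankM f)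
      (fun e => e.val < k ∧ I.mach e = m ∧ 0 < alloc I s e) W) rfl
    (fun s' hf => (hs₁.frame hf rfl).nE) (fun m => ⟨none, ?_, .of_empty (by simp)⟩) ?_ ?_
  · simp [write_eq, h₁ m m.2]
  · intro k hk s' hf h8 hI
    have hs' := hs₁.frame hf rfl
    have ha : ∀ e : Fin I.nE, s'.real 3 e = alloc I s e := fun e => by
      rw [← ha₁, ← alloc_frame hf rfl]; rfl
    have hmach := hs'.mach ⟨k, hk⟩
    have hrank := hs'.rankM ⟨k, hk⟩
    have hak := ha ⟨k, hk⟩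
    simp only at hmach hrank hak
    refine Runs.ite (fun hpos => ?_) fun hpos => Runs.skip fun m => ?_
    · simp only [Test.Holds, RExp.eval, NExp.eval, h8, hak] at hpos
      obtain ⟨W, hW, hW'⟩ := hI (I.mach ⟨k, hk⟩)
      refine Runs.ite (fun hb => Runs.setNat fun m => ?_) fun hb => Runs.skip fun m => ?_
      · by_cases hm : m = I.mach ⟨k, hk⟩
        · subst hm
          refine ⟨some ⟨k, hk⟩, by simp [NExp.eval, h8, hmach, write_eq],
            hW'.insert ⟨k, hk⟩ (lt_succ_and_iff_or hk ⟨rfl, hpos⟩) le_rfl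
              (fun a b c hab hbc => hbc.trans hab) ?_⟩
          rintro f rfl
          simp only [Test.holds_or, Test.Holds, NExp.eval, h8, hmach, hW, enc_some,
            Nat.add_sub_cancel, hs'.rankM, hrank] at hb
          obtain hb | hb := hb
          · omega
          · exact hb.le
        · obtain ⟨V, hV, hV'⟩ := hI m
          refine ⟨V, ?_, hV'.congr (lt_succ_and_iff hk fun h => hm h.1.symm)⟩
          have : (m : ℕ) ≠ I.mach ⟨k, hk⟩ := fun h => hm (Fin.ext h)
          simpa [NExp.eval, h8, hmach, write_eq, Function.update_apply, this] using hV
      · by_cases hm : m = I.mach ⟨k, hk⟩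
        · subst hm
          simp only [Test.holds_or, Test.Holds, NExp.eval, h8, hmach, hW, not_or] at hb
          cases W with
          | none => simp at hb
          | some f =>
            simp only [enc_some, Nat.add_sub_cancel, hs'.rankM, hrank, not_lt] at hb
            exact ⟨some f, by simpa [write_eq] using hW,
              hW'.keep ⟨k, hk⟩ (lt_succ_and_iff_or hk ⟨rfl, hpos⟩) hb.2⟩
        · obtain ⟨V, hV, hV'⟩ := hI m
          exact ⟨V, by simpa [write_eq] using hV, hV'.congr (lt_succ_and_iff hk fun h => hm h.1.symm)⟩
    · simp only [Test.Holds, RExp.eval, NExp.eval, h8, hak] at hpos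
      obtain ⟨V, hV, hV'⟩ := hI m
      exact ⟨V, by simpa [write_eq] using hV, hV'.congr (lt_succ_and_iff hk fun h => hpos h.2)⟩
  · intro s' _ hI m
    obtain ⟨V, hV, hV'⟩ := hI m
    exact ⟨V, hV, hV'.congr (by simp)⟩

/-- The memory contains the loads for the allocation `x`. -/
structure Loaded (I : AllocInstance) (x : Fin I.nE → ℝ) (s : State) : Prop where
  alloc : ∀ e : Fin I.nE, s.real 3 e = x e
  loadJ : ∀ j : Fin I.nJ, s.real 4 j = I.loadJ x j
  loadM : ∀ m : Fin I.nM, s.real 5 m = I.loadM x m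

theorem Loaded.frame {x : Fin I.nE → ℝ} {s s' : State} {p : Prog} (h : Loaded I x s)
    (hf : Frame p s s') (h3 : p.setsReal 3 = false) (h4 : p.setsReal 4 = false)
    (h5 : p.setsReal 5 = false) : Loaded I x s' :=
  ⟨by rw [hf.real 3 h3]; exact h.alloc, by rw [hf.real 4 h4]; exact h.loadJ,
    by rw [hf.real 5 h5]; exact h.loadM⟩

/-- Some positive edge is worse than `e` if and only if the worst positive edge of the machine is,
so one comparison decides. -/
theorem candTest_holds {x : Fin I.nE → ℝ} {s : State} (hs : Inp I s) (hl : Loaded I x s)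
    {W : Fin I.nM → Option (Fin I.nE)} (hW : ∀ m : Fin I.nM, s.nat 5 m = enc (W m))
    (hW' : ∀ m, IsWorst I x m (W m)) {e : Fin I.nE} (h8 : s.nat 8 0 = e) :
    candTest.Holds s ↔ I.Cand x e := by
  simp only [candTest, AllocInstance.Cand, AllocInstance.Wanted, Test.holds_or, Test.Holds,
    NExp.eval, RExp.eval, h8, hl.alloc, hs.mach, hl.loadM, hs.cap, hs.quotaM, hW, hs.rankM]
  refine and_congr_right fun _ => or_congr_right ?_
  have := hW' (I.mach e)
  cases h : W (I.mach e) with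
  | none =>
    simp only [enc_none, not_true_eq_false, false_and, false_iff, not_exists, not_and]
    intro f hf hb
    exact (hW' (I.mach e)).none h f ⟨hb.1, hf⟩
  | some f =>
    obtain ⟨⟨hm, hf⟩, hmax⟩ := (hW' (I.mach e)).some h
    simp only [enc_some, Nat.add_sub_cancel, hs.rankM]
    constructor
    · rintro ⟨-, hr⟩
      exact ⟨f, hf, hm, hr⟩
    · rintro ⟨g, hg, hb⟩
      exact ⟨by omega, hb.2.trans_le (hmax g ⟨hb.1, hg⟩)⟩

theorem props_spec {x : Fin I.nE → ℝ} {s : State} (hs : Inp I s) (hl : Loaded I x s)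
    {W : Fin I.nM → Option (Fin I.nE)} (hW : ∀ m : Fin I.nM, s.nat 5 m = enc (W m))
    (hW' : ∀ m, IsWorst I x m (W m)) :
    Runs I.size props s fun s' => ∀ j : Fin I.nJ, ∃ P, s'.nat 6 j = enc P ∧ IsProp I x j P := by
  refine Runs.seq_of (clearNat_spec I.nJ (by simp [AllocInstance.size]; omega) (by decide)
    fun s' hf => (hs.frame hf rfl).nJ) fun s₁ h₁ hf₁ => ?_
  have hs₁ := hs.frame hf₁ rfl
  have hl₁ := hl.frame hf₁ rfl rfl rfl
  have hW₁ : ∀ m : Fin I.nM, s₁.nat 5 m = enc (W m) := by rw [hf₁.nat 5 rfl]; exact hW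
  refine Runs.forTo I.nE (by simp [AllocInstance.size]; omega) (fun k s' =>
    ∀ j : Fin I.nJ, ∃ P, s'.nat 6 j = enc P ∧ IsArg (fun f e => I.rankJ f ≤ I.rankJ e)
      (fun e => e.val < k ∧ I.job e = j ∧ I.Cand x e) P) rfl
    (fun s' hf => (hs₁.frame hf rfl).nE) (fun m => ⟨none, ?_, .of_empty (by simp)⟩) ?_ ?_
  · simp [write_eq, h₁ m m.2]
  · intro k hk s' hf h8 hI
    have hs' := hs₁.frame hf rfl
    have hl' := hl₁.frame hf rfl rfl rfl
    have hjob := hs'.job ⟨k, hk⟩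
    have hrank := hs'.rankJ ⟨k, hk⟩
    simp only at hjob hrank
    have hc := candTest_holds (e := ⟨k, hk⟩) hs' hl' (by rw [hf.nat 5 rfl]; exact hW₁) hW' h8
    refine Runs.ite (fun hpos => ?_) fun hpos => Runs.skip fun m => ?_
    · rw [hc] at hpos
      obtain ⟨W, hW, hW'⟩ := hI (I.job ⟨k, hk⟩)
      refine Runs.ite (fun hb => Runs.setNat fun m => ?_) fun hb => Runs.skip fun m => ?_
      · by_cases hm : m = I.job ⟨k, hk⟩
        · subst hm
          refine ⟨some ⟨k, hk⟩, by simp [NExp.eval, h8, hjob, write_eq],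
            hW'.insert ⟨k, hk⟩ (lt_succ_and_iff_or hk ⟨rfl, hpos⟩) le_rfl
              (fun a b c hab hbc => hab.trans hbc) ?_⟩
          rintro f rfl
          simp only [Test.holds_or, Test.Holds, NExp.eval, h8, hjob, hW, enc_some,
            Nat.add_sub_cancel, hs'.rankJ, hrank] at hb
          obtain hb | hb := hb
          · omega
          · exact hb.le
        · obtain ⟨V, hV, hV'⟩ := hI m
          refine ⟨V, ?_, hV'.congr (lt_succ_and_iff hk fun h => hm h.1.symm)⟩
          have : (m : ℕ) ≠ I.job ⟨k, hk⟩ := fun h => hm (Fin.ext h)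
          simpa [NExp.eval, h8, hjob, write_eq, Function.update_apply, this] using hV
      · by_cases hm : m = I.job ⟨k, hk⟩
        · subst hm
          simp only [Test.holds_or, Test.Holds, NExp.eval, h8, hjob, hW, not_or] at hb
          cases W with
          | none => simp at hb
          | some f =>
            simp only [enc_some, Nat.add_sub_cancel, hs'.rankJ, hrank, not_lt] at hb
            exact ⟨some f, by simpa [write_eq] using hW,
              hW'.keep ⟨k, hk⟩ (lt_succ_and_iff_or hk ⟨rfl, hpos⟩) hb.2⟩
        · obtain ⟨V, hV, hV'⟩ := hI m
          exact ⟨V, by simpa [write_eq] using hV, hV'.congr (lt_succ_and_iff hk fun h => hm h.1.symm)⟩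
    · rw [hc] at hpos
      obtain ⟨V, hV, hV'⟩ := hI m
      exact ⟨V, by simpa [write_eq] using hV, hV'.congr (lt_succ_and_iff hk fun h => hpos h.2)⟩
  · intro s' _ hI m
    obtain ⟨V, hV, hV'⟩ := hI m
    exact ⟨V, hV, hV'.congr (by simp)⟩

theorem enc_eq_zero {n : ℕ} {o : Option (Fin n)} : enc o = 0 ↔ o = none := by
  cases o <;> simp

open Classical in
/-- The edge refused when the job with proposal `P` proposes. -/
noncomputable def refusal (I : AllocInstance) (x : Fin I.nE → ℝ)
    (W : Fin I.nM → Option (Fin I.nE)) : Option (Fin I.nE) → Option (Fin I.nE)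
  | none => none
  | some e => if I.loadM x (I.mach e) < I.quotaM (I.mach e) then none else W (I.mach e)

theorem pointers_refusal {x : Fin I.nE → ℝ} (hx : I.Feasible x) {W : Fin I.nM → Option (Fin I.nE)}
    (hW : ∀ m, IsWorst I x m (W m)) {P : Fin I.nJ → Option (Fin I.nE)}
    (hP : ∀ j, IsProp I x j (P j)) : I.Pointers x P fun j => refusal I x W (P j) := by
  have key : ∀ {j f}, refusal I x W (P j) = some f → ∃ e, P j = some e ∧
      ¬ I.loadM x (I.mach e) < I.quotaM (I.mach e) ∧ W (I.mach e) = some f ∧ I.mach f = I.mach e ∧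
      0 < x f := by
    intro j f h
    cases hp : P j with
    | none => simp [hp, refusal] at h
    | some e =>
      simp only [hp, refusal, Option.ite_none_left_eq_some] at h
      exact ⟨e, rfl, h.1, h.2, ((hW _).some h.2).1⟩
  refine ⟨fun {j e} h => ((hP j).some h).1.1, fun {j e} h => ((hP j).some h).1.2,
    fun {j e} h e' he hc => ((hP j).some h).2 e' ⟨he, hc⟩,
    fun {j} h e he hc => (hP j).none h e ⟨he, hc⟩, fun {j f} h => ?_, fun {j f} h => ?_,
    fun {j f} h => ?_, fun {j f} h g hg hx => ?_, fun {j e} h he => ?_⟩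
  · obtain ⟨e, he, -, -, hm, -⟩ := key h
    exact ⟨e, he, hm⟩
  · obtain ⟨e, he, hl, -, hm, -⟩ := key h
    rw [hm]
    exact le_antisymm (hx.2.2 _) (not_lt.1 hl)
  · obtain ⟨e, he, -, -, -, h⟩ := key h
    exact h
  · obtain ⟨e, he, -, hf, hm, -⟩ := key h
    exact ((hW _).some hf).2 g ⟨hg.trans hm, hx⟩
  · simp only [he, refusal] at h
    -- At a full machine the candidate is wanted because of some worse positive edge, so a worst
    -- positive edge exists and the refusal is not `none`.
    by_contra hl
    rw [if_neg hl] at h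
    obtain hw | ⟨g, hg, hb⟩ := ((hP j).some he).1.2.2
    · exact hl hw
    · exact (hW _).none h g ⟨hb.1, hg⟩

/-- An active job is stored in array 12 if there is one. -/
def ActiveFound (I : AllocInstance) (x : Fin I.nE → ℝ) (s : State) : Prop :=
  (s.nat 12 0 = 0 ∧ ∀ j, ¬ I.Active x j) ∨ ∃ j : Fin I.nJ, s.nat 12 0 = j + 1 ∧ I.Active x j

theorem links_spec {x : Fin I.nE → ℝ} {s : State} (hs : Inp I s) (hl : Loaded I x s)
    {W : Fin I.nM → Option (Fin I.nE)} (hW : ∀ m : Fin I.nM, s.nat 5 m = enc (W m))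
    {P : Fin I.nJ → Option (Fin I.nE)} (hP : ∀ j : Fin I.nJ, s.nat 6 j = enc (P j))
    (hP' : ∀ j, IsProp I x j (P j)) :
    Runs I.size links s fun s' => (∀ j : Fin I.nJ, s'.nat 7 j = enc (refusal I x W (P j))) ∧
      ActiveFound I x s' := by
  refine Runs.seq_of (Runs.setNat (Q := fun s' => s'.nat 12 0 = 0)
    (by simp [NExp.eval, write_eq])) fun s₁ h₁ hf₁ => ?_
  have hs₁ := hs.frame hf₁ rfl
  have hl₁ := hl.frame hf₁ rfl rfl rfl
  have hW₁ : ∀ m : Fin I.nM, s₁.nat 5 m = enc (W m) := by rw [hf₁.nat 5 rfl]; exact hW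
  have hP₁ : ∀ j : Fin I.nJ, s₁.nat 6 j = enc (P j) := by rw [hf₁.nat 6 rfl]; exact hP
  refine Runs.forTo I.nJ (by simp [AllocInstance.size]; omega) (fun k s' =>
    (∀ j : Fin I.nJ, j.val < k → s'.nat 7 j = enc (refusal I x W (P j))) ∧
      ((s'.nat 12 0 = 0 ∧ ∀ j : Fin I.nJ, j.val < k → ¬ I.Active x j) ∨
        ∃ j : Fin I.nJ, s'.nat 12 0 = j + 1 ∧ I.Active x j)) rfl
    (fun s' hf => (hs₁.frame hf rfl).nJ) ⟨by simp, Or.inl ⟨by simp [write_eq, h₁], by simp⟩⟩ ?_ ?_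
  · rintro k hk s' hf h8 ⟨hF, hA⟩
    have hs' := hs₁.frame hf rfl
    have hl' := hl₁.frame hf rfl rfl rfl
    have hW' : ∀ m : Fin I.nM, s'.nat 5 m = enc (W m) := by rw [hf.nat 5 rfl]; exact hW₁
    have hPk : s'.nat 6 k = enc (P ⟨k, hk⟩) := by rw [hf.nat 6 rfl]; exact hP₁ ⟨k, hk⟩
    have hlk := hl'.loadJ ⟨k, hk⟩
    have hqk := hs'.quotaJ ⟨k, hk⟩
    simp only at hlk hqk
    have hlt : ∀ j : Fin I.nJ, j.val < k + 1 → j.val < k ∨ j = ⟨k, hk⟩ := fun j hj => by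
      rcases Nat.lt_succ_iff_lt_or_eq.1 hj with h | h
      · exact Or.inl h
      · exact Or.inr (Fin.ext h)
    have hne : ∀ j : Fin I.nJ, j.val < k → (j : ℕ) ≠ k := fun j hj => hj.ne
    refine Runs.seq (Runs.setNat (Runs.ite (fun hb => Runs.skip ?_) fun hb => ?_))
    · have hn : P ⟨k, hk⟩ = none := by
        simpa [Test.Holds, NExp.eval, write_eq, h8, hPk, enc_eq_zero] using hb
      refine ⟨fun j hj => ?_, ?_⟩
      · obtain hj | rfl := hlt j hj
        · simpa [NExp.eval, write_eq, h8, hne j hj] using hF j hj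
        · simp [NExp.eval, write_eq, h8, hn, refusal]
      · refine hA.imp (fun h => ⟨by simpa [write_eq] using h.1, fun j hj => ?_⟩)
          fun ⟨j, h, ha⟩ => ⟨j, by simpa [write_eq] using h, ha⟩
        obtain hj | rfl := hlt j hj
        · exact h.2 j hj
        · rintro ⟨-, e, he, hc⟩
          exact (hP' _).none hn e ⟨he, hc⟩
    · obtain ⟨e, he⟩ : ∃ e, P ⟨k, hk⟩ = some e := by
        rw [← Option.ne_none_iff_exists']
        simpa [Test.Holds, NExp.eval, write_eq, h8, hPk, enc_eq_zero] using hb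
      rw [he, enc_some] at hPk
      have hec := ((hP' _).some he).1
      -- Since job `k` has a candidate, it is active exactly if it has free quota; the intermediate
      -- condition records the outcome before its refusal is entered.
      refine Runs.seq_of (R := fun s'' => s''.nat 7 = Function.update (s'.nat 7) k 0 ∧
          s''.nat 8 0 = k ∧ s''.nat 5 = s'.nat 5 ∧ s''.nat 6 = s'.nat 6 ∧ s''.nat 2 = s'.nat 2 ∧
          s''.real = s'.real ∧ ((s''.nat 12 0 = 0 ∧ ∀ j : Fin I.nJ, j.val < k + 1 → ¬ I.Active x j) ∨
            ∃ j : Fin I.nJ, s''.nat 12 0 = j + 1 ∧ I.Active x j))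
        (Runs.ite (fun hb => Runs.setNat ?_) fun hb => Runs.skip ?_) ?_
      · simp only [Test.Holds, NExp.eval, RExp.eval, write_eq, h8, Nat.reduceEqDiff, if_false, hlk,
          hqk] at hb
        exact ⟨by simp [NExp.eval, write_eq, h8], by simp [NExp.eval, write_eq, h8],
          by simp [write_eq], by simp [write_eq], by simp [write_eq], rfl,
          Or.inr ⟨⟨k, hk⟩, by simp [NExp.eval, write_eq, h8], hb, e, hec⟩⟩
      · simp only [Test.Holds, NExp.eval, RExp.eval, write_eq, h8, Nat.reduceEqDiff, if_false, hlk,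
          hqk] at hb
        refine ⟨by simp [NExp.eval, write_eq, h8], by simp [write_eq, h8],
          by simp [write_eq], by simp [write_eq], by simp [write_eq], rfl, ?_⟩
        refine hA.imp (fun h => ⟨by simpa [write_eq] using h.1, fun j hj => ?_⟩)
          fun ⟨j, h, ha⟩ => ⟨j, by simpa [write_eq] using h, ha⟩
        obtain hj | rfl := hlt j hj
        · exact h.2 j hj
        · exact fun h => hb h.1
      · rintro s'' ⟨h7, h8', h5, h6, h2, hr, hA'⟩ -
        have hm : s''.nat 2 e = I.mach e := by rw [h2]; exact hs'.mach e
        have hlm : s''.real 5 (I.mach e) = I.loadM x (I.mach e) := by rw [hr]; exact hl'.loadM _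
        have hqm : s''.real 2 (I.mach e) = I.quotaM (I.mach e) := by rw [hr]; exact hs'.quotaM _
        refine Runs.ite (fun hb => Runs.skip ⟨fun j hj => ?_, ?_⟩)
          fun hb => Runs.setNat ⟨fun j hj => ?_, ?_⟩
        · simp only [Test.Holds, NExp.eval, RExp.eval, h8', h6, hPk, Nat.add_sub_cancel, hm, hlm,
            hqm] at hb
          obtain hj | rfl := hlt j hj
          · simpa [write_eq, h7, hne j hj] using hF j hj
          · simp [write_eq, h7, he, refusal, hb]
        · simpa [write_eq] using hA'
        · simp only [Test.Holds, NExp.eval, RExp.eval, h8', h6, hPk, Nat.add_sub_cancel, hm, hlm,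
            hqm] at hb
          obtain hj | rfl := hlt j hj
          · simpa [NExp.eval, h8', write_eq, h7, hne j hj] using hF j hj
          · simp [NExp.eval, h8', h6, hPk, write_eq, he, refusal, hb, hm, h5, hW']
        · simpa [write_eq] using hA'
  · rintro s' - ⟨hF, hA⟩
    exact ⟨fun j => hF j j.2, hA.imp (fun h => ⟨h.1, fun j => h.2 j j.2⟩) id⟩

/-- A candidate edge that its job prefers to an edge with positive value is stored in array 11 if
there is one. -/
def EnvyFound (I : AllocInstance) (x : Fin I.nE → ℝ) (s : State) : Prop :=
  (s.nat 11 0 = 0 ∧ I.EnvyFree x) ∨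
    ∃ e f : Fin I.nE, s.nat 11 0 = e + 1 ∧ I.Cand x e ∧ I.BetterAtJob e f ∧ 0 < x f

/-- A positive edge is envied by some candidate if and only if it is worse than the best candidate
of its job. One pass over the edges is therefore enough. -/
theorem envy_spec {x : Fin I.nE → ℝ} {s : State} (hs : Inp I s) (hl : Loaded I x s)
    {P : Fin I.nJ → Option (Fin I.nE)} (hP : ∀ j : Fin I.nJ, s.nat 6 j = enc (P j))
    (hP' : ∀ j, IsProp I x j (P j)) : Runs I.size envy s (EnvyFound I x) := by
  refine Runs.seq_of (Runs.setNat (Q := fun s' => s'.nat 11 0 = 0)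
    (by simp [NExp.eval, write_eq])) fun s₁ h₁ hf₁ => ?_
  have hs₁ := hs.frame hf₁ rfl
  have hl₁ := hl.frame hf₁ rfl rfl rfl
  have hP₁ : ∀ j : Fin I.nJ, s₁.nat 6 j = enc (P j) := by rw [hf₁.nat 6 rfl]; exact hP
  refine Runs.forTo I.nE (by simp [AllocInstance.size]; omega) (fun k s' =>
    (s'.nat 11 0 = 0 ∧ ∀ e f : Fin I.nE, f.val < k → I.Cand x e → I.BetterAtJob e f → ¬ 0 < x f) ∨
      ∃ e f : Fin I.nE, s'.nat 11 0 = e + 1 ∧ I.Cand x e ∧ I.BetterAtJob e f ∧ 0 < x f) rfl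
    (fun s' hf => (hs₁.frame hf rfl).nE) (Or.inl ⟨by simp [write_eq, h₁], by simp⟩) ?_ ?_
  · rintro k hk s' hf h8 hI
    have hs' := hs₁.frame hf rfl
    have hl' := hl₁.frame hf rfl rfl rfl
    have hP₂ : ∀ j : Fin I.nJ, s'.nat 6 j = enc (P j) := by rw [hf.nat 6 rfl]; exact hP₁
    have hjob := hs'.job ⟨k, hk⟩
    have hrank := hs'.rankJ ⟨k, hk⟩
    have hxk := hl'.alloc ⟨k, hk⟩
    simp only at hjob hrank hxk
    refine Runs.ite (fun hb => Runs.setNat (Or.inr ?_)) fun hb => Runs.skip ?_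
    · simp only [Test.Holds, NExp.eval, RExp.eval, h8, hxk, hjob, hP₂, enc_eq_zero, hrank] at hb
      obtain ⟨hpos, hn, hr⟩ := hb
      obtain ⟨e, he⟩ := Option.ne_none_iff_exists'.1 hn
      rw [he, enc_some, Nat.add_sub_cancel, hs'.rankJ] at hr
      obtain ⟨⟨hej, hc⟩, -⟩ := (hP' _).some he
      exact ⟨e, ⟨k, hk⟩, by simp [NExp.eval, write_eq, h8, hjob, hP₂, he], hc, ⟨hej.symm, hr⟩, hpos⟩
    · refine hI.imp (fun h => ⟨by simpa [write_eq] using h.1, fun e f hf hc hbt hpos => ?_⟩)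
        fun ⟨e, f, h, h'⟩ => ⟨e, f, by simpa [write_eq] using h, h'⟩
      rcases Nat.lt_succ_iff_lt_or_eq.1 hf with hlt | heq
      · exact h.2 e f hlt hc hbt hpos
      · obtain rfl : f = ⟨k, hk⟩ := Fin.ext heq
        refine hb ?_
        simp only [Test.Holds, NExp.eval, RExp.eval, h8, hxk, hjob, hP₂, enc_eq_zero, hrank]
        cases hp : P (I.job ⟨k, hk⟩) with
        | none => exact absurd ⟨hbt.1.symm, hc⟩ ((hP' _).none hp e)
        | some g =>
          refine ⟨hpos, by simp, ?_⟩
          rw [enc_some, Nat.add_sub_cancel, hs'.rankJ]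
          exact (((hP' _).some hp).2 e ⟨hbt.1.symm, hc⟩).trans_lt hbt.2
  · rintro s' - hI
    exact hI.imp (fun h => ⟨h.1, fun e f => h.2 e f f.2⟩) id

/-- The memory contains the input and the pointers. -/
structure Ctx (I : AllocInstance) (P F : Fin I.nJ → Option (Fin I.nE)) (s : State) : Prop where
  inp : Inp I s
  prop : ∀ j : Fin I.nJ, s.nat 6 j = enc (P j)
  refusal : ∀ j : Fin I.nJ, s.nat 7 j = enc (F j)

theorem Ctx.frame {P F : Fin I.nJ → Option (Fin I.nE)} {s s' : State} {p : Prog} (h : Ctx I P F s)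
    (hf : Frame p s s') (hp : p.keepsInput = true) (h6 : p.setsNat 6 = false)
    (h7 : p.setsNat 7 = false) : Ctx I P F s' :=
  ⟨h.inp.frame hf hp, by rw [hf.nat 6 h6]; exact h.prop, by rw [hf.nat 7 h7]; exact h.refusal⟩

theorem scan_spec {s : State} (hs : Inp I s) (hx : I.Feasible (alloc I s)) :
    Runs I.size scan s fun s' => Loaded I (alloc I s) s' ∧ EnvyFound I (alloc I s) s' ∧
      ActiveFound I (alloc I s) s' ∧ ∃ P F, Ctx I P F s' ∧ I.Pointers (alloc I s) P F := by
  refine Runs.seq_of (loads_spec hs) fun s₁ ⟨hJ, hM⟩ hf₁ => ?_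
  have hs₁ := hs.frame hf₁ rfl
  have ha₁ := alloc_frame (I := I) hf₁ rfl
  have hl₁ : Loaded I (alloc I s) s₁ := ⟨fun e => congrFun ha₁ e, hJ, hM⟩
  refine Runs.seq_of (worsts_spec hs₁) fun s₂ h₂ hf₂ => ?_
  rw [ha₁] at h₂
  choose W hW hW' using h₂
  have hs₂ := hs₁.frame hf₂ rfl
  have hl₂ := hl₁.frame hf₂ rfl rfl rfl
  refine Runs.seq_of (props_spec hs₂ hl₂ hW hW') fun s₃ h₃ hf₃ => ?_
  choose P hP hP' using h₃
  have hs₃ := hs₂.frame hf₃ rfl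
  have hl₃ := hl₂.frame hf₃ rfl rfl rfl
  refine Runs.seq_of (links_spec (W := W) hs₃ hl₃ (by rw [hf₃.nat 5 rfl]; exact hW) hP hP')
    fun s₄ ⟨hF, hA⟩ hf₄ => ?_
  have hP₄ : ∀ j : Fin I.nJ, s₄.nat 6 j = enc (P j) := by rw [hf₄.nat 6 rfl]; exact hP
  have hl₄ := hl₃.frame hf₄ rfl rfl rfl
  have hc : Ctx I P (fun j => refusal I (alloc I s) W (P j)) s₄ := ⟨hs₃.frame hf₄ rfl, hP₄, hF⟩
  refine (envy_spec hc.inp hl₄ hP₄ hP').mono fun s₅ h₅ hf₅ => ?_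
  refine ⟨hl₄.frame hf₅ rfl rfl rfl, h₅, ?_, P, _, hc.frame hf₅ rfl rfl rfl,
    pointers_refusal hx hW' hP'⟩
  unfold ActiveFound
  rw [hf₅.nat 12 rfl]
  exact hA

/-! ## Output -/

/-- The allocation after all changes announced in an output. -/
noncomputable def after {n : ℕ} : (Fin n → ℝ) → List OutSym → (Fin n → ℝ)
  | x, [] => x
  | x, .put f v :: l => after (fun e => if (e : ℕ) = f then v else x e) l
  | x, .close _ :: l => after x l

theorem after_append {n : ℕ} (l l' : List OutSym) (x : Fin n → ℝ) :
    after x (l ++ l') = after (after x l) l' := by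
  induction l generalizing x with
  | nil => rfl
  | cons a l ih => cases a <;> exact ih _

theorem decode_append {n : ℕ} (l l' : List OutSym) (x : Fin n → ℝ) :
    decode x (l ++ l') = decode x l ++ decode (after x l) l' := by
  induction l generalizing x with
  | nil => rfl
  | cons a l ih =>
    cases a with
    | put f v => exact ih _
    | close e => exact congrArg _ (ih _)

theorem responsePath_append {I : AllocInstance} (l l' : List (ℕ × (Fin I.nE → ℝ)))
    (x y z : Fin I.nE → ℝ) (h : I.ResponsePath x l y) (h' : I.ResponsePath y l' z) :
    I.ResponsePath x (l ++ l') z := by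
  induction l generalizing x with
  | nil =>
    obtain rfl : y = x := h
    exact h'
  | cons a l ih => exact ⟨h.1, ih _ h.2⟩

/-- The complete steps on the output lead from `x₀` to `z`, and all announced changes lead to the
allocation in the memory. -/
structure Pending (I : AllocInstance) (x₀ z : Fin I.nE → ℝ) (s : State) : Prop where
  after_eq : after x₀ s.out = alloc I s
  path : I.ResponsePath x₀ (decode x₀ s.out) z

/-- The steps on the output lead from `x₀` to the allocation in the memory. -/
abbrev Good (I : AllocInstance) (x₀ : Fin I.nE → ℝ) (s : State) : Prop := Pending I x₀ (alloc I s) s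

theorem Pending.frame {x₀ z : Fin I.nE → ℝ} {s s' : State} {p : Prog} (h : Pending I x₀ z s)
    (hf : Frame p s s') (h3 : p.setsReal 3 = false) (hw : p.writes = false) :
    Pending I x₀ z s' :=
  ⟨by rw [hf.out hw, alloc_frame hf h3]; exact h.after_eq, by rw [hf.out hw]; exact h.path⟩

theorem Good.frame {x₀ : Fin I.nE → ℝ} {s s' : State} {p : Prog} (h : Good I x₀ s)
    (hf : Frame p s s') (h3 : p.setsReal 3 = false) (hw : p.writes = false) : Good I x₀ s' := by
  unfold Good
  rw [alloc_frame hf h3]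
  exact Pending.frame h hf h3 hw

theorem NExp.eval_congr {s s' : State} (h : s'.nat = s.nat) (u : NExp) : u.eval s' = u.eval s := by
  induction u with
  | const k => rfl
  | get a i ih => simp [NExp.eval, ih, h]
  | add u v ihu ihv => simp [NExp.eval, ihu, ihv]
  | sub u v ihu ihv => simp [NExp.eval, ihu, ihv]

/-- Change the value of edge `u` and announce this. -/
def assign (u : NExp) (v : RExp) : Prog := .seq (.setReal 3 u v) (.put u (.get 3 u))

/-- Every change in the memory is announced at once, so output and memory describe the same
allocation even in the middle of a step, while `z` stays the result of the last complete step. -/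
theorem assign_spec {x₀ z : Fin I.nE → ℝ} {s : State} {u : NExp} {v : RExp} {e : Fin I.nE}
    (h : Pending I x₀ z s) (hu : u.eval s = e) :
    Runs N (assign u v) s fun s' =>
      Pending I x₀ z s' ∧ alloc I s' = Function.update (alloc I s) e (v.eval s) := by
  -- The address depends only on natural numbers, so it is the same after the assignment.
  have hu' : ∀ r o, u.eval { nat := s.nat, real := r, out := o } = e := fun r o =>
    (NExp.eval_congr (s := s) (by rfl) u).trans hu
  refine Runs.seq (Runs.setReal (Runs.put ?_))
  have ha : alloc I { s with real := write s.real 3 (u.eval s) (v.eval s) } =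
      Function.update (alloc I s) e (v.eval s) := by
    funext g
    simp only [alloc, write_eq, if_true, hu, Function.update_apply, Fin.val_inj]
  refine ⟨⟨?_, ?_⟩, ha⟩
  · rw [after_append, h.after_eq]
    refine Eq.trans ?_ ha.symm
    funext g
    simp only [after, hu', RExp.eval, write_eq, if_true, Function.update_apply, Fin.val_inj]
  · simp only [decode_append, decode, List.append_nil]
    exact h.path

theorem close_spec {x₀ z : Fin I.nE → ℝ} {s : State} {u : NExp} {e : Fin I.nE}
    (h : Pending I x₀ z s) (hu : u.eval s = e) (hb : I.BetterResponse z e (alloc I s)) :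
    Runs N (.close u) s fun s' => Good I x₀ s' ∧ alloc I s' = alloc I s := by
  refine Runs.close ⟨⟨?_, ?_⟩, rfl⟩
  · rw [after_append, h.after_eq]; rfl
  · rw [decode_append]
    refine responsePath_append _ _ _ _ _ h.path ⟨⟨e, hu.symm, ?_⟩, ?_⟩
    · rw [h.after_eq]; exact hb
    · rw [h.after_eq]; rfl

/-- A step that raises edge `u` by `a`. -/
def raiseProg (u : NExp) (a : RExp) : Prog := .seq (assign u (.add (.get 3 u) a)) (.close u)

theorem raiseProg_spec {x₀ : Fin I.nE → ℝ} {s : State} {u : NExp} {a : RExp} {e : Fin I.nE}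
    {z : Fin I.nE → ℝ} (h : Pending I x₀ z s) (hu : u.eval s = e)
    (hb : I.BetterResponse z e (AllocInstance.raise (alloc I s) e (a.eval s))) :
    Runs N (raiseProg u a) s fun s' =>
      Good I x₀ s' ∧ alloc I s' = AllocInstance.raise (alloc I s) e (a.eval s) := by
  refine Runs.seq_of (assign_spec h hu) fun s₁ ⟨h₁, ha₁⟩ hf₁ => ?_
  have ha : alloc I s₁ = AllocInstance.raise (alloc I s) e (a.eval s) := by
    simp only [ha₁, RExp.eval, hu]; rfl
  have hu₁ : u.eval s₁ = e :=
    (NExp.eval_congr (funext fun b => hf₁.nat b rfl) u).trans hu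
  refine (close_spec h₁ hu₁ (ha ▸ hb)).mono fun s₂ ⟨h₂, ha₂⟩ _ => ⟨h₂, ha₂.trans ha⟩

/-- A step that raises edge `u` by `a` and lowers edge `w` by the content of array 6. -/
def shiftProg (u w : NExp) (a : RExp) : Prog :=
  .seq (assign u (.add (.get 3 u) a)) (.seq (assign w (.sub (.get 3 w) (rcell 6))) (.close u))

theorem shiftProg_spec {x₀ : Fin I.nE → ℝ} {s : State} {u w : NExp} {a : RExp} {e f : Fin I.nE}
    (h : Good I x₀ s) (hu : u.eval s = e) (hw : w.eval s = f) (hne : f ≠ e)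
    (hb : I.BetterResponse (alloc I s) e
      (AllocInstance.shift (alloc I s) e f (a.eval s) (s.real 6 0))) :
    Runs N (shiftProg u w a) s fun s' => Good I x₀ s' ∧
      alloc I s' = AllocInstance.shift (alloc I s) e f (a.eval s) (s.real 6 0) := by
  refine Runs.seq_of (assign_spec h hu) fun s₁ ⟨h₁, ha₁⟩ hf₁ => ?_
  have hw₁ : w.eval s₁ = f :=
    (NExp.eval_congr (funext fun b => hf₁.nat b rfl) w).trans hw
  refine Runs.seq_of (assign_spec h₁ hw₁) fun s₂ ⟨h₂, ha₂⟩ hf₂ => ?_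
  have hu₂ : u.eval s₂ = e :=
    (NExp.eval_congr ((funext fun b => hf₂.nat b rfl).trans (funext fun b => hf₁.nat b rfl)) u).trans hu
  have h6 : s₁.real 6 0 = s.real 6 0 := by rw [hf₁.real 6 rfl]
  have h3 : s₁.real 3 f = alloc I s f := by
    have := congrFun ha₁ f
    rwa [Function.update_of_ne hne] at this
  have ha : alloc I s₂ = AllocInstance.shift (alloc I s) e f (a.eval s) (s.real 6 0) := by
    simp only [ha₂, ha₁, RExp.eval, NExp.eval, hu, hw₁, h6, h3]; rfl
  exact (close_spec h₂ hu₂ (ha ▸ hb)).mono fun s₃ ⟨h₃, ha₃⟩ _ => ⟨h₃, ha₃.trans ha⟩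

/-- Replace the content of the real variable `b` by its minimum with `v`. -/
def setMin (b : ℕ) (v : RExp) : Prog := .ite (.realLt v (rcell b)) (.setReal b (.const 0) v) .skip

theorem setMin_spec {s : State} {b : ℕ} {v : RExp} :
    Runs N (setMin b v) s fun s' => s'.real b 0 = min (s.real b 0) (v.eval s) := by
  refine Runs.ite (fun h => Runs.setReal ?_) fun h => Runs.skip ?_
  · simp only [Test.Holds, RExp.eval, NExp.eval] at h
    simp [NExp.eval, write_eq, min_eq_right h.le]
  · simp only [Test.Holds, RExp.eval, NExp.eval, not_lt] at h
    exact (min_eq_left h).symm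

/-! ## Removing envy -/

namespace AllocInstance

variable {x : Fin I.nE → ℝ} {e : Fin I.nE}

open Classical in
/-- Lower all edges to zero that an end vertex of `e` likes less than `e`. -/
noncomputable def clear (I : AllocInstance) (x : Fin I.nE → ℝ) (e : Fin I.nE) : Fin I.nE → ℝ :=
  fun f => if I.BetterAtJob e f ∨ I.BetterAtMach e f then 0 else x f

theorem clear_self : I.clear x e e = x e := by
  simp [clear, BetterAtJob, BetterAtMach]

theorem clear_le (hx : I.Feasible x) (f : Fin I.nE) : I.clear x e f ≤ x f := by
  unfold clear
  split_ifs
  · exact (hx.1 f).1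
  · exact le_rfl

theorem sum_ite_le {n : ℕ} {x y : Fin n → ℝ} (h : ∀ f, y f ≤ x f) (p : Fin n → Prop)
    [DecidablePred p] : (∑ f, if p f then y f else 0) ≤ ∑ f, if p f then x f else 0 := by
  refine Finset.sum_le_sum fun f _ => ?_
  split_ifs
  · exact h f
  · exact le_rfl

theorem sum_ite_lt {n : ℕ} {x y : Fin n → ℝ} (h : ∀ f, y f ≤ x f) (p : Fin n → Prop)
    [DecidablePred p] {g : Fin n} (hp : p g) (hg : y g < x g) :
    (∑ f, if p f then y f else 0) < ∑ f, if p f then x f else 0 := by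
  refine Finset.sum_lt_sum (fun f _ => ?_) ⟨g, Finset.mem_univ _, by simpa [hp] using hg⟩
  split_ifs
  · exact h f
  · exact le_rfl

theorem loadJ_clear_le (hx : I.Feasible x) (j : Fin I.nJ) :
    I.loadJ (I.clear x e) j ≤ I.loadJ x j := sum_ite_le (clear_le hx) _

theorem loadM_clear_le (hx : I.Feasible x) (m : Fin I.nM) :
    I.loadM (I.clear x e) m ≤ I.loadM x m := sum_ite_le (clear_le hx) _

/-- Emptying the worse edges makes room at the job, where `g` was positive, and at the machine,
which had room or held a worse positive edge. So `e` can really rise, and afterwards its job holds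
nothing worse than `e`. -/
theorem envy_step (hx : I.Feasible x) (he : I.Cand x e) {g : Fin I.nE} (hg : I.BetterAtJob e g)
    (hxg : 0 < x g) {a : ℝ}
    (ha : a = min (min (I.cap e - I.clear x e e) (I.quotaJ (I.job e) - I.loadJ (I.clear x e) (I.job e)))
      (I.quotaM (I.mach e) - I.loadM (I.clear x e) (I.mach e))) :
    I.BetterResponse x e (raise (I.clear x e) e a) ∧
      I.phi (raise (I.clear x e) e a) < I.phi x := by
  have hle := clear_le (e := e) hx
  have hge : ∀ f, 0 ≤ I.clear x e f := fun f => by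
    unfold clear
    split_ifs
    · exact le_rfl
    · exact (hx.1 f).1
  have b1 : a ≤ I.cap e - I.clear x e e := ha ▸ (min_le_left _ _).trans (min_le_left _ _)
  have b2 : a ≤ I.quotaJ (I.job e) - I.loadJ (I.clear x e) (I.job e) :=
    ha ▸ (min_le_left _ _).trans (min_le_right _ _)
  have b3 : a ≤ I.quotaM (I.mach e) - I.loadM (I.clear x e) (I.mach e) := ha ▸ min_le_right _ _
  have hpos : 0 < a := by
    rw [ha, lt_min_iff, lt_min_iff, clear_self]
    refine ⟨⟨sub_pos.2 he.1, sub_pos.2 ?_⟩, sub_pos.2 ?_⟩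
    · refine lt_of_lt_of_le ?_ (hx.2.1 (I.job e))
      exact sum_ite_lt hle _ hg.1 (by simpa [clear, hg] using hxg)
    · obtain h | ⟨f, hf, hb⟩ := he.2
      · exact (loadM_clear_le hx _).trans_lt h
      · refine lt_of_lt_of_le ?_ (hx.2.2 (I.mach e))
        exact sum_ite_lt hle _ hb.1 (by simpa [clear, hb] using hf)
  have hne : ∀ f, f ≠ e → raise (I.clear x e) e a f = I.clear x e f := fun f hf => by
    simp [raise, hf]
  refine ⟨⟨⟨he.1, Or.inr ⟨g, hxg, hg⟩, he.2⟩, ⟨fun f => ?_, fun j => ?_, fun m => ?_⟩, ?_,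
    fun f hf => ⟨by rw [hne f hf]; exact hle f, fun hlt => ?_⟩⟩, ?_⟩
  · by_cases hf : f = e
    · subst hf
      simp only [raise, Function.update_self]
      exact ⟨by linarith [hge f], by linarith⟩
    · rw [hne f hf]
      exact ⟨hge f, (hle f).trans (hx.1 f).2⟩
  · rw [loadJ_raise]
    split_ifs with h
    · subst h; linarith
    · linarith [hx.2.1 j, loadJ_clear_le (e := e) hx j]
  · rw [loadM_raise]
    split_ifs with h
    · subst h; linarith
    · linarith [hx.2.2 m, loadM_clear_le (e := e) hx m]
  · simp only [raise, Function.update_self, clear_self]; linarith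
  · rw [hne f hf, clear] at hlt
    split_ifs at hlt with h
    · exact h
    · exact absurd hlt (lt_irrefl _)
  · refine phi_lt hxg hg (fun f hf => ?_) fun f hf => by rw [hne f hf]; exact hle f
    rw [hne f (by rintro rfl; exact lt_irrefl _ hf.2)]
    simp [clear, hf]

end AllocInstance

/-- The edge in array 11. -/
abbrev envyEdge : NExp := .pred (cell 11)

/-- An end vertex of the edge in array 11 likes that edge more than the edge in the counter. -/
def worseTest : Test :=
  .or (.and (.natEq (.get 1 ctr) (.get 1 envyEdge)) (.natLt (.get 3 envyEdge) (.get 3 ctr)))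
    (.and (.natEq (.get 2 ctr) (.get 2 envyEdge)) (.natLt (.get 4 envyEdge) (.get 4 ctr)))

/-- A step along the edge in array 11, which lowers to zero whatever may be lowered. -/
def envyStep : Prog :=
  .seq (forTo numE (.ite worseTest (assign ctr .zero) .skip)) <|
  .seq loads <|
  .seq (.setReal 6 (.const 0) (.sub (.get 0 envyEdge) (.get 3 envyEdge))) <|
  .seq (setMin 6 (.sub (.get 1 (.get 1 envyEdge)) (.get 4 (.get 1 envyEdge)))) <|
  .seq (setMin 6 (.sub (.get 2 (.get 2 envyEdge)) (.get 5 (.get 2 envyEdge)))) <|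
  raiseProg envyEdge (rcell 6)

theorem envyStep_spec {x₀ : Fin I.nE → ℝ} {s : State} (hs : Inp I s) (hg : Good I x₀ s)
    (hx : I.Feasible (alloc I s)) {e f : Fin I.nE} (h11 : s.nat 11 0 = e + 1)
    (he : I.Cand (alloc I s) e) (hb : I.BetterAtJob e f) (hf : 0 < alloc I s f) :
    Runs I.size envyStep s fun s' => Good I x₀ s' ∧ I.Feasible (alloc I s') ∧
      I.phi (alloc I s') < I.phi (alloc I s) := by
  classical
  -- The edges are lowered one by one, but the completed steps still end at the old allocation:
  -- lowering and raising form a single better-response step.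
  have loop : Runs I.size (forTo numE (.ite worseTest (assign ctr .zero) .skip)) s fun s' =>
      Pending I x₀ (alloc I s) s' ∧ alloc I s' = I.clear (alloc I s) e := by
    refine Runs.forTo I.nE (by simp [AllocInstance.size]; omega) (fun k s' =>
      Pending I x₀ (alloc I s) s' ∧ alloc I s' =
        fun g => if g.val < k then I.clear (alloc I s) e g else alloc I s g) rfl
      (fun s' hf => (hs.frame hf rfl).nE) ⟨⟨hg.after_eq, hg.path⟩, by simp; rfl⟩ ?_ ?_
    · rintro k hk s' hfr h8 ⟨hp, ha⟩
      have hs' := hs.frame hfr rfl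
      have hkn : ctr.eval s' = ((⟨k, hk⟩ : Fin I.nE) : ℕ) := h8
      have h11' : s'.nat 11 0 = e + 1 := by rw [hfr.nat 11 rfl, h11]
      have htest : worseTest.Holds s' ↔ I.BetterAtJob e ⟨k, hk⟩ ∨ I.BetterAtMach e ⟨k, hk⟩ := by
        have hj := hs'.job ⟨k, hk⟩
        have hm := hs'.mach ⟨k, hk⟩
        have hrj := hs'.rankJ ⟨k, hk⟩
        have hrm := hs'.rankM ⟨k, hk⟩
        simp only at hj hm hrj hrm
        simp only [worseTest, Test.holds_or, Test.Holds, NExp.eval, h8, h11', Nat.add_sub_cancel,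
          hs'.job, hs'.mach, hs'.rankJ, hs'.rankM, hj, hm, hrj, hrm, Fin.val_inj,
          AllocInstance.BetterAtJob, AllocInstance.BetterAtMach]
      refine Runs.ite (fun hw => ?_) fun hw => Runs.skip ⟨⟨hp.after_eq, hp.path⟩, ?_⟩
      · rw [htest] at hw
        refine (assign_spec hp hkn).mono fun s'' ⟨hp', ha'⟩ _ => ⟨⟨hp'.after_eq, hp'.path⟩, ?_⟩
        refine Eq.trans (b := alloc I s'') rfl ?_
        rw [ha', ha]
        funext g
        by_cases hgk : g = ⟨k, hk⟩
        · subst hgk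
          simp [AllocInstance.clear, hw, RExp.eval]
        · have : g.val < k + 1 ↔ g.val < k := by
            have : g.val ≠ k := fun h => hgk (Fin.ext h)
            omega
          simp [hgk, this]
      · rw [htest] at hw
        refine Eq.trans (b := alloc I s') rfl ?_
        rw [ha]
        funext g
        by_cases hgk : g = ⟨k, hk⟩
        · subst hgk
          simp [AllocInstance.clear, hw]
        · have : g.val < k + 1 ↔ g.val < k := by
            have : g.val ≠ k := fun h => hgk (Fin.ext h)
            omega
          simp [this]
    · rintro s' - ⟨hp, ha⟩
      exact ⟨hp, by simpa using ha⟩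
  refine Runs.seq_of loop fun s₁ ⟨hp₁, ha₁⟩ hf₁ => ?_
  have hs₁ := hs.frame hf₁ rfl
  refine Runs.seq_of (loads_spec hs₁) fun s₂ ⟨hJ, hM⟩ hf₂ => ?_
  have hs₂ := hs₁.frame hf₂ rfl
  have h11₂ : s₂.nat 11 0 = e + 1 := by rw [hf₂.nat 11 rfl, hf₁.nat 11 rfl, h11]
  have hp₂ := hp₁.frame hf₂ rfl rfl
  have ha₂ : alloc I s₂ = I.clear (alloc I s) e := (alloc_frame hf₂ rfl).trans ha₁
  have hax : ∀ g : Fin I.nE, s₂.real 3 g = I.clear (alloc I s) e g := fun g => congrFun ha₂ g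
  rw [ha₁] at hJ hM
  refine Runs.seq_of (Runs.setReal (Q := fun s' => s'.real 6 0 = I.cap e - I.clear (alloc I s) e e)
    ?_) fun s₃ h₃ hf₃ => ?_
  · simp [RExp.eval, NExp.eval, h11₂, write_eq, hs₂.cap, hax]
  have hs₃ := hs₂.frame hf₃ rfl
  have h11₃ : s₃.nat 11 0 = e + 1 := by rw [hf₃.nat 11 rfl, h11₂]
  have hp₃ := hp₂.frame hf₃ rfl rfl
  have ha₃ := (alloc_frame hf₃ rfl).trans ha₂
  refine Runs.seq_of setMin_spec fun s₄ h₄ hf₄ => ?_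
  simp only [RExp.eval, NExp.eval, h11₃, Nat.add_sub_cancel, hs₃.job, hs₃.quotaJ,
    hf₃.real 4 rfl, hJ, h₃] at h₄
  have hs₄ := hs₃.frame hf₄ rfl
  have h11₄ : s₄.nat 11 0 = e + 1 := by rw [hf₄.nat 11 rfl, h11₃]
  have hp₄ := hp₃.frame hf₄ rfl rfl
  have ha₄ := (alloc_frame hf₄ rfl).trans ha₃
  refine Runs.seq_of setMin_spec fun s₅ h₅ hf₅ => ?_
  simp only [RExp.eval, NExp.eval, h11₄, Nat.add_sub_cancel, hs₄.mach, hs₄.quotaM,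
    hf₄.real 5 rfl, hf₃.real 5 rfl, hM, h₄] at h₅
  have h11₅ : s₅.nat 11 0 = e + 1 := by rw [hf₅.nat 11 rfl, h11₄]
  have hp₅ := hp₄.frame hf₅ rfl rfl
  have ha₅ := (alloc_frame hf₅ rfl).trans ha₄
  obtain ⟨hbr, hphi⟩ := AllocInstance.envy_step hx he hb hf h₅
  have hev : (rcell 6).eval s₅ = s₅.real 6 0 := rfl
  refine (raiseProg_spec (e := e) hp₅ (by simp [NExp.eval, h11₅])
    (by rw [ha₅, hev]; exact hbr)).mono fun s₆ ⟨hg₆, ha₆⟩ _ => ⟨hg₆, ?_⟩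
  rw [ha₆, ha₅, hev]
  exact ⟨hbr.2.1, hphi⟩

/-! ## A round of proposals and refusals -/

/-- The edge proposed by the job in variable `a`. -/
abbrev propOf (a : ℕ) : NExp := .pred (.get 6 (cell a))
/-- The edge refused when the job in variable `a` proposes. -/
abbrev refusalOf (a : ℕ) : NExp := .pred (.get 7 (cell a))

/-- Walk from the job in variable 9 to the job in variable 10, and compute the minimum of the content
of the real variable 6 and of what fits into the edges on the way. -/
def minWalk : Prog :=
  .loop (.not (.natEq (cell 9) (cell 10))) <|
    .seq (setMin 6 (.sub (.get 0 (propOf 9)) (.get 3 (propOf 9)))) <|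
    .seq (setMin 6 (.get 3 (refusalOf 9))) <|
    .setNat 9 (.const 0) (.get 1 (refusalOf 9))

/-- Walk from the job in variable 9 to the job in variable 10, and push the content of the real
variable 6 along the edges on the way. -/
def pushWalk : Prog :=
  .loop (.not (.natEq (cell 9) (cell 10))) <|
    .seq (shiftProg (propOf 9) (refusalOf 9) (rcell 6)) <|
    .setNat 9 (.const 0) (.get 1 (refusalOf 9))

variable {P F : Fin I.nJ → Option (Fin I.nE)} {r : ℕ → Fin I.nJ} {K : ℕ}

theorem Ctx.propOf_eval {s : State} (hc : Ctx I P F s) {a : ℕ} {j : Fin I.nJ} {e : Fin I.nE}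
    (ha : s.nat a 0 = j) (he : P j = some e) : (propOf a).eval s = e := by
  simp [NExp.eval, ha, hc.prop, he]

theorem Ctx.refusalOf_eval {s : State} (hc : Ctx I P F s) {a : ℕ} {j : Fin I.nJ} {f : Fin I.nE}
    (ha : s.nat a 0 = j) (hf : F j = some f) : (refusalOf a).eval s = f := by
  simp [NExp.eval, ha, hc.refusal, hf]

theorem minWalk_spec {s : State} (hc : Ctx I P F s) (hr : I.Route P F r K) (hK : K ≤ I.nJ)
    (h9 : s.nat 9 0 = r 0) (h10 : s.nat 10 0 = r K) :
    Runs I.size minWalk s fun s' => I.MinFit P F r K (alloc I s) (s.real 6 0) (s'.real 6 0) := by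
  refine Runs.loop K (by simp [AllocInstance.size]; omega) (fun i s' => s'.nat 9 0 = r i ∧
    I.MinFit P F r i (alloc I s) (s.real 6 0) (s'.real 6 0)) ⟨h9, .zero _ _⟩ ?_ ?_
  · rintro i hi s' hf ⟨h9', hm⟩
    have hc' := hc.frame hf rfl rfl rfl
    have h10' : s'.nat 10 0 = r K := by rw [hf.nat 10 rfl, h10]
    have ha' : alloc I s' = alloc I s := alloc_frame hf rfl
    obtain ⟨e, f, hP, hF, hj⟩ := hr.step i hi
    refine ⟨?_, ?_⟩
    · simp only [Test.Holds, NExp.eval, h9', h10', Fin.val_inj]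
      intro h
      have := hr.inj i hi.le K le_rfl h
      omega
    · refine Runs.seq_of setMin_spec fun s₁ h₁ hf₁ => ?_
      have hc₁ := hc'.frame hf₁ rfl rfl rfl
      have h9₁ : s₁.nat 9 0 = r i := by rw [hf₁.nat 9 rfl, h9']
      refine Runs.seq_of setMin_spec fun s₂ h₂ hf₂ => ?_
      have hc₂ := hc₁.frame hf₂ rfl rfl rfl
      have h9₂ : s₂.nat 9 0 = r i := by rw [hf₂.nat 9 rfl, h9₁]
      have x1 : s'.real 3 e = alloc I s e := congrFun ha' e
      have x2 : s₁.real 3 f = alloc I s f := by rw [hf₁.real 3 rfl]; exact congrFun ha' f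
      refine Runs.setNat ⟨?_, ?_⟩
      · have := hc₂.refusalOf_eval h9₂ hF
        simp only [NExp.eval] at this
        simp [NExp.eval, write_eq, this, hc₂.inp.job, hj]
      · refine (hm.succ hP hF).congr_amount ?_
        simp only [h₂, h₁, RExp.eval, hc'.propOf_eval h9' hP, hc₁.refusalOf_eval h9₁ hF, x1, x2,
          hc'.inp.cap]
  · rintro s' hf ⟨h9', hm⟩
    have h10' : s'.nat 10 0 = r K := by rw [hf.nat 10 rfl, h10]
    exact ⟨by simp [Test.Holds, NExp.eval, h9', h10'], hm⟩

theorem pushWalk_spec {x x₀ : Fin I.nE → ℝ} {s : State} (hc : Ctx I P F s)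
    (hp : I.Pointers x P F) (hr : I.Route P F r K) (hK : K ≤ I.nJ)
    (h9 : s.nat 9 0 = r 0) (h10 : s.nat 10 0 = r K) (hg : Good I x₀ s)
    (hfeas : I.Feasible (alloc I s)) (hfit : I.Fits P F r K (alloc I s) (s.real 6 0))
    (ha : 0 < s.real 6 0) (hq : I.loadJ (alloc I s) (r 0) + s.real 6 0 ≤ I.quotaJ (r 0)) :
    Runs I.size pushWalk s fun s' => Good I x₀ s' ∧
      I.Pushed P F r K (alloc I s) (s.real 6 0) K (alloc I s') := by
  refine Runs.loop K (by simp [AllocInstance.size]; omega) (fun i s' => s'.nat 9 0 = r i ∧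
    Good I x₀ s' ∧ I.Pushed P F r K (alloc I s) (s.real 6 0) i (alloc I s'))
    ⟨h9, hg, .zero hfeas⟩ ?_ ?_
  · rintro i hi s' hf ⟨h9', hg', hpu⟩
    have hc' := hc.frame hf rfl rfl rfl
    have h10' : s'.nat 10 0 = r K := by rw [hf.nat 10 rfl, h10]
    have h6' : s'.real 6 0 = s.real 6 0 := by rw [hf.real 6 rfl]
    obtain ⟨e, f, hP, hF, hj⟩ := hr.step i hi
    refine ⟨?_, ?_⟩
    · simp only [Test.Holds, NExp.eval, h9', h10', Fin.val_inj]
      intro h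
      have := hr.inj i hi.le K le_rfl h
      omega
    · obtain ⟨hbr, hpu'⟩ := hpu.step hp hr hfit ha hq hfeas hi hP hF
      have hev : (rcell 6).eval s' = s.real 6 0 := h6'
      refine Runs.seq_of (shiftProg_spec hg' (hc'.propOf_eval h9' hP) (hc'.refusalOf_eval h9' hF)
        (hp.ne hP hF) (by rw [hev, h6']; exact hbr)) fun s₁ ⟨hg₁, ha₁⟩ hf₁ => ?_
      rw [hev, h6'] at ha₁
      have hc₁ := hc'.frame hf₁ rfl rfl rfl
      have h9₁ : s₁.nat 9 0 = r i := by rw [hf₁.nat 9 rfl, h9']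
      refine Runs.setNat ⟨?_, ⟨hg₁.after_eq, hg₁.path⟩, ?_⟩
      · have := hc₁.refusalOf_eval h9₁ hF
        simp only [NExp.eval] at this
        simp [NExp.eval, write_eq, this, hc₁.inp.job, hj]
      · refine Eq.subst (motive := fun z => I.Pushed P F r K (alloc I s) (s.real 6 0) (i + 1) z)
          ?_ hpu'
        exact ha₁.symm
  · rintro s' hf ⟨h9', hg', hpu⟩
    have h10' : s'.nat 10 0 = r K := by rw [hf.nat 10 rfl, h10]
    exact ⟨by simp [Test.Holds, NExp.eval, h9', h10'], hg', hpu⟩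

/-- Follow the refusals from the active job for many rounds. -/
def findEnd : Prog :=
  .seq (.setNat 10 (.const 0) (.pred (cell 12))) <|
  forTo numJ <| .ite (.natEq (.get 7 (cell 10)) (.const 0)) .skip
    (.setNat 10 (.const 0) (.get 1 (refusalOf 10)))

theorem findEnd_spec {s : State} (hc : Ctx I P F s) {j : Fin I.nJ} (h12 : s.nat 12 0 = j + 1) :
    Runs I.size findEnd s fun s' => s'.nat 10 0 = (I.next F)^[I.nJ] j := by
  refine Runs.seq_of (Runs.setNat (Q := fun s' => s'.nat 10 0 = j)
    (by simp [NExp.eval, write_eq, h12])) fun s₁ h₁ hf₁ => ?_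
  have hc₁ := hc.frame hf₁ rfl rfl rfl
  refine Runs.forTo I.nJ (by simp [AllocInstance.size]; omega)
    (fun k s' => s'.nat 10 0 = (I.next F)^[k] j) rfl (fun s' hf => (hc₁.frame hf rfl rfl rfl).inp.nJ)
    (by simp [write_eq, h₁]) ?_ (fun s' _ h => h)
  intro k hk s' hf h8 h10
  have hc' := hc₁.frame hf rfl rfl rfl
  refine Runs.ite (fun hb => Runs.skip ?_) fun hb => Runs.setNat ?_
  · simp only [Test.Holds, NExp.eval, h10, hc'.refusal, enc_eq_zero] at hb
    rw [Function.iterate_succ_apply', AllocInstance.next_of_none hb]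
    simpa [write_eq] using h10
  · simp only [Test.Holds, NExp.eval, h10, hc'.refusal, enc_eq_zero] at hb
    obtain ⟨f, hf⟩ := Option.ne_none_iff_exists'.1 hb
    rw [Function.iterate_succ_apply', AllocInstance.next_of_some hf]
    have := hc'.refusalOf_eval h10 hf
    simp only [NExp.eval] at this
    simp [NExp.eval, write_eq, this, hc'.inp.job]

/-- By the pigeonhole principle two of the first `nJ + 1` iterates agree, so after `nJ` moves the
walk is on a cycle, or at a fixed point where nobody is refused. -/
theorem AllocInstance.exists_iterate_next (F : Fin I.nJ → Option (Fin I.nE)) (j : Fin I.nJ) :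
    ∃ n, (I.next F)^[n] (I.next F ((I.next F)^[I.nJ] j)) = (I.next F)^[I.nJ] j := by
  obtain ⟨l, l', hne, heq⟩ := Fintype.exists_ne_map_eq_of_card_lt
    (fun l : Fin (I.nJ + 1) => (I.next F)^[(l : ℕ)] j) (by simp)
  wlog hlt : l < l' generalizing l l'
  · exact this l' l hne.symm heq.symm (lt_of_le_of_ne (not_lt.1 hlt) hne.symm)
  have hlt' : (l : ℕ) < l' := hlt
  -- The walk has period `l' - l` from position `l` on; one application of `next` is already spent.
  refine ⟨l' - l - 1, ?_⟩
  rw [← Function.iterate_succ_apply, ← Function.iterate_add_apply,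
    show (l' - l - 1 : ℕ).succ + I.nJ = (I.nJ - l) + l' by omega, Function.iterate_add_apply]
  rw [← heq, ← Function.iterate_add_apply, Nat.sub_add_cancel (by omega)]

/-- Go around the cycle of refusals through the job in variable 10. -/
def rotate : Prog :=
  .seq (.setReal 7 (.const 0) (rcell 6)) <|
  .seq (.setReal 6 (.const 0) (.sub (.get 0 (propOf 10)) (.get 3 (propOf 10)))) <|
  .seq (setMin 6 (.get 3 (refusalOf 10))) <|
  .seq (.setNat 9 (.const 0) (.get 1 (refusalOf 10))) <|
  .seq minWalk <|
  .ite (.realLt .zero (rcell 6))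
    (.seq (setMin 7 (rcell 6)) <|
    .seq (shiftProg (propOf 10) (refusalOf 10) (rcell 7)) <|
    .seq (.setNat 9 (.const 0) (.get 1 (refusalOf 10))) <|
    .seq pushWalk <|
    .ite (.realLt (rcell 7) (rcell 6))
      (raiseProg (propOf 10) (.sub (rcell 6) (rcell 7))) .skip) .skip

/-- A round of proposals and refusals that starts at an active job. -/
def proposeStep : Prog :=
  .seq findEnd <|
  .seq (.setReal 6 (.const 0) (.sub (.get 1 (.pred (cell 12))) (.get 4 (.pred (cell 12))))) <|
  .seq (.ite (.and (.natEq (.get 7 (cell 10)) (.const 0)) (.not (.natEq (.get 6 (cell 10)) (.const 0))))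
    (.seq (setMin 6 (.sub (.get 0 (propOf 10)) (.get 3 (propOf 10))))
      (setMin 6 (.sub (.get 2 (.get 2 (propOf 10))) (.get 5 (.get 2 (propOf 10)))))) .skip) <|
  .seq (.setNat 9 (.const 0) (.pred (cell 12))) <|
  .seq minWalk <|
  .seq (.setNat 9 (.const 0) (.pred (cell 12))) <|
  .seq pushWalk <|
  .ite (.natEq (.get 7 (cell 10)) (.const 0))
    (.ite (.natEq (.get 6 (cell 10)) (.const 0)) .skip (raiseProg (propOf 10) (rcell 6)))
    rotate

theorem rotate_spec {x x₀ : Fin I.nE → ℝ} {s : State} (hc : Ctx I P F s)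
    (hp : I.Pointers x P F) (hr : I.Route P F r K) (hK : K ≤ I.nJ) {T : Fin I.nJ} {e f : Fin I.nE}
    (hP : P T = some e) (hF : F T = some f) (h0 : r 0 = I.job f) (hT : r K = T)
    (h10 : s.nat 10 0 = T) (hg : Good I x₀ s) (hfeas : I.Feasible (alloc I s))
    (ha : 0 < s.real 6 0) (hq : I.loadJ (alloc I s) T + s.real 6 0 ≤ I.quotaJ T) :
    Runs I.size rotate s fun s' => Good I x₀ s' ∧ I.Feasible (alloc I s') ∧
      I.Shape P F (alloc I s) (alloc I s') ∧
      (∀ j, I.loadJ (alloc I s') j = I.loadJ (alloc I s) j) ∧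
      (∀ m, I.loadM (alloc I s') m = I.loadM (alloc I s) m) ∧ I.Tight P F (alloc I s') := by
  set b := alloc I s with hb
  have fetch : ∀ s', Ctx I P F s' → s'.nat 10 0 = T → Runs I.size
      (.setNat 9 (.const 0) (.get 1 (refusalOf 10))) s' fun s'' => s''.nat 9 0 = r 0 := by
    intro s' hc' h10'
    refine Runs.setNat ?_
    have := hc'.refusalOf_eval h10' hF
    simp only [NExp.eval] at this
    simp [NExp.eval, write_eq, this, hc'.inp.job, h0]
  refine Runs.seq_of (Runs.setReal (Q := fun s' => s'.real 7 0 = s.real 6 0)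
    (by simp [NExp.eval, RExp.eval, write_eq])) fun s₁ h₁ hf₁ => ?_
  have hc₁ := hc.frame hf₁ rfl rfl rfl
  have hg₁ := hg.frame hf₁ rfl rfl
  have ha₁ : alloc I s₁ = b := alloc_frame hf₁ rfl
  have h10₁ : s₁.nat 10 0 = T := by rw [hf₁.nat 10 rfl, h10]
  refine Runs.seq_of (Runs.setReal (Q := fun s' => s'.real 6 0 = I.cap e - b e) ?_)
    fun s₂ h₂ hf₂ => ?_
  · have x1 : s₁.real 3 e = b e := congrFun ha₁ e
    simp only [RExp.eval, hc₁.propOf_eval h10₁ hP, hc₁.inp.cap, x1]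
    simp [NExp.eval, write_eq]
  have hc₂ := hc₁.frame hf₂ rfl rfl rfl
  have hg₂ := hg₁.frame hf₂ rfl rfl
  have ha₂ : alloc I s₂ = b := (alloc_frame hf₂ rfl).trans ha₁
  have h10₂ : s₂.nat 10 0 = T := by rw [hf₂.nat 10 rfl, h10₁]
  have h7₂ : s₂.real 7 0 = s.real 6 0 := by rw [hf₂.real 7 rfl, h₁]
  refine Runs.seq_of setMin_spec fun s₃ h₃ hf₃ => ?_
  have x1 : s₂.real 3 f = b f := congrFun ha₂ f
  simp only [RExp.eval, hc₂.refusalOf_eval h10₂ hF, x1, h₂] at h₃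
  have hc₃ := hc₂.frame hf₃ rfl rfl rfl
  have hg₃ := hg₂.frame hf₃ rfl rfl
  have ha₃ : alloc I s₃ = b := (alloc_frame hf₃ rfl).trans ha₂
  have h10₃ : s₃.nat 10 0 = T := by rw [hf₃.nat 10 rfl, h10₂]
  have h7₃ : s₃.real 7 0 = s.real 6 0 := by rw [hf₃.real 7 rfl, h7₂]
  refine Runs.seq_of (fetch s₃ hc₃ h10₃) fun s₄ h₄ hf₄ => ?_
  have hc₄ := hc₃.frame hf₄ rfl rfl rfl
  have hg₄ := hg₃.frame hf₄ rfl rfl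
  have ha₄ : alloc I s₄ = b := (alloc_frame hf₄ rfl).trans ha₃
  have h10₄ : s₄.nat 10 0 = T := by rw [hf₄.nat 10 rfl, h10₃]
  have h7₄ : s₄.real 7 0 = s.real 6 0 := by rw [hf₄.real 7 rfl, h7₃]
  have h6₄ : s₄.real 6 0 = min (I.cap e - b e) (b f) := by rw [hf₄.real 6 rfl, h₃]
  refine Runs.seq_of (minWalk_spec hc₄ hr hK h₄ (hT ▸ h10₄)) fun s₅ h₅ hf₅ => ?_
  have hc₅ := hc₄.frame hf₅ rfl rfl rfl
  have hg₅ := hg₄.frame hf₅ rfl rfl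
  have ha₅ : alloc I s₅ = b := (alloc_frame hf₅ rfl).trans ha₄
  have h10₅ : s₅.nat 10 0 = T := by rw [hf₅.nat 10 rfl, h10₄]
  have h7₅ : s₅.real 7 0 = s.real 6 0 := by rw [hf₅.real 7 rfl, h7₄]
  rw [ha₄, h6₄] at h₅
  -- The route to `T` may share edges with the cycle, so the preceding push may have exhausted one
  -- of them. Then nothing fits around the cycle and the event has already happened.
  refine Runs.ite (fun hpos => ?_) fun hpos => Runs.skip ⟨hg₅, ?_⟩
  · replace hpos : 0 < s₅.real 6 0 := hpos
    refine Runs.seq_of setMin_spec fun s₆ h₆ hf₆ => ?_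
    have hc₆ := hc₅.frame hf₆ rfl rfl rfl
    have hg₆ := hg₅.frame hf₆ rfl rfl
    have ha₆ : alloc I s₆ = b := (alloc_frame hf₆ rfl).trans ha₅
    have h10₆ : s₆.nat 10 0 = T := by rw [hf₆.nat 10 rfl, h10₅]
    have h6₆ : s₆.real 6 0 = s₅.real 6 0 := by rw [hf₆.real 6 rfl]
    replace h₆ : s₆.real 7 0 = min (s.real 6 0) (s₅.real 6 0) := by rw [h₆, h7₅]; rfl
    have hle : s₆.real 7 0 ≤ s.real 6 0 := h₆ ▸ min_le_left _ _
    -- The opening amount is the minimum of the amount pushed to `T`, for which `T` has room, and of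
    -- the amount for the cycle.
    have hR : I.Rotation P F r K b T e f (s₆.real 7 0) (s₆.real 6 0) := by
      refine ⟨hfeas, hr, h0, hT, hP, hF, ?_, ?_, by linarith, h6₆ ▸ h₅⟩
      · rw [h₆]; exact lt_min ha hpos
      · rw [h₆, h6₆]; exact min_le_right _ _
    obtain ⟨hbr, hfit, hq'⟩ := hR.first hp
    have hev : (rcell 7).eval s₆ = s₆.real 7 0 := rfl
    refine Runs.seq_of (shiftProg_spec hg₆ (hc₆.propOf_eval h10₆ hP) (hc₆.refusalOf_eval h10₆ hF)
      (hp.ne hP hF) (by rw [ha₆, hev]; exact hbr)) fun s₇ ⟨hg₇, ha₇⟩ hf₇ => ?_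
    rw [ha₆, hev] at ha₇
    have hc₇ := hc₆.frame hf₇ rfl rfl rfl
    have h10₇ : s₇.nat 10 0 = T := by rw [hf₇.nat 10 rfl, h10₆]
    refine Runs.seq_of (fetch s₇ hc₇ h10₇) fun s₈ h₈ hf₈ => ?_
    have hc₈ := hc₇.frame hf₈ rfl rfl rfl
    have hg₈ := hg₇.frame hf₈ rfl rfl
    have ha₈ := (alloc_frame hf₈ rfl).trans ha₇
    have h10₈ : s₈.nat 10 0 = T := by rw [hf₈.nat 10 rfl, h10₇]
    have h6₈ : s₈.real 6 0 = s₆.real 6 0 := by rw [hf₈.real 6 rfl, hf₇.real 6 rfl]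
    have h7₈ : s₈.real 7 0 = s₆.real 7 0 := by rw [hf₈.real 7 rfl, hf₇.real 7 rfl]
    refine Runs.seq_of (pushWalk_spec hc₈ hp hr hK h₈ (hT ▸ h10₈) hg₈ (by rw [ha₈]; exact hbr.2.1)
      (by rw [ha₈, h6₈]; exact hfit) (by rw [h6₈, h6₆]; exact hpos)
      (by rw [ha₈, h6₈]; exact hq')) fun s₉ ⟨hg₉, hpu⟩ hf₉ => ?_
    rw [ha₈, h6₈] at hpu
    have hc₉ := hc₈.frame hf₉ rfl rfl rfl
    have h10₉ : s₉.nat 10 0 = T := by rw [hf₉.nat 10 rfl, h10₈]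
    have h6₉ : s₉.real 6 0 = s₆.real 6 0 := by rw [hf₉.real 6 rfl, h6₈]
    have h7₉ : s₉.real 7 0 = s₆.real 7 0 := by rw [hf₉.real 7 rfl, h7₈]
    have hfin := hR.final hp hpu
    refine Runs.ite (fun hlt => ?_) fun hlt => Runs.skip ⟨hg₉, hpu.feasible, ?_⟩
    · replace hlt : s₆.real 7 0 < s₆.real 6 0 := by rw [← h6₉, ← h7₉]; exact hlt
      have hbr' := hR.last hp hpu hlt
      have hev' : (RExp.sub (rcell 6) (rcell 7)).eval s₉ = s₆.real 6 0 - s₆.real 7 0 := by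
        rw [← h6₉, ← h7₉]; rfl
      refine (raiseProg_spec hg₉ (hc₉.propOf_eval h10₉ hP) (by rw [hev']; exact hbr')).mono
        fun s' ⟨hg', ha'⟩ _ => ⟨hg', ?_⟩
      rw [ha', hev']
      exact ⟨hbr'.2.1, hfin⟩
    · replace hlt : ¬ s₆.real 7 0 < s₆.real 6 0 := by rw [← h6₉, ← h7₉]; exact hlt
      have heq : s₆.real 6 0 - s₆.real 7 0 = 0 := sub_eq_zero.2 (le_antisymm (not_lt.1 hlt) hR.le)
      simpa [heq, AllocInstance.raise] using hfin
  · replace hpos : s₅.real 6 0 ≤ 0 := not_lt.1 hpos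
    rw [ha₅]
    refine ⟨hfeas, ⟨fun g hg => absurd hg (lt_irrefl _), fun g hg => absurd hg (lt_irrefl _)⟩,
      fun _ => rfl, fun _ => rfl, h₅.tight_of_nonpos hpos ?_⟩
    rintro hm
    rcases min_choice (I.cap e - b e) (b f) with h2 | h2
    · exact Or.inl ⟨T, e, hP, by linarith⟩
    · exact Or.inr ⟨T, f, hF, by linarith⟩

theorem proposeStep_spec {x₀ : Fin I.nE → ℝ} {s : State} (hc : Ctx I P F s)
    (hl : Loaded I (alloc I s) s) (hp : I.Pointers (alloc I s) P F) (hg : Good I x₀ s)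
    (hx : I.Feasible (alloc I s)) {j : Fin I.nJ} (h12 : s.nat 12 0 = j + 1)
    (hact : I.Active (alloc I s) j) :
    Runs I.size proposeStep s fun s' => Good I x₀ s' ∧ I.Feasible (alloc I s') ∧
      I.Moves P F (alloc I s) (alloc I s') ∧ I.psi (alloc I s') < I.psi (alloc I s) := by
  set x := alloc I s with hxdef
  refine Runs.seq_of (findEnd_spec hc h12) fun s₁ h10₁ hf₁ => ?_
  set T := (I.next F)^[I.nJ] j with hTdef
  have hc₁ := hc.frame hf₁ rfl rfl rfl
  have hl₁ := hl.frame hf₁ rfl rfl rfl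
  have hg₁ := hg.frame hf₁ rfl rfl
  have ha₁ : alloc I s₁ = x := alloc_frame hf₁ rfl
  have h12₁ : s₁.nat 12 0 = j + 1 := by rw [hf₁.nat 12 rfl, h12]
  obtain ⟨K, hK, hKT, -, hr⟩ := hp.exists_route j T I.nJ hTdef.symm
  set r : ℕ → Fin I.nJ := fun l => (I.next F)^[l] j with hrdef
  have hr0 : r 0 = j := rfl
  replace hKT : r K = T := hKT
  refine Runs.seq_of (Runs.setReal (Q := fun s' => s'.real 6 0 = I.quotaJ j - I.loadJ x j)
    (by simp [NExp.eval, RExp.eval, write_eq, h12₁, hc₁.inp.quotaJ, hl₁.loadJ])) fun s₂ h₂ hf₂ => ?_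
  have hc₂ := hc₁.frame hf₂ rfl rfl rfl
  have hl₂ := hl₁.frame hf₂ rfl rfl rfl
  have hg₂ := hg₁.frame hf₂ rfl rfl
  have ha₂ : alloc I s₂ = x := (alloc_frame hf₂ rfl).trans ha₁
  have h12₂ : s₂.nat 12 0 = j + 1 := by rw [hf₂.nat 12 rfl, h12₁]
  have h10₂ : s₂.nat 10 0 = T := by rw [hf₂.nat 10 rfl, h10₁]
  have hpos₀ : 0 < I.quotaJ j - I.loadJ x j := sub_pos.2 hact.1
  refine Runs.seq_of (R := fun s' => 0 < s'.real 6 0 ∧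
      s'.real 6 0 ≤ I.quotaJ j - I.loadJ x j ∧
      (∀ e, F T = none → P T = some e → s'.real 6 0 = min (min (I.quotaJ j - I.loadJ x j)
        (I.cap e - x e)) (I.quotaM (I.mach e) - I.loadM x (I.mach e))) ∧
      (F T ≠ none ∨ P T = none → s'.real 6 0 = I.quotaJ j - I.loadJ x j))
    (Runs.ite (fun hb => ?_) fun hb => Runs.skip ?_) fun s₃ ⟨hpos₃, hle₃, hfree₃, hend₃⟩ hf₃ => ?_
  · simp only [Test.Holds, NExp.eval, h10₂, hc₂.refusal, hc₂.prop, enc_eq_zero] at hb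
    obtain ⟨hF, hP⟩ := hb
    obtain ⟨e, hP⟩ := Option.ne_none_iff_exists'.1 hP
    refine Runs.seq_of setMin_spec fun s₃ h₃ hf₃ => ?_
    have hc₃ := hc₂.frame hf₃ rfl rfl rfl
    have hl₃ := hl₂.frame hf₃ rfl rfl rfl
    have h10₃ : s₃.nat 10 0 = T := by rw [hf₃.nat 10 rfl, h10₂]
    simp only [RExp.eval, hc₂.propOf_eval h10₂ hP, hc₂.inp.cap, hl₂.alloc, h₂] at h₃
    refine setMin_spec.mono fun s₄ h₄ hf₄ => ?_
    have hm : (NExp.get 2 (propOf 10)).eval s₃ = I.mach e :=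
      (congrArg _ (hc₃.propOf_eval h10₃ hP)).trans (hc₃.inp.mach e)
    simp only [RExp.eval, hm, hc₃.inp.quotaM, hl₃.loadM, h₃] at h₄
    refine ⟨?_, ?_, fun e' _ he' => ?_, fun h => ?_⟩
    · rw [h₄]
      exact lt_min (lt_min hpos₀ (sub_pos.2 (hp.cand hP).1)) (sub_pos.2 (hp.free hF hP))
    · rw [h₄]; exact (min_le_left _ _).trans (min_le_left _ _)
    · obtain rfl : e = e' := by simpa [hP] using he'
      exact h₄
    · simp [hF, hP] at h
  · simp only [Test.Holds, NExp.eval, h10₂, hc₂.refusal, hc₂.prop, enc_eq_zero] at hb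
    rw [h₂]
    exact ⟨hpos₀, le_rfl, fun e hF hP => absurd ⟨hF, by simp [hP]⟩ hb, fun _ => rfl⟩
  have hc₃ := hc₂.frame hf₃ rfl rfl rfl
  have hg₃ := hg₂.frame hf₃ rfl rfl
  have ha₃ : alloc I s₃ = x := (alloc_frame hf₃ rfl).trans ha₂
  have h12₃ : s₃.nat 12 0 = j + 1 := by rw [hf₃.nat 12 rfl, h12₂]
  have h10₃ : s₃.nat 10 0 = T := by rw [hf₃.nat 10 rfl, h10₂]
  refine Runs.seq_of (Runs.setNat (Q := fun s' => s'.nat 9 0 = r 0)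
    (by simp [NExp.eval, write_eq, h12₃, hr0])) fun s₄ h₄ hf₄ => ?_
  have hc₄ := hc₃.frame hf₄ rfl rfl rfl
  have hg₄ := hg₃.frame hf₄ rfl rfl
  have ha₄ : alloc I s₄ = x := (alloc_frame hf₄ rfl).trans ha₃
  have h12₄ : s₄.nat 12 0 = j + 1 := by rw [hf₄.nat 12 rfl, h12₃]
  have h10₄ : s₄.nat 10 0 = T := by rw [hf₄.nat 10 rfl, h10₃]
  have h6₄ : s₄.real 6 0 = s₃.real 6 0 := by rw [hf₄.real 6 rfl]
  refine Runs.seq_of (minWalk_spec hc₄ hr hK h₄ (hKT ▸ h10₄)) fun s₅ h₅ hf₅ => ?_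
  rw [ha₄, h6₄] at h₅
  have hc₅ := hc₄.frame hf₅ rfl rfl rfl
  have hg₅ := hg₄.frame hf₅ rfl rfl
  have ha₅ : alloc I s₅ = x := (alloc_frame hf₅ rfl).trans ha₄
  have h12₅ : s₅.nat 12 0 = j + 1 := by rw [hf₅.nat 12 rfl, h12₄]
  have h10₅ : s₅.nat 10 0 = T := by rw [hf₅.nat 10 rfl, h10₄]
  have hpos₅ := h₅.pos hp hpos₃
  refine Runs.seq_of (Runs.setNat (Q := fun s' => s'.nat 9 0 = r 0)
    (by simp [NExp.eval, write_eq, h12₅, hr0])) fun s₆ h₆ hf₆ => ?_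
  have hc₆ := hc₅.frame hf₆ rfl rfl rfl
  have hg₆ := hg₅.frame hf₆ rfl rfl
  have ha₆ : alloc I s₆ = x := (alloc_frame hf₆ rfl).trans ha₅
  have h10₆ : s₆.nat 10 0 = T := by rw [hf₆.nat 10 rfl, h10₅]
  have h6₆ : s₆.real 6 0 = s₅.real 6 0 := by rw [hf₆.real 6 rfl]
  refine Runs.seq_of (pushWalk_spec hc₆ hp hr hK h₆ (hKT ▸ h10₆) hg₆ (by rw [ha₆]; exact hx)
    (by rw [ha₆, h6₆]; exact h₅.fits) (by rw [h6₆]; exact hpos₅)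
    (by rw [ha₆, h6₆, hr0]; linarith [h₅.le])) fun s₇ ⟨hg₇, hpu⟩ hf₇ => ?_
  rw [ha₆, h6₆] at hpu
  have hc₇ := hc₆.frame hf₇ rfl rfl rfl
  have h10₇ : s₇.nat 10 0 = T := by rw [hf₇.nat 10 rfl, h10₆]
  have h6₇ : s₇.real 6 0 = s₅.real 6 0 := by rw [hf₇.real 6 rfl, h6₆]
  refine Runs.ite (fun hF => Runs.ite (fun hP => Runs.skip ⟨hg₇, hpu.feasible, ?_⟩) fun hP => ?_)
    fun hF => ?_
  · simp only [Test.Holds, NExp.eval, h10₇, hc₇.prop, enc_eq_zero] at hP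
    rw [hend₃ (Or.inr hP)] at h₅
    exact hpu.psi_lt_of_none hp hx hpos₅.le h₅ hact (hKT ▸ hP)
  · simp only [Test.Holds, NExp.eval, h10₇, hc₇.refusal, hc₇.prop, enc_eq_zero] at hF hP
    obtain ⟨e, hP⟩ := Option.ne_none_iff_exists'.1 hP
    obtain ⟨hbr, hmv, hpsi⟩ := hpu.raise_of_free hp hr hx hpos₅ h₅ hact (hKT ▸ hP) (hKT ▸ hF)
      (hfree₃ e hF hP)
    have hev : (rcell 6).eval s₇ = s₅.real 6 0 := h6₇
    refine (raiseProg_spec hg₇ (hc₇.propOf_eval h10₇ hP) (by rw [hev]; exact hbr)).mono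
      fun s' ⟨hg', ha'⟩ _ => ⟨hg', ?_⟩
    rw [ha', hev]
    exact ⟨hbr.2.1, hmv, hpsi⟩
  · simp only [Test.Holds, NExp.eval, h10₇, hc₇.refusal, enc_eq_zero] at hF
    obtain ⟨f, hF⟩ := Option.ne_none_iff_exists'.1 hF
    obtain ⟨e, hP, -⟩ := hp.exists_of_some hF
    obtain ⟨n, hn⟩ := AllocInstance.exists_iterate_next F j
    obtain ⟨K', hK', hKT', -, hr'⟩ := hp.exists_route (I.next F T) T n hn
    -- Job `T` has just lost this amount, unless it is itself the start of the walk and has room by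
    -- the choice of the amount.
    have hq : I.loadJ (alloc I s₇) T + s₇.real 6 0 ≤ I.quotaJ T := by
      rw [hpu.loadJ_eq, h6₇, if_pos hKT.symm]
      by_cases h0 : T = r 0
      · rw [if_pos h0, h0, hr0]; linarith [h₅.le]
      · rw [if_neg h0]; linarith [hx.2.1 T]
    refine (rotate_spec hc₇ hp hr' hK' hP hF (AllocInstance.next_of_some hF) hKT' h10₇ hg₇
      hpu.feasible (by rw [h6₇]; exact hpos₅) hq).mono fun s' ⟨hg', hx', hsh, hJ, hM, ht⟩ _ => ?_
    have hmv : I.Moves P F x (alloc I s') :=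
      ⟨(hpu.shape hpos₅.le).trans hsh, fun m hm => by rw [hM, hpu.loadM_eq, hm]⟩
    -- The rotation changes no load, so over the whole round only `T` can have lost some.
    refine ⟨hg', hx', hmv, hmv.psi_lt hp hx T (fun j' hj' => ?_)
      (ht.elim Or.inl fun h => Or.inr (Or.inl h))⟩
    rw [hJ, hpu.loadJ_eq, hKT, if_neg hj']
    split_ifs <;> linarith

/-! ## The algorithm -/

/-- One round of the algorithm. -/
def round : Prog :=
  .seq scan <|
  .ite (.natEq (cell 11) (.const 0))
    (.ite (.natEq (cell 12) (.const 0)) (.setNat 13 (.const 0) (.const 1)) proposeStep) envyStep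

/-- The algorithm. Variable 13 is set to 1 when a stable allocation is reached. -/
def algorithm : Prog :=
  .ite (.natEq numE (.const 0)) .skip (.loop (.natEq (cell 13) (.const 0)) round)

theorem round_spec {x₀ : Fin I.nE → ℝ} {s : State} (hs : Inp I s) (hg : Good I x₀ s)
    (hx : I.Feasible (alloc I s)) (h13 : s.nat 13 0 = 0) :
    Runs I.size round s fun s' =>
      (s'.nat 13 0 ≠ 0 ∧ Good I x₀ s' ∧ I.Stable (alloc I s')) ∨
      (s'.nat 13 0 = 0 ∧ Inp I s' ∧ Good I x₀ s' ∧ I.Feasible (alloc I s') ∧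
        I.measure (alloc I s') < I.measure (alloc I s)) := by
  refine Runs.seq_of (scan_spec hs hx) fun s₁ ⟨hl, he, ha, P, F, hc, hp⟩ hf₁ => ?_
  have hg₁ := hg.frame hf₁ rfl rfl
  have ha₁ : alloc I s₁ = alloc I s := alloc_frame hf₁ rfl
  have h13₁ : s₁.nat 13 0 = 0 := by rw [hf₁.nat 13 rfl, h13]
  refine Runs.ite (fun h11 => ?_) fun h11 => ?_
  · replace h11 : s₁.nat 11 0 = 0 := h11
    replace he : I.EnvyFree (alloc I s) := by
      obtain ⟨-, he⟩ | ⟨e, f, h, -⟩ := he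
      · exact he
      · omega
    refine Runs.ite (fun h12 => Runs.setNat (Or.inl ?_)) fun h12 => ?_
    · replace h12 : s₁.nat 12 0 = 0 := h12
      refine ⟨by simp [NExp.eval, write_eq], ⟨hg₁.after_eq, hg₁.path⟩, ?_⟩
      refine Eq.subst (motive := I.Stable) ha₁.symm (AllocInstance.stable_of_envyFree hx he ?_)
      obtain ⟨-, ha⟩ | ⟨j, h, -⟩ := ha
      · exact ha
      · omega
    · replace h12 : s₁.nat 12 0 ≠ 0 := h12
      obtain ⟨h, -⟩ | ⟨j, hj, hact⟩ := ha
      · exact absurd h h12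
      · rw [← ha₁] at hl hp hx hact he
        refine (proposeStep_spec hc hl hp hg₁ hx hj hact).mono
          fun s' ⟨hg', hx', hmv, hpsi⟩ hf' => Or.inr ⟨by rw [hf'.nat 13 rfl, h13₁],
            hc.inp.frame hf' rfl, hg', hx', ?_⟩
        rw [← ha₁]
        exact AllocInstance.measure_lt_of_psi_lt he (hmv.envyFree hp hx he) hpsi
  · replace h11 : s₁.nat 11 0 ≠ 0 := h11
    obtain ⟨h, -⟩ | ⟨e, f, h, hcand, hb, hpos⟩ := he
    · exact absurd h h11
    · rw [← ha₁] at hx hcand hpos ⊢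
      refine (envyStep_spec hc.inp hg₁ hx h hcand hb hpos).mono
        fun s' ⟨hg', hx', hphi⟩ hf' => Or.inr ⟨by rw [hf'.nat 13 rfl, h13₁],
          hc.inp.frame hf' rfl, hg', hx', ?_⟩
      exact AllocInstance.measure_lt_of_phi_lt (fun h => h e f hcand hb hpos) hphi

theorem inp_inputState (I : AllocInstance) (x : Fin I.nE → ℝ) : Inp I (inputState I x) := by
  constructor <;> simp [inputState, pad]

theorem good_inputState (I : AllocInstance) (x : Fin I.nE → ℝ) :
    alloc I (inputState I x) = x ∧ Good I x (inputState I x) := by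
  have h : alloc I (inputState I x) = x := by
    funext e
    simp [alloc, inputState, pad]
  exact ⟨h, h.symm, h⟩

/-! ### Counting the operations -/

theorem AllocInstance.nE_le (I : AllocInstance) : I.nE ≤ I.nJ * I.nM := by
  have : Function.Injective fun e => (I.job e, I.mach e) := fun e f h =>
    I.simple e f (Prod.ext_iff.1 h).1 (Prod.ext_iff.1 h).2
  simpa using Fintype.card_le_of_injective _ this

theorem AllocInstance.size_sq_le (I : AllocInstance) (h : I.nE ≠ 0) :
    (I.size + 1) ^ 2 ≤ 9 * ((I.nJ + I.nM) ^ 2 * I.nE) := by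
  have h1 := I.nE_le
  have h2 : 1 ≤ I.nE := Nat.one_le_iff_ne_zero.2 h
  have h3 : I.nE ≤ (I.nJ + I.nM) ^ 2 := h1.trans (by nlinarith)
  rw [AllocInstance.size, Nat.add_assoc I.nE]
  generalize I.nJ + I.nM = V at *
  generalize I.nE = E at *
  have h4 : E * E ≤ V ^ 2 * E := Nat.mul_le_mul_right _ h3
  have h5 : V ^ 2 * 1 ≤ V ^ 2 * E := Nat.mul_le_mul_left _ h2
  -- Cauchy–Schwarz for three terms; each of the three on the right is at most `V ^ 2 * E`, which
  -- gives the factor 9.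
  have h6 : (E + V + 1) ^ 2 ≤ 3 * (E * E + V ^ 2 + 1) := by
    zify
    nlinarith [sq_nonneg ((E : ℤ) - V), sq_nonneg ((E : ℤ) - 1), sq_nonneg ((V : ℤ) - 1)]
  omega

theorem algorithm_spec (I : AllocInstance) (x : Fin I.nE → ℝ) (hx : I.Feasible x) :
    ∃ t s, Exec algorithm (inputState I x) t s ∧
      t ≤ (5 + 45 * (4 + round.bound 1)) * ((I.nJ + I.nM) ^ 2 * I.nE + 1) ∧
      Good I x s ∧ I.Stable (alloc I s) := by
  have hs := inp_inputState I x
  obtain ⟨ha, hg⟩ := good_inputState I x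
  -- Without edges only constant time is allowed, however many vertices there are. The program stops
  -- at once, and stability is vacuous.
  by_cases h0 : I.nE = 0
  · refine ⟨_, _, .iteTrue (by simpa [Test.Holds, NExp.eval, hs.nE] using h0) (.skip _), ?_, hg, ?_⟩
    · generalize round.bound 1 = c
      simp only [Test.cost, NExp.cost]
      exact le_trans (by omega) (Nat.le_mul_of_pos_right _ (Nat.succ_pos _))
    · rw [ha]
      exact ⟨hx, fun e => absurd e.2 (by omega)⟩
  · obtain ⟨t, s, hex, ht, hQ⟩ := Exec.loop_of_measure (N := I.size) (p := round)
      (b := .natEq (cell 13) (.const 0)) (Q := fun s => Good I x s ∧ I.Stable (alloc I s))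
      (fun k s => s.nat 13 0 = 0 ∧ Inp I s ∧ Good I x s ∧ I.Feasible (alloc I s) ∧
        I.measure (alloc I s) = k) (fun k s h => h.1)
      (fun k s ⟨h13, hs, hg, hx, hk⟩ => (round_spec hs hg hx h13).mono fun s' h _ => h.imp id
        fun ⟨h13', hs', hg', hx', hlt⟩ => ⟨_, hk ▸ hlt, h13', hs', hg', hx', rfl⟩)
      _ (inputState I x) ⟨rfl, hs, hg, by rwa [ha], rfl⟩
    refine ⟨_, s, .iteFalse (by simpa [Test.Holds, NExp.eval, hs.nE] using h0) hex, ?_, hQ⟩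
    have h1 : round.bound I.size ≤ round.bound 1 * (I.size + 1) :=
      Prog.bound_le_of_depth_le_one _ _ (by decide)
    have h2 := AllocInstance.measure_le (I := I) (alloc I (inputState I x))
    have h3 := I.size_sq_le h0
    generalize I.measure (alloc I (inputState I x)) = k at *
    -- The factor 5 is the coefficient of `nE`: 4 in `psiMax` and 1 from `phi`. With the factor 9 of
    -- `size_sq_le` it gives the 45; the separate 5 pays for the initial test.
    have h4 : k + 2 ≤ 5 * (I.size + 1) := by
      simp only [AllocInstance.psiMax, AllocInstance.size] at h2 ⊢; omega
    have h5 : (Test.natEq (cell 13) (.const 0)).cost + 1 + round.bound I.size ≤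
        (4 + round.bound 1) * (I.size + 1) := by
      generalize round.bound 1 = c at *
      simp only [Test.cost, NExp.cost]
      nlinarith
    have h6 := ht.trans (Nat.mul_le_mul h4 h5)
    generalize (I.nJ + I.nM) ^ 2 * I.nE = B at *
    generalize I.size = n at *
    generalize round.bound 1 = c at *
    simp only [Test.cost, NExp.cost]
    have h7 : 5 * (n + 1) * ((4 + c) * (n + 1)) = 5 * (4 + c) * (n + 1) ^ 2 := by ring
    have h8 := Nat.mul_le_mul_left (5 * (4 + c)) h3
    linarith

end StableAllocation

/-- There are one program for the real random access machine and one constant `C` such that, for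
every instance and every feasible allocation `x`, the program halts after at most
`C * (|V| ^ 2 * |E| + 1)` elementary operations, and its output is a sequence of better response
steps from `x` to a stable allocation. -/
theorem mainTheorem1 :
    ∃ (p : StableAllocation.Prog) (C : ℕ),
      ∀ (I : StableAllocation.AllocInstance) (x : Fin I.nE → ℝ), I.Feasible x →
        ∃ (t : ℕ) (s : StableAllocation.State) (y : Fin I.nE → ℝ),
          StableAllocation.Exec p (StableAllocation.inputState I x) t s ∧
          t ≤ C * ((I.nJ + I.nM) ^ 2 * I.nE + 1) ∧
          I.ResponsePath x (StableAllocation.decode x s.out) y ∧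
          I.Stable y := by
  refine ⟨StableAllocation.algorithm, 5 + 45 * (4 + StableAllocation.round.bound 1),
    fun I x hx => ?_⟩
  obtain ⟨t, s, hex, ht, hg, hst⟩ := StableAllocation.algorithm_spec I x hx
  exact ⟨t, s, _, hex, ht, hg.path, hst⟩
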